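/- **Notation.** For $y=(y_1,y_2)\in\mathbb R^2$ put $y^\perp=(-y_2,y_1)$, $\nabla^\perp f=(\nabla f)^\perp$; $\operatorname{curl}v=\partial_1v_2-\partial_2v_1$ in the sense of distributions. Depth functions are $L^\infty$ functions and pointwise conditions on them are meant almost everywhere. **Lakes.** A *lake with one non-degenerated island* is a pair $(\Omega,b)$ with $\Omega=\widetilde\Omega\setminus\mathcal I$, where $\widetilde\Omega\subset\mathbb R^2$ is open, bounded and simply connected and $\mathcal I\subset\widetilde\Omega$ is compact, simply connected and contains at least two points; $b\in L^\infty(\Omega)$, $b\ge0$, and for every compact $K\subset\Omega$ there is $\theta_K>0$ with $b\ge\theta_K$ on $K$; there are exponents $a_0,a_1\ge0$ and neighbourhoods $\mathcal O^0$ of $\partial\widetilde\Omega$ and $\mathcal O^1$ of $\partial\mathcal I$ such that $b(x)=c(x)\operatorname{dist}(x,\partial\Omega)^{a_k}$ in $\mathcal O^k\cap\Omega$ ($k=0,1$) with $c$ bounded and $c\ge\theta>0$; and $\partial\widetilde\Omega$ (resp. $\partial\mathcal I$) is a regular $C^1$ Jordan curve if $a_0>0$ (resp. $a_1>0$). A *punctured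 lake* is a pair $(\Omega,b)$ with $\Omega\subset\mathbb R^2$ open, bounded, simply connected, $0\in\Omega$; $b\in L^\infty(\Omega)$, $b\ge0$, and for every compact $K\subset\Omega\setminus\{0\}$ there is $\theta_K>0$ with $b\ge\theta_K$ on $K$; there are $a_0\ge0$, $a_1\in(0,2)$ and neighbourhoods $\mathcal O^0$ of $\partial\Omega$ and $\mathcal O^1$ of $0$ such that $b(x)=c(x)\operatorname{dist}(x,\partial\Omega\cup\{0\})^{a_k}$ in $\mathcal O^k\cap\Omega$ with $c$ bounded and $c\ge\theta>0$; and $\partial\Omega$ is a regular $C^1$ Jordan curve if $a_0>0$. A family $(\Omega_\varepsilon,b_\varepsilon)_{\varepsilon>0}$, $\Omega_\varepsilon=\widetilde\Omega_\varepsilon\setminus\mathcal I_\varepsilon$, of lakes with one non-degenerated island *converges* to the punctured lake $(\Omega,b)$ as $\varepsilon\to0$ if, with $b_\varepsilon$ extended by $0$: (1) $\Omega_\varepsilon\to\Omega\setminus\{0\}$ in the Hausdorff sense (the complements converge in the Hausdorff distance) and $\Omega_\varepsilon\subset\Omega$; (2) $b_\varepsilon\le C_0\,b$ in $\Omega$ for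 some $C_0>0$ independent of $\varepsilon$; (3) $b_\varepsilon\to b$ in $L^1_{\rm loc}(\Omega\setminus\{0\})$, and for every compact $K\subset\Omega\setminus\{0\}$ there are $\theta_K,\varepsilon_K>0$ with $b_\varepsilon\ge\theta_K$ on $K$ for $\varepsilon\in(0,\varepsilon_K]$. (It is enough that the lake condition, $\Omega_\varepsilon\subset\Omega$ and (2) hold for all sufficiently small $\varepsilon$.) **Harmonic functions.** Let $(\Omega,b)$, $\Omega=\widetilde\Omega\setminus\mathcal I$, be a lake with one island. A *cut-off* is a function $\chi\in C_c^\infty(\widetilde\Omega)$ with $\chi=1$ in a neighbourhood of $\mathcal I$. A function $\Phi$ is *$b$-harmonic* if $\Phi\in H^1_0(\widetilde\Omega)$, $b^{-1/2}\nabla\Phi\in L^2(\Omega)$, $\operatorname{div}(b^{-1}\nabla\Phi)=0$ in $\mathcal D'(\Omega)$, and there is a constant $c$ with $\Phi-c\chi\in H^1_0(\Omega)$ for all cut-offs $\chi$; if this holds with $c=1$, we write $\Phi|_{\partial\mathcal I}=1$. The circulation of a vector field $v$ with $\operatorname{curl}v\in L^1(\Omega)$ is $\gamma(v)=-\int_\Omega\chi\operatorname{curl}v\,dx-\int_\Omega\nabla^\perp\chi\cdot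 v\,dx$, which for the fields below does not depend on the cut-off $\chi$. Let $\phi^1$ be the $b$-harmonic function with $\phi^1|_{\partial\mathcal I}=1$ and $\psi^1$ the $b$-harmonic function with $\gamma(b^{-1}\nabla^\perp\psi^1)=1$; on $(\Omega_\varepsilon,b_\varepsilon)$ they are denoted $\phi^1_\varepsilon,\psi^1_\varepsilon$. **Theorem.** (i) Let $(\Omega,b)$ be a punctured lake. There is a constant $C=C(\Omega,b)>0$ such that for every family $(\Omega_\varepsilon,b_\varepsilon)$ of lakes with one non-degenerated island that converges to $(\Omega,b)$ and for all sufficiently small $\varepsilon>0$ (how small may depend on the family), $\phi^1_\varepsilon$ and $\psi^1_\varepsilon$ exist, are unique, and satisfy $$\|\phi^1_\varepsilon\|_{H^1(\Omega_\varepsilon)}+\big\|b_\varepsilon^{-1/2}\nabla\phi^1_\varepsilon\big\|_{L^2(\Omega_\varepsilon)}\le C,\qquad \|\psi^1_\varepsilon\|_{H^1(\Omega_\varepsilon)}+\big\|b_\varepsilon^{-1/2}\nabla\psi^1_\varepsilon\big\|_{L^2(\Omega_\varepsilon)}\le C .$$ (ii) For flat bottoms the bound fails: let $\widetilde\Omega_\varepsilon=B(0,1)$,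 $\mathcal I_\varepsilon=\overline B(0,r_\varepsilon)$ with $r_\varepsilon>0$, $r_\varepsilon\to0$, and let $b_\varepsilon$ be constants in $x$ with $b_\varepsilon\to b_0>0$. Then for all small $\varepsilon$ these are lakes with one non-degenerated island, $\psi^1_\varepsilon$ exists and is unique, and $\|\nabla\psi^1_\varepsilon\|_{L^2(\Omega_\varepsilon)}\to\infty$ and $\|b_\varepsilon^{-1/2}\nabla\psi^1_\varepsilon\|_{L^2(\Omega_\varepsilon)}\to\infty$ as $\varepsilon\to0$. -/

import Mathlib

open MeasureTheory Filter Topology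
open scoped ENNReal ContDiff

noncomputable section

namespace LakeEq

/-- The Euclidean plane. -/
abbrev Plane : Type := EuclideanSpace ℝ (Fin 2)

/-- Counterclockwise rotation by a right angle, so that `∇^⊥ f = rot (∇ f) = (-∂₂ f, ∂₁ f)`. -/
def rot (y : Plane) : Plane := !₂[-(y 1), y 0]

/-- Test functions on `U`: elements of `C_c^∞(U)`, extended by zero to the plane. -/
structure IsTest (U : Set Plane) (η : Plane → ℝ) : Prop where
  smooth : ContDiff ℝ ∞ η
  compactSupp : HasCompactSupport η
  supp_subset : tsupport η ⊆ U

/-! ### Lakes -/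

/-- `Γ` is a `C^1` Jordan curve: the image of a regular, simple, closed `C^1` curve. -/
def IsC1JordanCurve (Γ : Set Plane) : Prop :=
  ∃ γ : ℝ → Plane, ContDiff ℝ 1 γ ∧ Function.Periodic γ 1 ∧ Set.InjOn γ (Set.Ico 0 1) ∧
    (∀ t, deriv γ t ≠ 0) ∧ Set.range γ = Γ

/-- In a neighbourhood of `Γ`, inside `Ω`, the depth is `b(x) = c(x) dist(x, S)^a` with `c` bounded
and bounded below by a positive constant. -/
def HasShore (Ω Γ S : Set Plane) (b : Plane → ℝ) (a : ℝ) : Prop :=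
  ∃ O : Set Plane, IsOpen O ∧ Γ ⊆ O ∧ ∃ (c : Plane → ℝ) (θ M : ℝ), 0 < θ ∧
    ∀ᵐ x ∂(volume.restrict (O ∩ Ω)), θ ≤ c x ∧ c x ≤ M ∧ b x = c x * Metric.infDist x S ^ a

/-- `(Ωt \ I, b)` is a lake with one non-degenerated island `I` and outer domain `Ωt`. The depth `b`
is an element of `L^∞(Ωt \ I)`, only its values there (up to null sets) matter. -/
structure IsIslandLake (Ωt I : Set Plane) (b : Plane → ℝ) : Prop where
  isOpen : IsOpen Ωt
  isBounded : Bornology.IsBounded Ωt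
  simplyConnected : IsSimplyConnected Ωt
  island_compact : IsCompact I
  island_simplyConnected : IsSimplyConnected I
  island_subset : I ⊆ Ωt
  island_nontrivial : I.Nontrivial
  depth_memLp : MemLp b ∞ (volume.restrict (Ωt \ I))
  depth_nonneg : ∀ᵐ x ∂(volume.restrict (Ωt \ I)), 0 ≤ b x
  depth_lower : ∀ K : Set Plane, IsCompact K → K ⊆ Ωt \ I →
    ∃ θ : ℝ, 0 < θ ∧ ∀ᵐ x ∂(volume.restrict K), θ ≤ b x
  outer_shore : ∃ a₀ : ℝ, 0 ≤ a₀ ∧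
    HasShore (Ωt \ I) (frontier Ωt) (frontier (Ωt \ I)) b a₀ ∧
    (0 < a₀ → IsC1JordanCurve (frontier Ωt))
  island_shore : ∃ a₁ : ℝ, 0 ≤ a₁ ∧
    HasShore (Ωt \ I) (frontier I) (frontier (Ωt \ I)) b a₁ ∧
    (0 < a₁ → IsC1JordanCurve (frontier I))

/-- `(Ω, b)` is a lake punctured at the origin. -/
structure IsPuncturedLake (Ω : Set Plane) (b : Plane → ℝ) : Prop where
  isOpen : IsOpen Ω
  isBounded : Bornology.IsBounded Ω
  simplyConnected : IsSimplyConnected Ω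
  zero_mem : (0 : Plane) ∈ Ω
  depth_memLp : MemLp b ∞ (volume.restrict Ω)
  depth_nonneg : ∀ᵐ x ∂(volume.restrict Ω), 0 ≤ b x
  depth_lower : ∀ K : Set Plane, IsCompact K → K ⊆ Ω \ {0} →
    ∃ θ : ℝ, 0 < θ ∧ ∀ᵐ x ∂(volume.restrict K), θ ≤ b x
  outer_shore : ∃ a₀ : ℝ, 0 ≤ a₀ ∧ HasShore Ω (frontier Ω) (frontier Ω ∪ {0}) b a₀ ∧
    (0 < a₀ → IsC1JordanCurve (frontier Ω))
  origin_shore : ∃ a₁ : ℝ, 0 < a₁ ∧ a₁ < 2 ∧ HasShore Ω {0} (frontier Ω ∪ {0}) b a₁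

/-- The lakes `(Ωt ε \ I ε, bε ε)`, with one non-degenerated island each, converge as `ε → 0⁺` to the
punctured lake `(Ω, b)`. Hausdorff convergence of open sets is Hausdorff convergence of their
complements (complements in the plane give the same distances here as complements in a large closed
ball, because all the domains are contained in the bounded set `Ω`). -/
structure IsEvanescent (Ω : Set Plane) (b : Plane → ℝ)
    (Ωt I : ℝ → Set Plane) (bε : ℝ → Plane → ℝ) : Prop where
  lake : ∀ᶠ ε in 𝓝[>] (0 : ℝ), IsIslandLake (Ωt ε) (I ε) (bε ε)
  hausdorff : Tendsto (fun ε => Metric.hausdorffEDist (Ωt ε \ I ε)ᶜ (Ω \ {0})ᶜ)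
    (𝓝[>] (0 : ℝ)) (𝓝 0)
  subset : ∀ᶠ ε in 𝓝[>] (0 : ℝ), Ωt ε \ I ε ⊆ Ω
  depth_le : ∃ C : ℝ, 0 < C ∧ ∀ᶠ ε in 𝓝[>] (0 : ℝ),
    ∀ᵐ x ∂(volume.restrict Ω), (Ωt ε \ I ε).indicator (bε ε) x ≤ C * b x
  depth_tendsto : ∀ K : Set Plane, IsCompact K → K ⊆ Ω \ {0} →
    Tendsto (fun ε => eLpNorm (fun x => (Ωt ε \ I ε).indicator (bε ε) x - b x) 1
      (volume.restrict K)) (𝓝[>] (0 : ℝ)) (𝓝 0)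
  depth_lower : ∀ K : Set Plane, IsCompact K → K ⊆ Ω \ {0} →
    ∃ θ : ℝ, 0 < θ ∧ ∀ᶠ ε in 𝓝[>] (0 : ℝ),
      ∀ᵐ x ∂(volume.restrict K), θ ≤ (Ωt ε \ I ε).indicator (bε ε) x

/-! ### Function spaces and norms -/

/-- `Φ ∈ H^1_0(U)` (extended by zero to the plane) with gradient `G`: the pair `(Φ, G)` is the limit
in `L^2` of pairs `(φ, ∇φ)` with `φ ∈ C_c^∞(U)`. -/
def IsH10 (U : Set Plane) (Φ : Plane → ℝ) (G : Plane → Plane) : Prop :=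
  MemLp Φ 2 volume ∧ MemLp G 2 volume ∧
    ∃ φ : ℕ → Plane → ℝ, (∀ n, IsTest U (φ n)) ∧
      Tendsto (fun n => eLpNorm (fun x => φ n x - Φ x) 2 volume) atTop (𝓝 0) ∧
      Tendsto (fun n => eLpNorm (fun x => gradient (φ n) x - G x) 2 volume) atTop (𝓝 0)

/-- The `H^1(U)` norm of a function `Φ` with gradient `G`. -/
def h1Norm (U : Set Plane) (Φ : Plane → ℝ) (G : Plane → Plane) : ℝ≥0∞ :=
  (eLpNorm Φ 2 (volume.restrict U) ^ 2 + eLpNorm G 2 (volume.restrict U) ^ 2) ^ (1 / 2 : ℝ)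

/-- The weighted norm `‖b^{-1/2} G‖_{L^2(U)}`. -/
def weightedNorm (U : Set Plane) (b : Plane → ℝ) (G : Plane → Plane) : ℝ≥0∞ :=
  eLpNorm (fun x => (Real.sqrt (b x))⁻¹ • G x) 2 (volume.restrict U)

/-! ### `b`-harmonic functions and circulation -/

/-- A smooth cut-off function `χ ∈ C_c^∞(Ωt)` equal to `1` in a neighbourhood of the island `I`. -/
def IsCutoff (Ωt I : Set Plane) (χ : Plane → ℝ) : Prop :=
  IsTest Ωt χ ∧ ∀ᶠ x in 𝓝ˢ I, χ x = 1

/-- `Φ` (with gradient `G`) vanishes on `∂Ωt` and equals the constant `c` on `∂I`, in the sense that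
`Φ - c χ ∈ H^1_0(Ωt \ I)` for the cut-off functions `χ` (whose choice is immaterial). -/
def HasIslandTrace (Ωt I : Set Plane) (Φ : Plane → ℝ) (G : Plane → Plane) (c : ℝ) : Prop :=
  ∀ χ : Plane → ℝ, IsCutoff Ωt I χ →
    IsH10 (Ωt \ I) (fun x => Φ x - c * χ x) (fun x => G x - c • gradient χ x)

/-- `Φ` (with gradient `G`) is `b`-harmonic in the lake `(Ωt \ I, b)`; the equation
`div (b⁻¹ ∇Φ) = 0` holds in the sense of distributions in `Ωt \ I`. -/
structure IsBHarmonic (Ωt I : Set Plane) (b : Plane → ℝ) (Φ : Plane → ℝ) (G : Plane → Plane) :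
    Prop where
  h10 : IsH10 Ωt Φ G
  weighted : MemLp (fun x => (Real.sqrt (b x))⁻¹ • G x) 2 (volume.restrict (Ωt \ I))
  equation : ∀ η : Plane → ℝ, IsTest (Ωt \ I) η →
    ∫ x in Ωt \ I, (b x)⁻¹ * inner ℝ (G x) (gradient η x) = 0
  trace : ∃ c : ℝ, HasIslandTrace Ωt I Φ G c

/-- `curl v = w` in the sense of distributions in `U`. -/
def HasWeakCurl (U : Set Plane) (v : Plane → Plane) (w : Plane → ℝ) : Prop :=
  ∀ η : Plane → ℝ, IsTest U η →
    ∫ x in U, w x * η x = -∫ x in U, inner ℝ (rot (gradient η x)) (v x)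

/-- The generalized circulation of `v` around the island `I` is `κ`, that is, `curl v ∈ L^1(Ωt \ I)` and
`κ = -∫ χ curl v - ∫ ∇^⊥ χ · v` for the cut-off functions `χ` (whose choice is immaterial). -/
def HasCirculation (Ωt I : Set Plane) (v : Plane → Plane) (κ : ℝ) : Prop :=
  ∃ w : Plane → ℝ, IntegrableOn w (Ωt \ I) ∧ HasWeakCurl (Ωt \ I) v w ∧
    ∀ χ : Plane → ℝ, IsCutoff Ωt I χ →
      κ = -(∫ x in Ωt \ I, χ x * w x) - ∫ x in Ωt \ I, inner ℝ (rot (gradient χ x)) (v x)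

/-- `φ` (with gradient `G`) is the `b`-harmonic function equal to `1` on the island. -/
def IsPhiOne (Ωt I : Set Plane) (b : Plane → ℝ) (φ : Plane → ℝ) (G : Plane → Plane) : Prop :=
  IsBHarmonic Ωt I b φ G ∧ HasIslandTrace Ωt I φ G 1

/-- `ψ` (with gradient `G`) is the `b`-harmonic function for which the velocity field `b⁻¹ ∇^⊥ ψ` has
circulation `1` around the island. -/
def IsPsiOne (Ωt I : Set Plane) (b : Plane → ℝ) (ψ : Plane → ℝ) (G : Plane → Plane) : Prop :=
  IsBHarmonic Ωt I b ψ G ∧ HasCirculation Ωt I (fun x => (b x)⁻¹ • rot (G x)) 1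

/-- There is one and, up to null sets, only one function `f` (with gradient `G`) satisfying `P`. -/
def ExistsUniqueAE (P : (Plane → ℝ) → (Plane → Plane) → Prop) : Prop :=
  (∃ f G, P f G) ∧ ∀ f G f' G', P f G → P f' G' → f =ᵐ[volume] f' ∧ G =ᵐ[volume] G'

end LakeEq

end

/-! Everything reduces to the capacity of the island. For a condenser `(Ωt, I)` with depth `b`, let
`k` be the limit of weighted gradients `b^{-1/2}∇χ` of cut-offs that is orthogonal in `L²` to the
weighted gradients of all test functions. It is the weighted gradient of `φ¹`, and `‖k‖²` is the
capacity. Any `b`-harmonic function with value `c` on the island is `c φ¹` and has circulation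
`-c‖k‖²`; hence `ψ¹ = -‖k‖⁻² φ¹`, with weighted energy norm `1/‖k‖`. Part (i) asks for capacities
bounded above and away from zero, part (ii) for capacities tending to zero.

The identification of `φ¹` with `k`, and uniqueness, need test functions to be dense among the
`H^1_0` functions of finite weighted energy (`IsIslandLake.exists_isTest_approx`). Near the shore,
every circle of small radius around a point outside the lake meets the complement, because the
island is connected with two points and the outer domain is simply connected. A Poincaré inequality
on discs follows, and the shore law `b ~ dist^a` turns it into a weighted Hardy inequality on a
collar, which controls the error of cutting off.

For (i), the puncture itself has positive capacity (`IsPuncturedLake.norm_pos`): a cut-off has `2π =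
2π χ(0) ≤ ∫ |∇χ|/|x|`, which by Cauchy–Schwarz is at most the weighted energy norm times `(∫
b|x|⁻²)^{1/2}`, and this integral is finite since `b ~ |x|^a` with `a > 0`. Hausdorff convergence
and `b_ε ≤ C₀ b` force the island to contain the origin and to shrink to it, so a cut-off of the
lake is a cut-off of the puncture. Testing the puncture potential `k` with it gives `‖k‖² ≤
‖(b_ε/b)^{1/2} k‖ ‖k_ε‖` (`IsPotential.norm_sq_le`). The middle factor is close to `‖k‖`:
approximate `k` by one cut-off `f`, use `b_ε → b` on the support of `∇f`, and use `b_ε ≤ C₀ b` only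
on the small remainder. The same `f` bounds `‖k_ε‖` from above.

The unweighted bound must not depend on `C₀`, which belongs to the family. By Pythagoras the energy
of `f - φ¹_ε` is the difference of two energies that are nearly equal, hence so small that it
absorbs the factor `C₀`; what remains is the norm of `∇f`, controlled by `(Ω, b)` alone.

For (ii), `N` dyadic rescalings of one cut-off have gradients in disjoint annuli and equal energy
bounds, by scale invariance of the Dirichlet integral in the plane. Their average is a cut-off of
energy `O(1/N)`, so the capacity of the disc tends to zero. -/

noncomputable section

namespace LakeEq

/-! ### Topology of simply connected sets and continua in the plane -/

/-- The unit vector of polar angle `θ`. -/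
def dir (θ : ℝ) : Plane := !₂[Real.cos θ, Real.sin θ]

lemma norm_dir (θ : ℝ) : ‖dir θ‖ = 1 := by
  simp [dir, EuclideanSpace.norm_eq, Fin.sum_univ_two]

lemma hasDerivAt_dir (θ : ℝ) : HasDerivAt dir (rot (dir θ)) θ := by
  have h : HasDerivAt (fun t => ![Real.cos t, Real.sin t]) ![-Real.sin θ, Real.cos θ] θ := by
    refine hasDerivAt_pi.2 fun i => ?_
    fin_cases i
    · simpa using Real.hasDerivAt_cos θ
    · simpa using Real.hasDerivAt_sin θ
  exact ((EuclideanSpace.equiv (Fin 2) ℝ).symm.toContinuousLinearMap).hasFDerivAt.comp_hasDerivAt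
    θ h

lemma continuous_dir : Continuous dir :=
  continuous_iff_continuousAt.2 fun θ => (hasDerivAt_dir θ).continuousAt

lemma norm_rot (y : Plane) : ‖rot y‖ = ‖y‖ := by
  simp [rot, EuclideanSpace.norm_eq, Fin.sum_univ_two, add_comm]

lemma inner_rot (x y : Plane) : inner ℝ (rot x) (rot y) = inner ℝ x y := by
  simp [rot, PiLp.inner_apply, Fin.sum_univ_two, add_comm]

/-- A simply connected open set that misses `z` contains no circle centred at `z`. -/
lemma exists_mem_sphere_notMem {S : Set Plane} (hS : IsSimplyConnected S) (hSo : IsOpen S)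
    {z : Plane} (hz : z ∉ S) {r : ℝ} (hr : 0 < r) : ∃ y ∈ Metric.sphere z r, y ∉ S := by
  by_contra! hsub
  -- Simple connectedness gives a continuous logarithm `L` of `x - z`, read as a nonvanishing
  -- complex number on `S`.
  obtain ⟨L, hLc, hL⟩ := Complex.exists_continuousOn_eqOn_exp_comp hS hSo
    (g := fun x : Plane => ((x - z) 0 : ℂ) + ((x - z) 1 : ℂ) * Complex.I) (by fun_prop) (by
      rintro ⟨x, hx, hx0⟩
      apply hz
      have h0 := congrArg Complex.re hx0
      have h1 := congrArg Complex.im hx0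
      simp at h0 h1
      have : x = z := by
        ext i; fin_cases i
        · simpa using sub_eq_zero.1 h0
        · simpa using sub_eq_zero.1 h1
      rwa [← this])
  have hmem : ∀ t, z + r • dir t ∈ S := fun t => hsub _ (by simp [norm_smul, norm_dir, hr.le])
  have hcont : Continuous fun t : ℝ => L (z + r • dir t) :=
    hLc.comp_continuous (continuous_const.add (continuous_dir.const_smul r)) hmem
  have hexp : ∀ t : ℝ, Complex.exp (L (z + r • dir t) - t * Complex.I) = r := by
    intro t
    have := hL (hmem t)
    simp only [Function.comp] at this
    rw [Complex.exp_sub, this, Complex.exp_mul_I]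
    have hne : Complex.cos t + Complex.sin t * Complex.I ≠ 0 := by
      rw [← Complex.exp_mul_I]; exact Complex.exp_ne_zero _
    rw [div_eq_iff hne]
    simp [dir]; ring
  set k : ℝ → ℝ := fun t => (L (z + r • dir t)).im - t with hk
  have hkc : Continuous k := (Complex.continuous_im.comp hcont).sub continuous_id
  have hper : k (2 * Real.pi) = k 0 - 2 * Real.pi := by
    have : dir (2 * Real.pi) = dir 0 := by simp [dir]
    simp [hk, this]
  -- Along the circle, `Im L` minus the angle stays in one coset of `2πℤ`, yet it is continuous and
  -- drops by `2π` in a turn. The value half way down is attained but lies outside the coset.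
  have hmid : k 0 - Real.pi ∈ k '' Set.Icc 0 (2 * Real.pi) := by
    apply intermediate_value_Icc' (by positivity) hkc.continuousOn
    rw [hper]
    constructor <;> linarith [Real.pi_pos]
  obtain ⟨t, -, ht⟩ := hmid
  have h1 := (hexp t).trans (hexp 0).symm
  rw [Complex.exp_eq_exp_iff_exists_int] at h1
  obtain ⟨n, hn⟩ := h1
  have h2 := congrArg Complex.im hn
  simp at h2
  have h3 : k t = k 0 + n * (2 * Real.pi) := by
    simp only [hk]; simp; linarith
  rw [ht] at h3
  have h4 : (2 * n + 1 : ℝ) * Real.pi = 0 := by linarith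
  rcases mul_eq_zero.1 h4 with h | h
  · have : (2 * n + 1 : ℤ) = 0 := by exact_mod_cast h
    omega
  · exact Real.pi_ne_zero h

/-- A connected set meets the circles around one of its points that separate it from another. -/
lemma exists_mem_sphere_of_isPreconnected {I : Set Plane} (hI : IsPreconnected I) {z w : Plane}
    (hz : z ∈ I) (hw : w ∈ I) {r : ℝ} (hr : 0 ≤ r) (hrw : r ≤ dist w z) :
    ∃ y ∈ Metric.sphere z r, y ∈ I := by
  have h := hI.intermediate_value hz hw (f := fun y => dist y z) (by fun_prop)
  obtain ⟨y, hy, hyr⟩ := h ⟨by simpa using hr, hrw⟩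
  exact ⟨y, hyr, hy⟩

lemma exists_mem_frontier_dist_le {A : Set Plane} {y z : Plane} (hy : y ∈ A) (hz : z ∉ A) :
    ∃ w ∈ frontier A, dist y w ≤ dist y z := by
  obtain ⟨w, hw, hwd⟩ := exists_mem_frontier_infDist_compl_eq_dist hy
    (fun h => hz (h ▸ Set.mem_univ z))
  exact ⟨w, hw, hwd ▸ Metric.infDist_le_dist_of_mem hz⟩

/-! ### Polar coordinates and Poincaré inequalities -/

lemma lintegral_plane_eq_polar {g : Plane → ℝ≥0∞} (hg : Measurable g) :
    ∫⁻ x, g x = ∫⁻ r in Set.Ioi (0 : ℝ), ∫⁻ θ in Set.Ioo (-Real.pi) Real.pi,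
      ENNReal.ofReal r * g (r • dir θ) := by
  have hT := Complex.orthonormalBasisOneI.repr.measurePreserving
  rw [← hT.lintegral_comp hg, ← Complex.lintegral_comp_polarCoord_symm]
  have hT' : ∀ p : ℝ × ℝ, Complex.orthonormalBasisOneI.repr (Complex.polarCoord.symm p)
      = p.1 • dir p.2 := by
    intro p
    ext i
    rw [Complex.orthonormalBasisOneI_repr_apply]
    fin_cases i
    · simpa [dir] using Or.inl (Complex.cos_ofReal_re _)
    · simpa [dir] using Or.inl (Complex.sin_ofReal_re _)
  simp only [hT', smul_eq_mul, polarCoord_target]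
  rw [Measure.volume_eq_prod, ← Measure.prod_restrict, lintegral_prod]
  have := continuous_dir.measurable
  exact (Measurable.mul (by fun_prop) (hg.comp (by fun_prop))).aemeasurable

lemma lintegral_ball_eq_polar {g : Plane → ℝ≥0∞} (hg : Measurable g) (z : Plane) (R : ℝ) :
    ∫⁻ x in Metric.ball z R, g x = ∫⁻ r in Set.Ioo 0 R, ∫⁻ θ in Set.Ioo (-Real.pi) Real.pi,
      ENNReal.ofReal r * g (z + r • dir θ) := by
  rw [← lintegral_indicator Metric.isOpen_ball.measurableSet, ← lintegral_add_left_eq_self _ z,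
    lintegral_plane_eq_polar]
  swap
  · exact (hg.indicator Metric.isOpen_ball.measurableSet).comp (measurable_const_add z)
  rw [← Measure.restrict_restrict_of_subset (show Set.Ioo 0 R ⊆ Set.Ioi 0 from Set.Ioo_subset_Ioi_self),
    ← lintegral_indicator measurableSet_Ioo]
  refine setLIntegral_congr_fun measurableSet_Ioi fun r hr => ?_
  have hr' : 0 < r := hr
  have hmem : ∀ θ, z + r • dir θ ∈ Metric.ball z R ↔ r < R := by
    intro θ
    simp [norm_smul, norm_dir, abs_of_pos hr']
  by_cases h : r < R
  · simp [Set.indicator, hmem, h, hr']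
  · simp [Set.indicator, hmem, h]

lemma lintegral_mul_sq_le {α : Type*} [MeasurableSpace α] (μ : Measure α) {f g : α → ℝ≥0∞}
    (hf : AEMeasurable f μ) (hg : AEMeasurable g μ) :
    (∫⁻ a, f a * g a ∂μ) ^ 2 ≤ (∫⁻ a, f a ^ 2 ∂μ) * ∫⁻ a, g a ^ 2 ∂μ := by
  have h := ENNReal.lintegral_mul_le_Lp_mul_Lq μ Real.HolderConjugate.two_two hf hg
  have h2 : ∀ x : ℝ≥0∞, (x ^ (1 / 2 : ℝ)) ^ 2 = x := by
    intro x
    rw [← ENNReal.rpow_natCast, ← ENNReal.rpow_mul]; norm_num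
  calc _ ≤ ((∫⁻ a, f a ^ (2 : ℝ) ∂μ) ^ (1 / 2 : ℝ) * (∫⁻ a, g a ^ (2 : ℝ) ∂μ) ^ (1 / 2 : ℝ)) ^ 2 :=
        pow_le_pow_left₀ zero_le h 2
    _ = _ := by rw [mul_pow, h2, h2]; simp

lemma norm_gradient {f : Plane → ℝ} (x : Plane) : ‖gradient f x‖ = ‖fderiv ℝ f x‖ := by
  simp [gradient]

lemma continuous_gradient {f : Plane → ℝ} (hf : ContDiff ℝ 1 f) : Continuous (gradient f) :=
  (LinearIsometryEquiv.continuous _).comp (hf.continuous_fderiv one_ne_zero)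

/-- A function on `[-π, π]` with a zero is bounded by the integral of its derivative. -/
lemma lintegral_sq_le_of_zero {u u' : ℝ → ℝ} (hu : ∀ t, HasDerivAt u (u' t) t)
    (hu' : Continuous u') {t₀ : ℝ} (ht₀ : t₀ ∈ Set.Icc (-Real.pi) Real.pi) (h0 : u t₀ = 0) :
    ∫⁻ t in Set.Ioo (-Real.pi) Real.pi, ‖u t‖ₑ ^ 2 ≤
      ENNReal.ofReal (2 * Real.pi) ^ 2 * ∫⁻ t in Set.Ioo (-Real.pi) Real.pi, ‖u' t‖ₑ ^ 2 := by
  have hpt : ∀ t ∈ Set.Ioo (-Real.pi) Real.pi,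
      ‖u t‖ₑ ≤ ∫⁻ s in Set.Ioo (-Real.pi) Real.pi, ‖u' s‖ₑ := by
    intro t ht
    have h1 : ∫ s in t₀..t, u' s = u t := by
      rw [intervalIntegral.integral_eq_sub_of_hasDerivAt (fun s _ => hu s)
        (hu'.intervalIntegrable _ _), h0, sub_zero]
    rw [← h1, intervalIntegral.intervalIntegral_eq_integral_uIoc]
    have h2 : ‖(if t₀ ≤ t then (1 : ℝ) else -1) • ∫ s in Set.uIoc t₀ t, u' s‖ₑ
        = ‖∫ s in Set.uIoc t₀ t, u' s‖ₑ := by split_ifs <;> simp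
    rw [h2]
    refine (enorm_integral_le_lintegral_enorm _).trans ?_
    rw [restrict_Ioo_eq_restrict_Ioc]
    refine lintegral_mono_set fun s hs => ?_
    rw [Set.mem_uIoc] at hs
    rcases hs with hs | hs
    · exact ⟨by linarith [ht₀.1], by linarith [ht.2]⟩
    · exact ⟨by linarith [ht.1], by linarith [ht₀.2]⟩
  have hvol : (volume.restrict (Set.Ioo (-Real.pi) Real.pi)) Set.univ
      = ENNReal.ofReal (2 * Real.pi) := by
    rw [Measure.restrict_apply_univ, Real.volume_Ioo]; congr 1; ring
  -- One factor `2π` comes from Cauchy–Schwarz, the other from integrating the resulting constant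
  -- over the interval.
  calc _ ≤ ∫⁻ t in Set.Ioo (-Real.pi) Real.pi,
        (∫⁻ s in Set.Ioo (-Real.pi) Real.pi, 1 * ‖u' s‖ₑ) ^ 2 :=
      setLIntegral_mono (by fun_prop) fun t ht =>
        pow_le_pow_left₀ zero_le (by simpa using hpt t ht) 2
    _ = (∫⁻ s in Set.Ioo (-Real.pi) Real.pi, 1 * ‖u' s‖ₑ) ^ 2 * ENNReal.ofReal (2 * Real.pi) := by
      rw [lintegral_const, hvol]
    _ ≤ ((∫⁻ s in Set.Ioo (-Real.pi) Real.pi, 1 ^ 2) *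
        ∫⁻ s in Set.Ioo (-Real.pi) Real.pi, ‖u' s‖ₑ ^ 2) * ENNReal.ofReal (2 * Real.pi) := by
      gcongr
      exact lintegral_mul_sq_le _ aemeasurable_const (by fun_prop)
    _ = _ := by
      rw [one_pow, lintegral_one, hvol]; ring

lemma exists_eq_add_smul_dir {z y : Plane} {r : ℝ} (hy : y ∈ Metric.sphere z r) :
    ∃ θ ∈ Set.Icc (-Real.pi) Real.pi, y = z + r • dir θ := by
  set w : ℂ := ((y - z) 0 : ℂ) + ((y - z) 1 : ℂ) * Complex.I with hw
  have hn : ‖w‖ = r := by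
    have : ‖y - z‖ = r := by simpa [dist_eq_norm] using hy
    rw [← this, EuclideanSpace.norm_eq, Complex.norm_eq_sqrt_sq_add_sq, Fin.sum_univ_two]
    simp [hw]
  refine ⟨w.arg, ⟨(Complex.neg_pi_lt_arg w).le, Complex.arg_le_pi w⟩, ?_⟩
  have hc := Complex.norm_mul_cos_arg w
  have hs := Complex.norm_mul_sin_arg w
  rw [hn] at hc hs
  clear_value w
  subst hw
  ext i
  fin_cases i
  · simp [dir] at hc ⊢; linarith
  · simp [dir] at hs ⊢; linarith

/-- Poincaré inequality on a disc, for functions with a zero on each concentric circle. -/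
lemma lintegral_ball_sq_le {f : Plane → ℝ} (hf : ContDiff ℝ 1 f) {z : Plane} {R : ℝ}
    (hz : ∀ r, 0 < r → r < R → ∃ y ∈ Metric.sphere z r, f y = 0) :
    ∫⁻ x in Metric.ball z R, ‖f x‖ₑ ^ 2 ≤
      ENNReal.ofReal (2 * Real.pi * R) ^ 2 * ∫⁻ x in Metric.ball z R, ‖gradient f x‖ₑ ^ 2 := by
  have hgc := continuous_gradient hf
  have hfc := hf.continuous
  rw [lintegral_ball_eq_polar (by fun_prop), lintegral_ball_eq_polar (by fun_prop),
    ← lintegral_const_mul' _ _ (by finiteness)]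
  refine setLIntegral_mono' measurableSet_Ioo fun r hr => ?_
  obtain ⟨y, hy, hy0⟩ := hz r hr.1 hr.2
  obtain ⟨θ, hθ, rfl⟩ := exists_eq_add_smul_dir hy
  have hder : ∀ t, HasDerivAt (fun t => f (z + r • dir t))
      (fderiv ℝ f (z + r • dir t) (r • rot (dir t))) t := by
    intro t
    have h1 : HasDerivAt (fun t => z + r • dir t) (r • rot (dir t)) t :=
      ((hasDerivAt_dir t).const_smul r).const_add z
    exact ((hf.differentiable one_ne_zero _).hasFDerivAt).comp_hasDerivAt t h1
  have hcr : Continuous fun t => rot (dir t) := by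
    have : (fun t => rot (dir t)) = fun t => dir (t + Real.pi / 2) := by
      ext t i; fin_cases i <;> simp [rot, dir, Real.cos_add_pi_div_two, Real.sin_add_pi_div_two]
    rw [this]
    exact continuous_dir.comp (by fun_prop)
  have hcd := continuous_dir
  have hcf := hf.continuous_fderiv one_ne_zero
  -- The angular derivative on the circle of radius `r` is at most `r |∇f|`, and `r < R`; this is
  -- where the factor `R` arises. The Jacobian `r` is the same on both sides.
  have key := lintegral_sq_le_of_zero hder
    ((hcf.comp (by fun_prop)).clm_apply (by fun_prop)) hθ hy0
  rw [lintegral_const_mul' _ _ (by finiteness), lintegral_const_mul' _ _ (by finiteness),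
    mul_left_comm]
  gcongr
  refine key.trans ?_
  rw [ENNReal.ofReal_mul (p := 2 * Real.pi) (by positivity), mul_pow, mul_assoc]
  gcongr
  rw [← lintegral_const_mul' _ _ (by finiteness)]
  refine lintegral_mono fun t => ?_
  rw [← mul_pow]
  gcongr
  calc _ ≤ ‖fderiv ℝ f (z + r • dir t)‖ₑ * ‖r • rot (dir t)‖ₑ := ContinuousLinearMap.le_opENorm _ _
    _ = ‖gradient f (z + r • dir t)‖ₑ * ENNReal.ofReal r := by
      rw [← ofReal_norm (gradient f _), norm_gradient, ofReal_norm, ← ofReal_norm (r • _),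
        norm_smul, norm_rot, norm_dir, mul_one, Real.norm_of_nonneg hr.1.le]
    _ ≤ _ := by rw [mul_comm]; gcongr; exact hr.2.le

/-- Poincaré inequality for functions supported in a bounded set. -/
lemma lintegral_sq_le_of_support {f : Plane → ℝ} (hf : ContDiff ℝ 1 f) {D : ℝ} (hD : 0 < D)
    (hs : ∀ x, D ≤ ‖x‖ → f x = 0) :
    ∫⁻ x, ‖f x‖ₑ ^ 2 ≤ ENNReal.ofReal (2 * Real.pi * (3 * D)) ^ 2 * ∫⁻ x, ‖gradient f x‖ₑ ^ 2 := by
  -- With a centre of norm `D`, the disc of radius `3D` contains the support, and the outermost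
  -- point `z + r • dir 0` of each circle has norm `D + r ≥ D`, so it is a zero of `f`.
  set z : Plane := (D : ℝ) • dir 0 with hz
  have hnz : ‖z‖ = D := by simp [hz, norm_smul, norm_dir, hD.le]
  have hsup : Function.support (fun x => ‖f x‖ₑ ^ 2) ⊆ Metric.ball z (3 * D) := by
    intro x hx
    have hx' : ‖x‖ < D := by
      by_contra! h
      exact hx (by simp [hs x h])
    rw [mem_ball_iff_norm]
    linarith [norm_sub_le x z]
  rw [← setLIntegral_eq_of_support_subset hsup]
  refine (lintegral_ball_sq_le hf fun r hr _ => ⟨z + r • dir 0, ?_, hs _ ?_⟩).trans ?_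
  · simp [norm_smul, norm_dir, hr.le]
  · rw [hz, ← add_smul, norm_smul, norm_dir, Real.norm_of_nonneg (by positivity)]; linarith
  · gcongr
    exact Measure.restrict_le_self

/-- The value of a function at the origin is controlled by a singular integral of its gradient. -/
lemma enorm_zero_le_lintegral {f : Plane → ℝ} (hf : ContDiff ℝ 1 f) (hc : HasCompactSupport f) :
    ENNReal.ofReal (2 * Real.pi) * ‖f 0‖ₑ ≤ ∫⁻ x, ‖gradient f x‖ₑ * ‖x‖ₑ⁻¹ := by
  have hgc := continuous_gradient hf
  have hcd := continuous_dir
  rw [lintegral_plane_eq_polar (by fun_prop), lintegral_lintegral_swap]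
  swap
  · refine Measurable.aemeasurable ?_
    fun_prop
  -- On each ray, `-f 0` is the integral of the radial derivative; the polar Jacobian `r` cancels
  -- the kernel `1/‖x‖`.
  have hray : ∀ θ, ‖f 0‖ₑ ≤ ∫⁻ r in Set.Ioi (0 : ℝ),
      ENNReal.ofReal r * (‖gradient f (r • dir θ)‖ₑ * ‖r • dir θ‖ₑ⁻¹) := by
    intro θ
    obtain ⟨D, hD⟩ := IsCompact.isBounded hc |>.exists_norm_le
    set T := max D 0 + 1 with hT
    have hT0 : 0 < T := by positivity
    have hfT : f (T • dir θ) = 0 := by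
      by_contra h
      have := hD _ (subset_tsupport _ h)
      rw [norm_smul, norm_dir, mul_one, Real.norm_of_nonneg hT0.le] at this
      linarith [le_max_left D 0]
    have hder : ∀ t ∈ Set.uIcc 0 T, HasDerivAt (fun t : ℝ => f (t • dir θ))
        (fderiv ℝ f (t • dir θ) (dir θ)) t := by
      intro t _
      have h1 : HasDerivAt (fun t : ℝ => t • dir θ) ((1 : ℝ) • dir θ) t :=
        (hasDerivAt_id t).smul_const _
      rw [one_smul] at h1
      exact ((hf.differentiable one_ne_zero _).hasFDerivAt).comp_hasDerivAt t h1
    have hcont : Continuous fun t : ℝ => fderiv ℝ f (t • dir θ) (dir θ) :=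
      ((hf.continuous_fderiv one_ne_zero).comp (by fun_prop)).clm_apply continuous_const
    have h1 := intervalIntegral.integral_eq_sub_of_hasDerivAt hder (hcont.intervalIntegrable _ _)
    rw [hfT, zero_smul, zero_sub, intervalIntegral.integral_of_le hT0.le] at h1
    rw [← enorm_neg, ← h1]
    refine (enorm_integral_le_lintegral_enorm _).trans ?_
    refine (lintegral_mono_set Set.Ioc_subset_Ioi_self).trans ?_
    refine setLIntegral_mono' measurableSet_Ioi fun r hr => ?_
    have hr' : 0 < r := hr
    have h2 : ‖r • dir θ‖ₑ = ENNReal.ofReal r := by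
      rw [← ofReal_norm, norm_smul, norm_dir, mul_one, Real.norm_of_nonneg hr'.le]
    rw [h2, mul_left_comm, ENNReal.mul_inv_cancel (by simpa using hr') (by finiteness), mul_one]
    refine (ContinuousLinearMap.le_opENorm _ _).trans (le_of_eq ?_)
    rw [← ofReal_norm (gradient f _), norm_gradient, ofReal_norm, ← ofReal_norm (dir θ), norm_dir]
    simp
  calc _ = ∫⁻ θ in Set.Ioo (-Real.pi) Real.pi, ‖f 0‖ₑ := by
        rw [lintegral_const, mul_comm, Measure.restrict_apply_univ, Real.volume_Ioo]
        congr 2; ring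
    _ ≤ _ := lintegral_mono fun θ => hray θ

/-! ### Test functions, cut-off functions and `H^1_0` -/

lemma gradient_fun_sub {f g : Plane → ℝ} {x : Plane} (hf : DifferentiableAt ℝ f x)
    (hg : DifferentiableAt ℝ g x) :
    gradient (fun y => f y - g y) x = gradient f x - gradient g x := by
  simp [gradient, fderiv_fun_sub hf hg]

lemma gradient_fun_const_mul {f : Plane → ℝ} (c : ℝ) {x : Plane} (hf : DifferentiableAt ℝ f x) :
    gradient (fun y => c * f y) x = c • gradient f x := by
  simp [gradient, fderiv_const_mul hf]

lemma gradient_fun_mul {f g : Plane → ℝ} {x : Plane} (hf : DifferentiableAt ℝ f x)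
    (hg : DifferentiableAt ℝ g x) :
    gradient (fun y => f y * g y) x = f x • gradient g x + g x • gradient f x := by
  simp [gradient, fderiv_fun_mul hf hg]

lemma tsupport_gradient_subset (f : Plane → ℝ) : tsupport (gradient f) ⊆ tsupport f := by
  refine (closure_mono ?_).trans (tsupport_fderiv_subset ℝ (f := f))
  intro x hx h
  exact hx (by simp [gradient, h])

lemma eLpNorm_two_sq {α E : Type*} [MeasurableSpace α] [NormedAddCommGroup E] (f : α → E)
    (μ : Measure α) : eLpNorm f 2 μ ^ 2 = ∫⁻ x, ‖f x‖ₑ ^ 2 ∂μ := by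
  have := eLpNorm_nnreal_pow_eq_lintegral (f := f) (μ := μ) (p := 2) (by norm_num)
  simpa using this

lemma eLpNorm_two_le_of_lintegral_le {α E F : Type*} [MeasurableSpace α] [NormedAddCommGroup E]
    [NormedAddCommGroup F] {f : α → E} {g : α → F} {μ ν : Measure α} {c : ℝ≥0∞}
    (h : ∫⁻ x, ‖f x‖ₑ ^ 2 ∂μ ≤ c ^ 2 * ∫⁻ x, ‖g x‖ₑ ^ 2 ∂ν) :
    eLpNorm f 2 μ ≤ c * eLpNorm g 2 ν := by
  rw [← eLpNorm_two_sq, ← eLpNorm_two_sq, ← mul_pow] at h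
  exact (ENNReal.pow_le_pow_left_iff two_ne_zero).1 h

namespace IsTest

variable {U V : Set Plane} {f g : Plane → ℝ}

lemma contDiff_one (hf : IsTest U f) : ContDiff ℝ 1 f := hf.smooth.of_le (by simp)

lemma differentiable (hf : IsTest U f) : Differentiable ℝ f :=
  hf.contDiff_one.differentiable one_ne_zero

lemma mono (hf : IsTest U f) (h : U ⊆ V) : IsTest V f :=
  ⟨hf.smooth, hf.compactSupp, hf.supp_subset.trans h⟩

lemma zero (U : Set Plane) : IsTest U fun _ => 0 := by
  refine ⟨contDiff_const, HasCompactSupport.zero, ?_⟩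
  have : tsupport (fun _ : Plane => (0 : ℝ)) = ∅ := by simp
  simp [this]

lemma of_support_subset (hf : ContDiff ℝ ∞ f) {K : Set Plane} (hK : IsCompact K) (hKU : K ⊆ U)
    (h : ∀ x ∉ K, f x = 0) : IsTest U f := by
  have hs : tsupport f ⊆ K :=
    closure_minimal (fun x hx => by by_contra hxK; exact hx (h x hxK)) hK.isClosed
  exact ⟨hf, hK.of_isClosed_subset (isClosed_tsupport f) hs, hs.trans hKU⟩

lemma sub (hf : IsTest U f) (hg : IsTest U g) : IsTest U fun x => f x - g x := by
  refine of_support_subset (hf.smooth.sub hg.smooth) (hf.compactSupp.isCompact.union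
    hg.compactSupp.isCompact) (Set.union_subset hf.supp_subset hg.supp_subset) fun x hx => ?_
  rw [Set.mem_union, not_or] at hx
  simp [image_eq_zero_of_notMem_tsupport hx.1, image_eq_zero_of_notMem_tsupport hx.2]

lemma const_mul (hf : IsTest U f) (c : ℝ) : IsTest U fun x => c * f x := by
  refine of_support_subset (contDiff_const.mul hf.smooth) hf.compactSupp.isCompact
    hf.supp_subset fun x hx => ?_
  simp [image_eq_zero_of_notMem_tsupport hx]

lemma gradient_sub (hf : IsTest U f) (hg : IsTest V g) :
    gradient (fun x => f x - g x) = fun x => gradient f x - gradient g x :=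
  funext fun x => gradient_fun_sub (hf.differentiable x) (hg.differentiable x)

lemma gradient_const_mul (hf : IsTest U f) (c : ℝ) :
    gradient (fun x => c * f x) = fun x => c • gradient f x :=
  funext fun x => gradient_fun_const_mul c (hf.differentiable x)

lemma continuous_gradient (hf : IsTest U f) : Continuous (gradient f) :=
  LakeEq.continuous_gradient hf.contDiff_one

lemma hasCompactSupport_gradient (hf : IsTest U f) : HasCompactSupport (gradient f) :=
  hf.compactSupp.of_isClosed_subset (isClosed_tsupport _) (tsupport_gradient_subset f)

lemma eq_zero (hf : IsTest U f) {x : Plane} (hx : x ∉ U) : f x = 0 :=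
  image_eq_zero_of_notMem_tsupport fun h => hx (hf.supp_subset h)

lemma gradient_eq_zero (hf : IsTest U f) {x : Plane} (hx : x ∉ U) : gradient f x = 0 :=
  image_eq_zero_of_notMem_tsupport fun h => hx (hf.supp_subset (tsupport_gradient_subset f h))

lemma memLp (hf : IsTest U f) : MemLp f 2 volume :=
  hf.smooth.continuous.memLp_of_hasCompactSupport hf.compactSupp

lemma memLp_gradient (hf : IsTest U f) : MemLp (gradient f) 2 volume :=
  hf.continuous_gradient.memLp_of_hasCompactSupport hf.hasCompactSupport_gradient

lemma eLpNorm_ball_le (hf : IsTest U f) {z : Plane} {R : ℝ}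
    (hz : ∀ r, 0 < r → r < R → ∃ y ∈ Metric.sphere z r, y ∉ U) :
    eLpNorm f 2 (volume.restrict (Metric.ball z R)) ≤
      ENNReal.ofReal (2 * Real.pi * R) *
        eLpNorm (gradient f) 2 (volume.restrict (Metric.ball z R)) :=
  eLpNorm_two_le_of_lintegral_le <| lintegral_ball_sq_le hf.contDiff_one fun r h0 hr =>
    let ⟨y, hy, hyU⟩ := hz r h0 hr
    ⟨y, hy, hf.eq_zero hyU⟩

lemma eLpNorm_le (hf : IsTest U f) {D : ℝ} (hD : 0 < D) (hU : U ⊆ Metric.ball 0 D) :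
    eLpNorm f 2 volume ≤ ENNReal.ofReal (2 * Real.pi * (3 * D)) *
      eLpNorm (gradient f) 2 volume :=
  eLpNorm_two_le_of_lintegral_le <| lintegral_sq_le_of_support hf.contDiff_one hD fun x hx =>
    hf.eq_zero fun h => by
      have := hU h
      rw [mem_ball_zero_iff] at this
      linarith

end IsTest

namespace IsCutoff

variable {Ωt I : Set Plane} {χ χ' : Plane → ℝ}

lemma tsupport_gradient (hχ : IsCutoff Ωt I χ) : tsupport (gradient χ) ⊆ Ωt \ I := by
  intro x hx
  refine ⟨hχ.1.supp_subset (tsupport_gradient_subset χ hx), fun hI => ?_⟩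
  refine notMem_tsupport_iff_eventuallyEq.2 ?_ hx
  have h1 : ∀ᶠ y in 𝓝 x, χ y = 1 := hχ.2.filter_mono (nhds_le_nhdsSet hI)
  filter_upwards [h1.eventually_nhds] with y hy
  rw [EventuallyEq.gradient_eq (f := fun _ => (1 : ℝ)) hy]
  simp

lemma gradient_eq_zero (hχ : IsCutoff Ωt I χ) {x : Plane} (hx : x ∉ Ωt \ I) : gradient χ x = 0 :=
  image_eq_zero_of_notMem_tsupport fun h => hx (hχ.tsupport_gradient h)

lemma isTest_of_eventually_zero {η : Plane → ℝ} (hη : IsTest Ωt η) (h : ∀ᶠ x in 𝓝ˢ I, η x = 0) :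
    IsTest (Ωt \ I) η := by
  refine ⟨hη.smooth, hη.compactSupp, fun x hx => ⟨hη.supp_subset hx, fun hI => ?_⟩⟩
  exact notMem_tsupport_iff_eventuallyEq.2 (h.filter_mono (nhds_le_nhdsSet hI)) hx

lemma isTest_sub (hχ : IsCutoff Ωt I χ) (hχ' : IsCutoff Ωt I χ') :
    IsTest (Ωt \ I) fun x => χ x - χ' x := by
  refine isTest_of_eventually_zero (hχ.1.sub hχ'.1) ?_
  filter_upwards [hχ.2, hχ'.2] with x h h'
  simp [h, h']

lemma sub_isTest (hχ : IsCutoff Ωt I χ) {η : Plane → ℝ} (hη : IsTest (Ωt \ I) η) :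
    IsCutoff Ωt I fun x => χ x - η x := by
  refine ⟨hχ.1.sub (hη.mono Set.sdiff_subset), ?_⟩
  have hη0 : ∀ᶠ x in 𝓝ˢ I, η x = 0 := by
    refine eventually_nhdsSet_iff_forall.2 fun x hx => ?_
    exact notMem_tsupport_iff_eventuallyEq.1 fun h => (hη.supp_subset h).2 hx
  filter_upwards [hχ.2, hη0] with x h h'
  simp [h, h']

end IsCutoff

lemma exists_isCutoff {Ωt I : Set Plane} (hΩ : IsOpen Ωt) (hI : IsCompact I) (h : I ⊆ Ωt) :
    ∃ χ, IsCutoff Ωt I χ := by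
  obtain ⟨K, hK, hIK, hKΩ⟩ := exists_compact_between hI hΩ h
  obtain ⟨f, h1, h0, -⟩ := exists_contMDiffMap_one_nhds_of_subset_interior
    (modelWithCornersSelf ℝ Plane) (n := ⊤) hI.isClosed hIK
  exact ⟨f, IsTest.of_support_subset f.contMDiff.contDiff hK hKΩ h0, h1⟩

namespace IsH10

variable {U V : Set Plane} {Φ Φ' : Plane → ℝ} {G G' : Plane → Plane}

lemma sub (h : IsH10 U Φ G) (h' : IsH10 U Φ' G') :
    IsH10 U (fun x => Φ x - Φ' x) (fun x => G x - G' x) := by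
  obtain ⟨h1, h2, φ, h3, h4, h5⟩ := h
  obtain ⟨h1', h2', φ', h3', h4', h5'⟩ := h'
  refine ⟨h1.sub h1', h2.sub h2', fun n x => φ n x - φ' n x, fun n => (h3 n).sub (h3' n), ?_, ?_⟩
  · refine tendsto_of_tendsto_of_tendsto_of_le_of_le tendsto_const_nhds
      (by simpa using h4.add h4') (fun _ => zero_le) fun n => ?_
    refine le_trans (le_of_eq ?_) (eLpNorm_sub_le ((h3 n).memLp.sub h1).1
      ((h3' n).memLp.sub h1').1 one_le_two)
    congr 1; ext x; simp; ring
  · refine tendsto_of_tendsto_of_tendsto_of_le_of_le tendsto_const_nhds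
      (by simpa using h5.add h5') (fun _ => zero_le) fun n => ?_
    refine le_trans (le_of_eq ?_) (eLpNorm_sub_le ((h3 n).memLp_gradient.sub h2).1
      ((h3' n).memLp_gradient.sub h2').1 one_le_two)
    congr 1; ext1 x; simp only [(h3 n).gradient_sub (h3' n), Pi.sub_apply]; abel

lemma const_mul (h : IsH10 U Φ G) (c : ℝ) :
    IsH10 U (fun x => c * Φ x) (fun x => c • G x) := by
  obtain ⟨h1, h2, φ, h3, h4, h5⟩ := h
  refine ⟨h1.const_mul c, h2.const_smul c, fun n x => c * φ n x, fun n => (h3 n).const_mul c, ?_, ?_⟩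
  · have := ENNReal.Tendsto.const_mul (a := ‖c‖ₑ) h4 (Or.inr (by finiteness))
    rw [mul_zero] at this
    refine this.congr fun n => ?_
    rw [← eLpNorm_const_smul]
    congr 1; ext x; simp; ring
  · have := ENNReal.Tendsto.const_mul (a := ‖c‖ₑ) h5 (Or.inr (by finiteness))
    rw [mul_zero] at this
    refine this.congr fun n => ?_
    rw [← eLpNorm_const_smul]
    congr 1; ext1 x; simp only [(h3 n).gradient_const_mul c, Pi.smul_apply, smul_sub]

/-- Estimates of test functions by their gradients pass to the limit. -/
lemma eLpNorm_le_of_isTest (h : IsH10 U Φ G) {S : Set Plane} {c : ℝ≥0∞} (hc : c ≠ ⊤)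
    (hS : ∀ f, IsTest U f → eLpNorm f 2 (volume.restrict S) ≤
      c * eLpNorm (gradient f) 2 (volume.restrict S)) :
    eLpNorm Φ 2 (volume.restrict S) ≤ c * eLpNorm G 2 (volume.restrict S) := by
  obtain ⟨h1, h2, φ, h3, h4, h5⟩ := h
  have hle : ∀ n, eLpNorm Φ 2 (volume.restrict S) ≤ eLpNorm (fun x => φ n x - Φ x) 2 volume +
      c * (eLpNorm (fun x => gradient (φ n) x - G x) 2 volume +
        eLpNorm G 2 (volume.restrict S)) := by
    intro n
    have hφ := (h3 n).memLp.restrict S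
    have hg := (h3 n).memLp_gradient.restrict S
    calc eLpNorm Φ 2 (volume.restrict S)
        = eLpNorm (φ n - (φ n - Φ)) 2 (volume.restrict S) := by simp
      _ ≤ eLpNorm (φ n) 2 (volume.restrict S) + eLpNorm (φ n - Φ) 2 (volume.restrict S) :=
        eLpNorm_sub_le hφ.1 (hφ.sub (h1.restrict S)).1 one_le_two
      _ ≤ c * eLpNorm (gradient (φ n)) 2 (volume.restrict S) + eLpNorm (φ n - Φ) 2 volume :=
        add_le_add (hS _ (h3 n)) (eLpNorm_restrict_le _ _ _ _)
      _ ≤ c * (eLpNorm (gradient (φ n) - G) 2 volume + eLpNorm G 2 (volume.restrict S)) +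
          eLpNorm (φ n - Φ) 2 volume := by
        gcongr
        calc _ = eLpNorm ((gradient (φ n) - G) + G) 2 (volume.restrict S) := by simp
          _ ≤ eLpNorm (gradient (φ n) - G) 2 (volume.restrict S) + _ :=
            eLpNorm_add_le (hg.sub (h2.restrict S)).1 (h2.restrict S).1 one_le_two
          _ ≤ _ := add_le_add_left (eLpNorm_restrict_le _ _ _ _) _
      _ = _ := add_comm _ _
  refine ge_of_tendsto' (x := atTop) ?_ hle
  have h6 := ENNReal.Tendsto.const_mul (h5.add_const (eLpNorm G 2 (volume.restrict S)))
    (Or.inr hc)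
  simpa using h4.add h6

lemma eLpNorm_ball_le (h : IsH10 U Φ G) {z : Plane} {R : ℝ}
    (hz : ∀ r, 0 < r → r < R → ∃ y ∈ Metric.sphere z r, y ∉ U) :
    eLpNorm Φ 2 (volume.restrict (Metric.ball z R)) ≤
      ENNReal.ofReal (2 * Real.pi * R) * eLpNorm G 2 (volume.restrict (Metric.ball z R)) :=
  h.eLpNorm_le_of_isTest (by finiteness) fun _ hf => hf.eLpNorm_ball_le hz

lemma eLpNorm_le (h : IsH10 U Φ G) {D : ℝ} (hD : 0 < D) (hU : U ⊆ Metric.ball 0 D) :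
    eLpNorm Φ 2 volume ≤ ENNReal.ofReal (2 * Real.pi * (3 * D)) * eLpNorm G 2 volume := by
  have := h.eLpNorm_le_of_isTest (S := Set.univ) (c := ENNReal.ofReal (2 * Real.pi * (3 * D)))
    (by finiteness) fun f hf => by simpa using hf.eLpNorm_le hD hU
  simpa using this

/-- Gradients of test functions vanish off `U`, and this survives the `L²` limit. Integrals of `G`
over discs crossing the shore thus reduce to the lake, where the weight makes sense. -/
lemma gradient_ae_zero (h : IsH10 U Φ G) (hU : MeasurableSet U) :
    G =ᵐ[volume.restrict Uᶜ] 0 := by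
  obtain ⟨h1, h2, φ, h3, h4, h5⟩ := h
  rw [← eLpNorm_eq_zero_iff (h2.restrict _).1 two_ne_zero]
  refine le_antisymm (ge_of_tendsto' h5 fun n => ?_) zero_le
  refine le_trans (le_of_eq ?_) (eLpNorm_restrict_le _ _ _ Uᶜ)
  rw [← eLpNorm_neg]
  refine eLpNorm_congr_ae ?_
  filter_upwards [ae_restrict_mem hU.compl] with x hx
  simp [(h3 n).gradient_eq_zero hx]

lemma ae_zero (h : IsH10 U Φ G) (hU : Bornology.IsBounded U) (hG : G =ᵐ[volume] 0) :
    Φ =ᵐ[volume] 0 := by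
  obtain ⟨D, hD, hUD⟩ := hU.subset_ball_lt 0 0
  rw [← eLpNorm_eq_zero_iff h.1.1 two_ne_zero]
  have := h.eLpNorm_le hD hUD
  rw [(eLpNorm_eq_zero_iff h.2.1.1 two_ne_zero).2 hG, mul_zero] at this
  exact le_antisymm this zero_le

end IsH10

/-! ### Weighted gradients and potentials -/

/-- The weighted field `b^{-1/2} G`. -/
def wgt (b : Plane → ℝ) (G : Plane → Plane) : Plane → Plane := fun x => (Real.sqrt (b x))⁻¹ • G x

lemma weightedNorm_eq (U : Set Plane) (b : Plane → ℝ) (G : Plane → Plane) :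
    weightedNorm U b G = eLpNorm (wgt b G) 2 (volume.restrict U) := rfl

/-- Bounded depth functions on `U` that are locally bounded below by positive constants. -/
structure IsDepth (U : Set Plane) (b : Plane → ℝ) : Prop where
  isOpen : IsOpen U
  meas : AEStronglyMeasurable b (volume.restrict U)
  bound : ∃ M : ℝ, 0 < M ∧ ∀ᵐ x ∂(volume.restrict U), b x ≤ M
  lower : ∀ K : Set Plane, IsCompact K → K ⊆ U →
    ∃ θ : ℝ, 0 < θ ∧ ∀ᵐ x ∂(volume.restrict K), θ ≤ b x

lemma exists_bound_of_memLp_top {U : Set Plane} {b : Plane → ℝ}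
    (h : MemLp b ∞ (volume.restrict U)) :
    ∃ M : ℝ, 0 < M ∧ ∀ᵐ x ∂(volume.restrict U), b x ≤ M := by
  have h1 := h.2
  rw [eLpNorm_exponent_top] at h1
  refine ⟨(eLpNormEssSup b (volume.restrict U)).toReal + 1, by positivity, ?_⟩
  filter_upwards [enorm_ae_le_eLpNormEssSup b (volume.restrict U)] with x hx
  have h2 := ENNReal.toReal_mono h1.ne hx
  rw [toReal_enorm] at h2
  linarith [le_abs_self (b x), Real.norm_eq_abs (b x)]

lemma IsIslandLake.isDepth {Ωt I : Set Plane} {b : Plane → ℝ} (h : IsIslandLake Ωt I b) :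
    IsDepth (Ωt \ I) b :=
  ⟨h.isOpen.sdiff h.island_compact.isClosed, h.depth_memLp.1,
    exists_bound_of_memLp_top h.depth_memLp, h.depth_lower⟩

lemma IsPuncturedLake.isDepth {Ω : Set Plane} {b : Plane → ℝ} (h : IsPuncturedLake Ω b) :
    IsDepth (Ω \ {0}) b :=
  have h1 := h.depth_memLp.mono_measure (Measure.restrict_mono Set.sdiff_subset le_rfl)
  ⟨h.isOpen.sdiff isClosed_singleton, h1.1, exists_bound_of_memLp_top h1, h.depth_lower⟩

namespace IsDepth

variable {U : Set Plane} {b : Plane → ℝ}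

/-- `U` is exhausted by countably many compact sets, each with its own positive lower bound. -/
lemma ae_pos (hb : IsDepth U b) : ∀ᵐ x ∂(volume.restrict U), 0 < b x := by
  have : LocallyCompactSpace U := IsOpen.locallyCompactSpace hb.isOpen
  obtain ⟨K, hK, hKU⟩ := isSigmaCompact_iff_sigmaCompactSpace.2
    (sigmaCompactSpace_of_locallyCompact_secondCountable (X := U))
  rw [← hKU, ae_restrict_iUnion_iff]
  intro n
  obtain ⟨θ, hθ, h⟩ := hb.lower (K n) (hK n) (hKU ▸ Set.subset_iUnion K n)
  exact h.mono fun x hx => hθ.trans_le hx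

lemma aestronglyMeasurable_wgt (hb : IsDepth U b) {G : Plane → Plane}
    (hG : AEStronglyMeasurable G (volume.restrict U)) :
    AEStronglyMeasurable (wgt b G) (volume.restrict U) :=
  (hb.meas.aemeasurable.sqrt.inv.aestronglyMeasurable).smul hG

/-- On compact subsets the weight is bounded. -/
lemma exists_norm_wgt_le (hb : IsDepth U b) {K : Set Plane} (hK : IsCompact K) (hKU : K ⊆ U) :
    ∃ c : ℝ, 0 < c ∧ ∀ G : Plane → Plane, (∀ x ∉ K, G x = 0) →
      ∀ᵐ x ∂volume, ‖wgt b G x‖ ≤ c * ‖G x‖ := by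
  obtain ⟨θ, hθ, h⟩ := hb.lower K hK hKU
  rw [ae_restrict_iff' hK.measurableSet] at h
  refine ⟨(Real.sqrt θ)⁻¹, by positivity, fun G h0 => ?_⟩
  filter_upwards [h] with x hx
  by_cases hxK : x ∈ K
  · rw [wgt, norm_smul, norm_inv, Real.norm_of_nonneg (Real.sqrt_nonneg _)]
    gcongr
    exact hx hxK
  · simp [wgt, h0 x hxK]

lemma eLpNorm_wgt_le (hb : IsDepth U b) {K : Set Plane} (hK : IsCompact K) (hKU : K ⊆ U) :
    ∃ c : ℝ, 0 < c ∧ ∀ G : Plane → Plane, (∀ x ∉ K, G x = 0) →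
      eLpNorm (wgt b G) 2 (volume.restrict U) ≤ ENNReal.ofReal c * eLpNorm G 2 volume := by
  obtain ⟨c, hc, h⟩ := hb.exists_norm_wgt_le hK hKU
  refine ⟨c, hc, fun G h0 => ?_⟩
  exact (eLpNorm_restrict_le _ _ _ _).trans (eLpNorm_le_mul_eLpNorm_of_ae_le_mul (h G h0) 2)

lemma memLp_wgt (hb : IsDepth U b) {G : Plane → Plane} (hG : MemLp G 2 volume)
    {K : Set Plane} (hK : IsCompact K) (hKU : K ⊆ U) (h0 : ∀ x ∉ K, G x = 0) :
    MemLp (wgt b G) 2 (volume.restrict U) := by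
  obtain ⟨c, -, h⟩ := hb.eLpNorm_wgt_le hK hKU
  exact ⟨hb.aestronglyMeasurable_wgt (hG.restrict U).1,
    (h G h0).trans_lt (ENNReal.mul_lt_top (by finiteness) hG.2)⟩

end IsDepth

/-- Compactly supported smooth functions that are locally constant near the complement of `U`. -/
structure IsGradTest (U : Set Plane) (f : Plane → ℝ) : Prop where
  isTest : IsTest Set.univ f
  supp : tsupport (gradient f) ⊆ U

namespace IsGradTest

variable {U : Set Plane} {b : Plane → ℝ} {f g : Plane → ℝ}

lemma memLp (hf : IsGradTest U f) (hb : IsDepth U b) :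
    MemLp (wgt b (gradient f)) 2 (volume.restrict U) :=
  hb.memLp_wgt hf.isTest.memLp_gradient hf.isTest.hasCompactSupport_gradient hf.supp
    fun _ hx => image_eq_zero_of_notMem_tsupport hx

lemma gradient_eq_zero (hf : IsGradTest U f) {x : Plane} (hx : x ∉ U) : gradient f x = 0 :=
  image_eq_zero_of_notMem_tsupport fun h => hx (hf.supp h)

end IsGradTest

lemma IsTest.isGradTest {U : Set Plane} {f : Plane → ℝ} (hf : IsTest U f) : IsGradTest U f :=
  ⟨hf.mono (Set.subset_univ _), (tsupport_gradient_subset f).trans hf.supp_subset⟩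

lemma IsCutoff.isGradTest {Ωt I : Set Plane} {χ : Plane → ℝ} (hχ : IsCutoff Ωt I χ) :
    IsGradTest (Ωt \ I) χ :=
  ⟨hχ.1.mono (Set.subset_univ _), hχ.tsupport_gradient⟩

open Classical in
/-- The weighted gradient as an element of `L^2(U)`. -/
def wgradLp (U : Set Plane) (b : Plane → ℝ) (f : Plane → ℝ) : Lp Plane 2 (volume.restrict U) :=
  if h : MemLp (wgt b (gradient f)) 2 (volume.restrict U) then h.toLp _ else 0

section wgradLp

variable {U : Set Plane} {b : Plane → ℝ} {f g : Plane → ℝ}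

lemma wgradLp_eq (hb : IsDepth U b) (hf : IsGradTest U f) :
    wgradLp U b f = (hf.memLp hb).toLp _ := dif_pos _

lemma coeFn_wgradLp (hb : IsDepth U b) (hf : IsGradTest U f) :
    wgradLp U b f =ᵐ[volume.restrict U] wgt b (gradient f) := by
  rw [wgradLp_eq hb hf]
  exact MemLp.coeFn_toLp _

lemma enorm_wgradLp (hb : IsDepth U b) (hf : IsGradTest U f) :
    ‖wgradLp U b f‖ₑ = eLpNorm (wgt b (gradient f)) 2 (volume.restrict U) := by
  rw [wgradLp_eq hb hf, Lp.enorm_toLp]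

lemma wgradLp_sub (hb : IsDepth U b) (hf : IsGradTest U f) (hg : IsGradTest U g)
    (hfg : IsGradTest U fun x => f x - g x) :
    wgradLp U b (fun x => f x - g x) = wgradLp U b f - wgradLp U b g := by
  rw [wgradLp_eq hb hf, wgradLp_eq hb hg, wgradLp_eq hb hfg, ← MemLp.toLp_sub]
  refine MemLp.toLp_congr _ _ (ae_of_all _ fun x => ?_)
  simp [wgt, hf.isTest.gradient_sub hg.isTest, smul_sub]

lemma inner_wgradLp (hb : IsDepth U b) (hf : IsGradTest U f)
    (h : Lp Plane 2 (volume.restrict U)) :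
    inner ℝ h (wgradLp U b f) = ∫ x in U, inner ℝ (h x) (wgt b (gradient f) x) := by
  rw [L2.inner_def]
  refine integral_congr_ae ?_
  filter_upwards [coeFn_wgradLp hb hf] with x hx
  rw [hx]

lemma wgradLp_const_mul (hb : IsDepth U b) (hf : IsTest U f) (c : ℝ) :
    wgradLp U b (fun x => c * f x) = c • wgradLp U b f := by
  rw [wgradLp_eq hb hf.isGradTest, wgradLp_eq hb (hf.const_mul c).isGradTest,
    ← MemLp.toLp_const_smul]
  refine MemLp.toLp_congr _ _ (ae_of_all _ fun x => ?_)
  rw [wgt, hf.gradient_const_mul c]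
  exact smul_comm (_ : ℝ) c (gradient f x)

/-- The subspace of the weighted gradients of test functions. -/
def testGradients (hb : IsDepth U b) : Submodule ℝ (Lp Plane 2 (volume.restrict U)) where
  carrier := {g | ∃ η, IsTest U η ∧ g = wgradLp U b η}
  zero_mem' := by
    refine ⟨_, (IsTest.zero U).const_mul 0, ?_⟩
    rw [wgradLp_const_mul hb (IsTest.zero U), zero_smul]
  add_mem' := by
    rintro _ _ ⟨f, hf, rfl⟩ ⟨g, hg, rfl⟩
    refine ⟨_, hf.sub (hg.const_mul (-1)), ?_⟩
    rw [wgradLp_sub hb hf.isGradTest (hg.const_mul (-1)).isGradTest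
      (hf.sub (hg.const_mul (-1))).isGradTest, wgradLp_const_mul hb hg, neg_one_smul, sub_neg_eq_add]
  smul_mem' := by
    rintro c _ ⟨f, hf, rfl⟩
    exact ⟨_, hf.const_mul c, (wgradLp_const_mul hb hf c).symm⟩

end wgradLp

/-- The weighted gradient of the equilibrium potential of the condenser `(Ωt, I)`: a limit of
weighted gradients of cut-off functions that is orthogonal to those of the test functions. -/
structure IsPotential (Ωt I : Set Plane) (b : Plane → ℝ)
    (h : Lp Plane 2 (volume.restrict (Ωt \ I))) : Prop where
  mem_closure : h ∈ closure {g | ∃ χ, IsCutoff Ωt I χ ∧ g = wgradLp (Ωt \ I) b χ}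
  orth : ∀ η, IsTest (Ωt \ I) η → inner ℝ h (wgradLp (Ωt \ I) b η) = 0

section potential

variable {Ωt I : Set Plane} {b : Plane → ℝ}

/-- Remove from the weighted gradient of one cut-off its orthogonal projection onto the closure of
the test gradients. A cut-off minus a test function is again a cut-off, so the difference stays in
the closure of the cut-off gradients. -/
lemma exists_isPotential (hΩ : IsOpen Ωt) (hI : IsCompact I) (hIΩ : I ⊆ Ωt)
    (hb : IsDepth (Ωt \ I) b) : ∃ h, IsPotential Ωt I b h := by
  obtain ⟨χ, hχ⟩ := exists_isCutoff hΩ hI hIΩ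
  set g := wgradLp (Ωt \ I) b χ with hg
  set V := (testGradients hb).topologicalClosure with hV
  have : CompleteSpace V := (testGradients hb).isClosed_topologicalClosure.completeSpace_coe
  refine ⟨g - V.starProjection g, ?_, fun η hη => ?_⟩
  · have h1 : V.starProjection g ∈ closure (testGradients hb : Set (Lp Plane 2 _)) :=
      V.starProjection_apply_mem g
    refine map_mem_closure (f := fun u => g - u) (by fun_prop) h1 ?_
    rintro _ ⟨η, hη, rfl⟩
    refine ⟨_, hχ.sub_isTest hη, ?_⟩
    rw [wgradLp_sub hb hχ.isGradTest hη.isGradTest (hχ.sub_isTest hη).isGradTest]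
  · have h1 : wgradLp (Ωt \ I) b η ∈ V := (testGradients hb).le_topologicalClosure ⟨η, hη, rfl⟩
    rw [real_inner_comm]
    exact Submodule.inner_right_of_mem_orthogonal h1 (V.sub_starProjection_mem_orthogonal g)

namespace IsPotential

variable {h h' : Lp Plane 2 (volume.restrict (Ωt \ I))} {χ : Plane → ℝ}

/-- Two cut-offs differ by a test function, so all of them have the same inner product with `h`;
passing to the limit `h` itself identifies the common value. All capacity estimates below test this
identity with suitable cut-offs. -/
lemma inner_cutoff (hh : IsPotential Ωt I b h) (hb : IsDepth (Ωt \ I) b)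
    (hχ : IsCutoff Ωt I χ) : inner ℝ h (wgradLp (Ωt \ I) b χ) = ‖h‖ ^ 2 := by
  have h1 : Set.EqOn (fun g => inner ℝ h g) (fun _ => inner ℝ h (wgradLp (Ωt \ I) b χ))
      {g | ∃ χ, IsCutoff Ωt I χ ∧ g = wgradLp (Ωt \ I) b χ} := by
    rintro _ ⟨χ', hχ', rfl⟩
    have := hh.orth _ (hχ'.isTest_sub hχ)
    rw [wgradLp_sub hb hχ'.isGradTest hχ.isGradTest (hχ'.isTest_sub hχ).isGradTest,
      inner_sub_right] at this
    exact sub_eq_zero.1 this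
  have h2 := h1.closure (by fun_prop) (by fun_prop) hh.mem_closure
  rw [← real_inner_self_eq_norm_sq]
  exact h2.symm

/-- Pythagoras. It converts near-minimality of the energy of a cut-off into closeness to the
potential. -/
lemma norm_cutoff_sub_sq (hh : IsPotential Ωt I b h) (hb : IsDepth (Ωt \ I) b)
    (hχ : IsCutoff Ωt I χ) :
    ‖wgradLp (Ωt \ I) b χ - h‖ ^ 2 = ‖wgradLp (Ωt \ I) b χ‖ ^ 2 - ‖h‖ ^ 2 := by
  rw [norm_sub_sq_real, real_inner_comm, hh.inner_cutoff hb hχ]; ring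

lemma norm_le (hh : IsPotential Ωt I b h) (hb : IsDepth (Ωt \ I) b)
    (hχ : IsCutoff Ωt I χ) : ‖h‖ ≤ ‖wgradLp (Ωt \ I) b χ‖ := by
  have := hh.norm_cutoff_sub_sq hb hχ
  exact le_of_sq_le_sq (by nlinarith [sq_nonneg ‖wgradLp (Ωt \ I) b χ - h‖]) (norm_nonneg _)

lemma unique (hh : IsPotential Ωt I b h) (hh' : IsPotential Ωt I b h') (hb : IsDepth (Ωt \ I) b) :
    h = h' := by
  have key : ∀ {k k'}, IsPotential Ωt I b k → IsPotential Ωt I b k' →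
      inner ℝ k k' = ‖k‖ ^ 2 := by
    intro k k' hk hk'
    have h1 : Set.EqOn (fun g => inner ℝ k g) (fun _ => ‖k‖ ^ 2)
        {g | ∃ χ, IsCutoff Ωt I χ ∧ g = wgradLp (Ωt \ I) b χ} := by
      rintro _ ⟨χ, hχ, rfl⟩
      exact hk.inner_cutoff hb hχ
    exact h1.closure (by fun_prop) (by fun_prop) hk'.mem_closure
  have h1 := key hh hh'
  have h2 := key hh' hh
  have h3 : ‖h - h'‖ ^ 2 = 0 := by
    rw [norm_sub_sq_real]; rw [real_inner_comm] at h2; linarith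
  exact sub_eq_zero.1 (norm_eq_zero.1 (pow_eq_zero_iff two_ne_zero |>.1 h3))

lemma exists_cutoff (hh : IsPotential Ωt I b h) {τ : ℝ} (hτ : 0 < τ) :
    ∃ χ, IsCutoff Ωt I χ ∧ ‖wgradLp (Ωt \ I) b χ - h‖ < τ := by
  obtain ⟨_, ⟨χ, hχ, rfl⟩, hd⟩ := Metric.mem_closure_iff.1 hh.mem_closure τ hτ
  exact ⟨χ, hχ, by rwa [dist_comm, dist_eq_norm] at hd⟩

end IsPotential

end potential

/-! ### Density of test functions in the weighted space -/

/-- Near the shore the depth is comparable to a constant at comparable distances. -/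
lemma HasShore.exists_comparable {Ω Γ : Set Plane} {b : Plane → ℝ} {a : ℝ} (hΩ : IsOpen Ω)
    (h : HasShore Ω Γ (frontier Ω) b a) (ha : 0 ≤ a) (hΓ : IsCompact Γ)
    (hΓn : (frontier Ω).Nonempty) :
    ∃ δ C : ℝ, 0 < δ ∧ 0 < C ∧ ∀ R, 0 < R → R < δ → ∃ m : ℝ, 0 < m ∧
      (∀ᵐ y ∂(volume.restrict Ω), y ∈ Metric.thickening (4 * R) Γ →
        R / 4 ≤ Metric.infDist y Ωᶜ → m ≤ b y) ∧
      (∀ᵐ y ∂(volume.restrict Ω), y ∈ Metric.thickening (4 * R) Γ →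
        Metric.infDist y (frontier Ω) ≤ 4 * R → b y ≤ C * m) := by
  obtain ⟨O, hO, hΓO, c, θ, M, hθ, hc⟩ := h
  obtain ⟨δ, hδ, hδO⟩ := hΓ.exists_thickening_subset_open hO hΓO
  have hsub : frontier Ω ⊆ Ωᶜ := fun x hx => by rw [hΩ.frontier_eq] at hx; exact hx.2
  -- `m` is the least depth allowed by the shore law at distance `R/4`, and `16^a` is the ratio of
  -- `(4R)^a` to `(R/4)^a`. Using `|M| + 1` keeps the constant positive.
  refine ⟨δ / 4, (|M| + 1) * 16 ^ a / θ, by positivity, by positivity, fun R hR hRδ =>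
    ⟨θ * (R / 4) ^ a, by positivity, ?_, ?_⟩⟩
  all_goals
    rw [ae_restrict_iff' (hO.inter hΩ).measurableSet] at hc
    filter_upwards [ae_restrict_of_ae hc, ae_restrict_mem hΩ.measurableSet] with y hy hyΩ hyΓ hd
    obtain ⟨h1, h2, h3⟩ := hy ⟨hδO (Metric.thickening_mono (by linarith) _ hyΓ), hyΩ⟩
    rw [h3]
  · have h5 := hd.trans (Metric.infDist_le_infDist_of_subset hsub hΓn)
    have h6 := hθ.le.trans h1
    gcongr
  · have h4 : (16 : ℝ) ^ a * (R / 4) ^ a = (4 * R) ^ a := by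
      rw [← Real.mul_rpow (by norm_num) (by positivity)]; congr 1; ring
    calc c y * Metric.infDist y (frontier Ω) ^ a ≤ (|M| + 1) * (4 * R) ^ a := by
          have h5 : 0 ≤ Metric.infDist y (frontier Ω) := Metric.infDist_nonneg
          have h6 : c y ≤ |M| + 1 := by linarith [le_abs_self M]
          gcongr
      _ = _ := by rw [← h4]; field_simp

/-- Half the distance between two points of the set works for all centres at once. This gives a
uniform scale below which circles around island points meet the island. -/
lemma exists_dist_le_of_nontrivial {I : Set Plane} (hI : I.Nontrivial) :
    ∃ ρ : ℝ, 0 < ρ ∧ ∀ z, ∃ w ∈ I, ρ ≤ dist w z := by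
  obtain ⟨p, hp, q, hq, hpq⟩ := hI
  refine ⟨dist p q / 2, by simpa using hpq, fun z => ?_⟩
  by_contra! h
  linarith [h p hp, h q hq, dist_triangle_right p q z]

/-- The two ingredients of the Hardy inequality at scale `R`: zeros on all circles, and a depth
comparable to one constant `m`. A point off the lake lies either in the island, where connectedness
and the inner shore law apply, or off the outer domain, where simple connectedness and the outer
shore law do. -/
lemma IsIslandLake.exists_comparable {Ωt I : Set Plane} {b : Plane → ℝ}
    (h : IsIslandLake Ωt I b) :
    ∃ δ C : ℝ, 0 < δ ∧ 0 < C ∧ ∀ R, 0 < R → R < δ → ∀ z ∉ Ωt \ I,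
      (∀ r, 0 < r → r < 2 * R → ∃ y ∈ Metric.sphere z r, y ∉ Ωt \ I) ∧
      ∃ m : ℝ, 0 < m ∧
      (∀ᵐ y ∂(volume.restrict (Ωt \ I)), y ∈ Metric.ball z (4 * R) →
        R / 4 ≤ Metric.infDist y (Ωt \ I)ᶜ → m ≤ b y) ∧
      (∀ᵐ y ∂(volume.restrict (Ωt \ I)), y ∈ Metric.ball z (4 * R) → b y ≤ C * m) := by
  have hU := h.isDepth.isOpen
  obtain ⟨a₀, ha₀, hs₀, -⟩ := h.outer_shore
  obtain ⟨a₁, ha₁, hs₁, -⟩ := h.island_shore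
  obtain ⟨ρ, hρ, hIρ⟩ := exists_dist_le_of_nontrivial h.island_nontrivial
  by_cases hne : (Ωt \ I).Nonempty
  swap
  · rw [Set.not_nonempty_iff_eq_empty] at hne
    refine ⟨1, 1, one_pos, one_pos, fun R hR _ z _ => ⟨fun r hr _ => ?_, 1, one_pos, ?_⟩⟩
    · exact ⟨z + r • dir 0, by simp [norm_smul, norm_dir, hr.le], by simp [hne]⟩
    · simp [hne]
  have hfr : (frontier (Ωt \ I)).Nonempty := by
    rw [nonempty_frontier_iff]
    refine ⟨hne, fun hu => ?_⟩
    obtain ⟨p, hp⟩ := h.island_nontrivial.nonempty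
    exact (hu.symm ▸ Set.mem_univ p : p ∈ Ωt \ I).2 hp
  have hc₀ : IsCompact (frontier Ωt) := Metric.isCompact_of_isClosed_isBounded isClosed_frontier
    (h.isBounded.closure.subset frontier_subset_closure)
  have hc₁ : IsCompact (frontier I) := h.island_compact.of_isClosed_subset isClosed_frontier
    h.island_compact.isClosed.frontier_subset
  obtain ⟨δ₀, C₀, hδ₀, hC₀, H₀⟩ := hs₀.exists_comparable hU ha₀ hc₀ hfr
  obtain ⟨δ₁, C₁, hδ₁, hC₁, H₁⟩ := hs₁.exists_comparable hU ha₁ hc₁ hfr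
  have hdist : ∀ z ∉ Ωt \ I, ∀ y ∈ Ωt \ I, ∀ {r}, y ∈ Metric.ball z r →
      Metric.infDist y (frontier (Ωt \ I)) ≤ r := by
    intro z hz y hy r hr
    obtain ⟨w, hw, hwd⟩ := exists_mem_frontier_dist_le hy hz
    exact (Metric.infDist_le_dist_of_mem hw).trans (hwd.trans (Metric.mem_ball.1 hr).le)
  refine ⟨min (min δ₀ δ₁) (ρ / 2), max C₀ C₁, by positivity, by positivity,
    fun R hR hRδ z hz => ?_⟩
  simp only [lt_min_iff] at hRδ
  have hUm := hU.measurableSet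
  by_cases hzI : z ∈ I
  · constructor
    · intro r hr hrR
      obtain ⟨w, hw, hwz⟩ := hIρ z
      obtain ⟨y, hy, hyI⟩ := exists_mem_sphere_of_isPreconnected
        h.island_simplyConnected.isPathConnected.isConnected.isPreconnected hzI hw hr.le
        (by linarith [hRδ.2])
      exact ⟨y, hy, fun hyU => hyU.2 hyI⟩
    · obtain ⟨m, hm, h1, h2⟩ := H₁ R hR hRδ.1.2
      have hth : ∀ y ∈ Ωt \ I, y ∈ Metric.ball z (4 * R) →
          y ∈ Metric.thickening (4 * R) (frontier I) := by
        intro y hy hyz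
        obtain ⟨w, hw, hwd⟩ := exists_mem_frontier_dist_le (A := Iᶜ) hy.2 (by simpa using hzI)
        rw [frontier_compl] at hw
        exact Metric.mem_thickening_iff.2 ⟨w, hw, hwd.trans_lt hyz⟩
      refine ⟨m, hm, ?_, ?_⟩
      · filter_upwards [h1, ae_restrict_mem hUm] with y hy hyU hyz hyd
        exact hy (hth y hyU hyz) hyd
      · filter_upwards [h2, ae_restrict_mem hUm] with y hy hyU hyz
        exact (hy (hth y hyU hyz) (hdist z hz y hyU hyz)).trans (by gcongr; exact le_max_right _ _)
  · have hzΩ : z ∉ Ωt := fun hzΩ => hz ⟨hzΩ, hzI⟩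
    constructor
    · intro r hr _
      obtain ⟨y, hy, hyΩ⟩ := exists_mem_sphere_notMem h.simplyConnected h.isOpen hzΩ hr
      exact ⟨y, hy, fun hyU => hyΩ hyU.1⟩
    · obtain ⟨m, hm, h1, h2⟩ := H₀ R hR hRδ.1.1
      have hth : ∀ y ∈ Ωt \ I, y ∈ Metric.ball z (4 * R) →
          y ∈ Metric.thickening (4 * R) (frontier Ωt) := by
        intro y hy hyz
        obtain ⟨w, hw, hwd⟩ := exists_mem_frontier_dist_le hy.1 hzΩ
        exact Metric.mem_thickening_iff.2 ⟨w, hw, hwd.trans_lt hyz⟩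
      refine ⟨m, hm, ?_, ?_⟩
      · filter_upwards [h1, ae_restrict_mem hUm] with y hy hyU hyz hyd
        exact hy (hth y hyU hyz) hyd
      · filter_upwards [h2, ae_restrict_mem hUm] with y hy hyU hyz
        exact (hy (hth y hyU hyz) (hdist z hz y hyU hyz)).trans (by gcongr; exact le_max_left _ _)

/-- Local form of the weighted Hardy inequality. -/
lemma IsIslandLake.exists_local_hardy {Ωt I : Set Plane} {b : Plane → ℝ}
    (h : IsIslandLake Ωt I b) {Φ : Plane → ℝ} {G : Plane → Plane} (hΦ : IsH10 (Ωt \ I) Φ G) :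
    ∃ δ C : ℝ, 0 < δ ∧ 0 < C ∧ ∀ R, 0 < R → R < δ → ∀ x, Metric.infDist x (Ωt \ I)ᶜ < R →
      ∫⁻ y in Metric.ball x R ∩ {y ∈ Ωt \ I | R / 4 ≤ Metric.infDist y (Ωt \ I)ᶜ},
          ‖(Real.sqrt (b y))⁻¹ * Φ y‖ₑ ^ 2 ≤
        ENNReal.ofReal (C * R) ^ 2 *
          ∫⁻ y in Metric.ball x (3 * R) ∩ (Ωt \ I), ‖wgt b G y‖ₑ ^ 2 := by
  set U := Ωt \ I with hUdef
  have hU := h.isDepth.isOpen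
  have hUm := hU.measurableSet
  obtain ⟨δ, C, hδ, hC, H⟩ := h.exists_comparable
  have hne : Uᶜ.Nonempty := by
    obtain ⟨p, hp⟩ := h.island_nontrivial.nonempty
    exact ⟨p, fun hpU => hpU.2 hp⟩
  refine ⟨δ, Real.sqrt C * (4 * Real.pi), hδ, by positivity, fun R hR hRδ x hx => ?_⟩
  obtain ⟨z, hz, hxz⟩ := (Metric.infDist_lt_iff hne).1 hx
  obtain ⟨hsph, m, hm, hlow, hup⟩ := H R hR hRδ z hz
  have hball : Metric.ball x R ⊆ Metric.ball z (2 * R) :=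
    Metric.ball_subset_ball' (by linarith)
  have hball' : Metric.ball z (2 * R) ⊆ Metric.ball x (3 * R) :=
    Metric.ball_subset_ball' (by rw [dist_comm]; linarith)
  have hball'' : Metric.ball z (2 * R) ⊆ Metric.ball z (4 * R) :=
    Metric.ball_subset_ball (by linarith)
  have hdm : Measurable fun y => Metric.infDist y Uᶜ :=
    (Metric.continuous_infDist_pt _).measurable
  set μ : ℝ≥0∞ := ENNReal.ofReal ((Real.sqrt m)⁻¹) with hμ
  -- The lower bound `m ≤ b` is needed only where `Φ` is measured, away from the shore, and the
  -- upper bound `b ≤ C m` only where `G` is. The unweighted Poincaré inequality links the two, and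
  -- `m` cancels.
  have h1 : ∫⁻ y in Metric.ball x R ∩ {y ∈ U | R / 4 ≤ Metric.infDist y Uᶜ},
      ‖(Real.sqrt (b y))⁻¹ * Φ y‖ₑ ^ 2 ≤ μ ^ 2 * ∫⁻ y in Metric.ball z (2 * R), ‖Φ y‖ₑ ^ 2 := by
    rw [← lintegral_const_mul' _ _ (by finiteness)]
    have hSm : MeasurableSet (Metric.ball x R ∩ {y ∈ U | R / 4 ≤ Metric.infDist y Uᶜ}) :=
      Metric.isOpen_ball.measurableSet.inter (hUm.inter (measurableSet_le measurable_const hdm))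
    refine (setLIntegral_mono_ae' hSm ?_).trans (lintegral_mono_set
      (Set.inter_subset_left.trans hball))
    filter_upwards [(ae_restrict_iff' hUm).1 hlow] with y hy hyS
    have hby := hy hyS.2.1 (hball'' (hball hyS.1)) hyS.2.2
    rw [enorm_mul, mul_pow, Real.enorm_eq_ofReal (by positivity), hμ]
    gcongr
  have h2 : ∫⁻ y in Metric.ball z (2 * R), ‖Φ y‖ₑ ^ 2 ≤
      ENNReal.ofReal (2 * Real.pi * (2 * R)) ^ 2 *
        ∫⁻ y in Metric.ball z (2 * R), ‖G y‖ₑ ^ 2 := by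
    rw [← eLpNorm_two_sq, ← eLpNorm_two_sq, ← mul_pow]
    gcongr
    exact hΦ.eLpNorm_ball_le hsph
  have h3 : ∫⁻ y in Metric.ball z (2 * R), ‖G y‖ₑ ^ 2 ≤ ENNReal.ofReal (Real.sqrt (C * m)) ^ 2 *
      ∫⁻ y in Metric.ball x (3 * R) ∩ U, ‖wgt b G y‖ₑ ^ 2 := by
    rw [← lintegral_inter_add_sdiff (fun y => ‖G y‖ₑ ^ 2) (Metric.ball z (2 * R)) hUm]
    have hz0 : ∫⁻ y in Metric.ball z (2 * R) \ U, ‖G y‖ₑ ^ 2 = 0 := by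
      refine le_antisymm ((lintegral_mono_set fun y hy => hy.2).trans (le_of_eq (b := 0) ?_)) zero_le
      rw [lintegral_congr_ae (g := 0)]
      · simp
      · filter_upwards [hΦ.gradient_ae_zero hUm] with y hy
        simp [hy]
    rw [hz0, add_zero, ← lintegral_const_mul' _ _ (by finiteness)]
    refine (setLIntegral_mono_ae' (Metric.isOpen_ball.measurableSet.inter hUm) ?_).trans
      (lintegral_mono_set (Set.inter_subset_inter_left _ hball'))
    filter_upwards [(ae_restrict_iff' hUm).1 hup, (ae_restrict_iff' hUm).1 h.isDepth.ae_pos]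
      with y hy hpos hyS
    have hby := hy hyS.2 (hball'' hyS.1)
    have hpos' := Real.sqrt_pos.2 (hpos hyS.2)
    rw [← mul_pow, wgt, enorm_smul, ← mul_assoc, Real.enorm_eq_ofReal (by positivity),
      ← ENNReal.ofReal_mul (by positivity)]
    gcongr
    refine le_mul_of_one_le_left zero_le (ENNReal.one_le_ofReal.2 ?_)
    rw [← div_eq_mul_inv, one_le_div hpos']
    exact Real.sqrt_le_sqrt hby
  calc _ ≤ μ ^ 2 * (ENNReal.ofReal (2 * Real.pi * (2 * R)) ^ 2 *
        (ENNReal.ofReal (Real.sqrt (C * m)) ^ 2 *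
          ∫⁻ y in Metric.ball x (3 * R) ∩ U, ‖wgt b G y‖ₑ ^ 2)) := by
        refine h1.trans ?_
        gcongr
        refine h2.trans ?_
        gcongr
    _ = _ := by
      rw [← mul_assoc, ← mul_assoc, ← mul_pow, ← mul_pow, hμ, ← ENNReal.ofReal_mul (by positivity),
        ← ENNReal.ofReal_mul (by positivity)]
      congr 3
      rw [Real.sqrt_mul hC.le]
      field_simp
      ring

/-- Averaging of local inequalities over the centres of the balls. -/
lemma lintegral_le_of_local {d : Plane → ℝ} (hd : ∀ x y, d x ≤ d y + dist x y)
    (hdm : Measurable d) {p q : Plane → ℝ≥0∞} (hp : AEMeasurable p) (hq : AEMeasurable q) {R : ℝ}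
    (hR : 0 < R) {K : ℝ≥0∞} (hK : K ≠ ⊤)
    (hpR : ∀ y, R / 2 < d y → p y = 0)
    (h : ∀ x, d x < R → ∫⁻ y in Metric.ball x R, p y ≤ K * ∫⁻ y in Metric.ball x (3 * R), q y) :
    ∫⁻ y, p y ≤ K * 36 * ∫⁻ y in {y | d y < 4 * R}, q y := by
  have hS : ∀ t, MeasurableSet {x | d x < t} := fun t => measurableSet_lt hdm measurable_const
  have hswap : ∀ (f : Plane → ℝ≥0∞), AEMeasurable f → ∀ t : ℝ,
      ∫⁻ x in {x | d x < R}, ∫⁻ y in Metric.ball x t, f y =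
        ∫⁻ y, f y * volume (Metric.ball y t ∩ {x | d x < R}) := by
    intro f hf t
    have h1 : ∀ x, ∫⁻ y in Metric.ball x t, f y =
        ∫⁻ y, {p : Plane × Plane | dist p.2 p.1 < t}.indicator (fun p => f p.2) (x, y) := by
      intro x
      rw [← lintegral_indicator Metric.isOpen_ball.measurableSet]
      rfl
    simp_rw [h1]
    rw [lintegral_lintegral_swap]
    · refine lintegral_congr fun y => ?_
      have h2 : ∀ x, {p : Plane × Plane | dist p.2 p.1 < t}.indicator (fun p => f p.2) (x, y)
          = (Metric.ball y t).indicator (fun _ => f y) x := by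
        intro x
        simp only [Set.indicator, Set.mem_ofPred_eq, Metric.mem_ball, dist_comm]
      simp_rw [h2]
      rw [lintegral_indicator_const Metric.isOpen_ball.measurableSet,
        Measure.restrict_apply Metric.isOpen_ball.measurableSet]
    · refine AEMeasurable.indicator ?_ (measurableSet_lt (by fun_prop) measurable_const)
      exact hf.comp_quasiMeasurePreserving Measure.quasiMeasurePreserving_snd
  -- Averaging uses Fubini: each `y` is counted with the area of the admissible centres near it. The
  -- constant `36 = 6²` is the ratio of the areas of discs of radii `3R` and `R/2`.
  set v := volume (Metric.ball (0 : Plane) (R / 2)) with hv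
  have hv0 : v ≠ 0 := (Metric.measure_ball_pos _ _ (by positivity)).ne'
  have hvt : v ≠ ⊤ := measure_ball_lt_top.ne
  have hv3 : ∀ y, volume (Metric.ball (y : Plane) (3 * R)) = 36 * v := by
    intro y
    have h1 := Measure.addHaar_ball_mul (volume : Measure Plane) y (r := 6) (by norm_num) (R / 2)
    rw [show (6 : ℝ) * (R / 2) = 3 * R by ring] at h1
    rw [h1, finrank_euclideanSpace_fin, ← hv]
    norm_num
  -- Where `p` is nonzero, `d y ≤ R/2`, so the whole disc of radius `R/2` about `y` consists of
  -- admissible centres.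
  have hlow : v * ∫⁻ y, p y ≤ ∫⁻ x in {x | d x < R}, ∫⁻ y in Metric.ball x R, p y := by
    rw [hswap p hp, ← lintegral_const_mul' _ _ hvt]
    refine lintegral_mono fun y => ?_
    by_cases hy : R / 2 < d y
    · simp [hpR y hy]
    · rw [mul_comm]
      gcongr
      rw [hv, ← Measure.addHaar_ball_center volume y]
      refine measure_mono fun x hx => ⟨Metric.ball_subset_ball (by linarith) hx, ?_⟩
      have := hd x y
      rw [Metric.mem_ball] at hx
      simp only [Set.mem_ofPred_eq]
      linarith
  have hup : ∫⁻ x in {x | d x < R}, ∫⁻ y in Metric.ball x (3 * R), q y ≤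
      36 * v * ∫⁻ y in {y | d y < 4 * R}, q y := by
    rw [hswap q hq, ← lintegral_const_mul' _ _ (by finiteness), ← lintegral_indicator (hS _)]
    refine lintegral_mono fun y => ?_
    by_cases hy : d y < 4 * R
    · simp only [Set.indicator, Set.mem_ofPred_eq, hy, if_true]
      rw [mul_comm, ← hv3 y]
      gcongr
      exact Set.inter_subset_left
    · have : Metric.ball y (3 * R) ∩ {x | d x < R} = ∅ := by
        refine Set.eq_empty_of_forall_notMem fun x hx => hy ?_
        have h1 := hd y x
        have h2 := hx.1
        have h3 : d x < R := hx.2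
        rw [Metric.mem_ball, dist_comm] at h2
        linarith
      simp [this]
  have hmid : ∫⁻ x in {x | d x < R}, ∫⁻ y in Metric.ball x R, p y ≤
      ∫⁻ x in {x | d x < R}, K * ∫⁻ y in Metric.ball x (3 * R), q y :=
    setLIntegral_mono' (hS R) fun x hx => h x hx
  rw [lintegral_const_mul' _ _ hK] at hmid
  have hall : v * ∫⁻ y, p y ≤ v * (K * 36 * ∫⁻ y in {y | d y < 4 * R}, q y) :=
    calc _ ≤ K * (36 * v * ∫⁻ y in {y | d y < 4 * R}, q y) :=
          hlow.trans (hmid.trans (by gcongr))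
      _ = _ := by ring
  exact (ENNReal.mul_le_mul_iff_right hv0 hvt).1 hall

/-- Smoothing a Lipschitz function: same Lipschitz constant, and same values where the function is
locally constant at the scale of the smoothing. -/
lemma exists_smooth_approx {g : Plane → ℝ} {L : NNReal} (hg : LipschitzWith L g) {r : ℝ}
    (hr : 0 < r) {B : ℝ} (hB : ∀ x y, dist (g x) (g y) ≤ B) :
    ∃ η : Plane → ℝ, ContDiff ℝ ∞ η ∧ (∀ x, ‖gradient η x‖ ≤ L) ∧ (∀ x, dist (η x) (g x) ≤ B) ∧
      ∀ x, (∀ y ∈ Metric.ball x r, g y = g x) → η x = g x := by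
  let φ : ContDiffBump (0 : Plane) := ⟨r / 2, r, by positivity, by linarith⟩
  set η : Plane → ℝ := convolution (φ.normed volume) g (ContinuousLinearMap.lsmul ℝ ℝ) volume
    with hη
  have hint : ∀ x, Integrable fun t => φ.normed volume t • g (x - t) := by
    intro x
    refine Continuous.integrable_of_hasCompactSupport ?_ ?_
    · exact φ.continuous_normed.smul (hg.continuous.comp (by fun_prop))
    · exact φ.hasCompactSupport_normed.smul_right
  have hlip : LipschitzWith L η := by
    refine LipschitzWith.of_dist_le_mul fun x y => ?_
    have h1 : η x - η y = ∫ t, φ.normed volume t • (g (x - t) - g (y - t)) := by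
      simp only [hη, convolution_def, ContinuousLinearMap.lsmul_apply]
      rw [← integral_sub (hint x) (hint y)]
      simp only [smul_sub]
    rw [Real.dist_eq, h1, ← Real.norm_eq_abs]
    refine (norm_integral_le_of_norm_le (g := fun t => φ.normed volume t * (L * dist x y))
      (φ.integrable_normed.mul_const _) (ae_of_all _ fun t => ?_)).trans (le_of_eq ?_)
    · rw [norm_smul, Real.norm_of_nonneg (φ.nonneg_normed t)]
      gcongr
      · exact φ.nonneg_normed t
      · simpa [dist_eq_norm] using hg.dist_le_mul (x - t) (y - t)
    · rw [integral_mul_const, φ.integral_normed, one_mul]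
  refine ⟨η, ?_, fun x => ?_, fun x => ?_, fun x hx => ?_⟩
  · exact HasCompactSupport.contDiff_convolution_left (n := ⊤) _ φ.hasCompactSupport_normed
      φ.contDiff_normed hg.continuous.locallyIntegrable
  · rw [norm_gradient]
    exact norm_fderiv_le_of_lipschitz ℝ hlip
  · exact ContDiffBump.dist_normed_convolution_le hg.continuous.aestronglyMeasurable
      fun y _ => hB y x
  · exact ContDiffBump.normed_convolution_eq_right hx

/-- A linear ramp in the distance to the complement, rising from 0 at `5δ/4` to 1 at `7δ/4` (slope
`2/δ`), is smoothed at scale `δ/4`; the margins keep the gradient in the collar between `δ` and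
`2δ`. The crude bound 2 for `|1 - η|` comes from `0 ≤ g ≤ 1` and `|η - g| ≤ 1`. -/
lemma exists_distance_cutoff {U : Set Plane} (hUb : Bornology.IsBounded U)
    {δ : ℝ} (hδ : 0 < δ) :
    ∃ η : Plane → ℝ, IsTest U η ∧ (∀ x, |1 - η x| ≤ 2) ∧
      (∀ x, 2 * δ ≤ Metric.infDist x Uᶜ → η x = 1) ∧ (∀ x, ‖gradient η x‖ ≤ 2 / δ) ∧
      (∀ x, Metric.infDist x Uᶜ < δ → gradient η x = 0) ∧
      (∀ x, 2 * δ < Metric.infDist x Uᶜ → gradient η x = 0) := by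
  set d : Plane → ℝ := fun x => Metric.infDist x Uᶜ with hd
  have hdc : Continuous d := Metric.continuous_infDist_pt _
  have hdd : ∀ x y, d x ≤ d y + dist x y := fun x y => Metric.infDist_le_infDist_add_dist
  set g : Plane → ℝ := fun x => max 0 (min 1 ((d x - 5 / 4 * δ) * (2 / δ))) with hg
  have hg01 : ∀ x, 0 ≤ g x ∧ g x ≤ 1 := fun x => ⟨le_max_left _ _, by simp [hg]⟩
  have hL : LipschitzWith (Real.toNNReal (2 / δ)) g := by
    refine ((LipschitzWith.of_le_add_mul _ fun x y => ?_).const_min 1).const_max 0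
    rw [Real.coe_toNNReal _ (by positivity)]
    have h1 := mul_le_mul_of_nonneg_right (hdd x y) (show 0 ≤ 2 / δ by positivity)
    linarith
  obtain ⟨η, hη, hgrad, hdist, heq⟩ := exists_smooth_approx hL (r := δ / 4) (by positivity)
    (B := 1) fun x y => by
      rw [Real.dist_eq, abs_le]
      constructor <;> linarith [hg01 x, hg01 y]
  rw [Real.coe_toNNReal _ (by positivity)] at hgrad
  have h0 : ∀ x, d x < 5 / 4 * δ → g x = 0 := by
    intro x hx
    refine max_eq_left ((min_le_right _ _).trans ?_)
    exact mul_nonpos_of_nonpos_of_nonneg (by linarith) (by positivity)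
  have h1 : ∀ x, 7 / 4 * δ < d x → g x = 1 := by
    intro x hx
    have : 1 ≤ (d x - 5 / 4 * δ) * (2 / δ) := by
      rw [← mul_div_assoc, one_le_div hδ]; linarith
    simp [hg, min_eq_left this]
  have hη0 : ∀ x, d x < δ → η x = 0 := by
    intro x hx
    rw [heq x fun y hy => ?_, h0 x (by linarith)]
    have := hdd y x
    rw [Metric.mem_ball] at hy
    rw [h0 x (by linarith), h0 y (by linarith)]
  have hη1 : ∀ x, 2 * δ ≤ d x → η x = 1 := by
    intro x hx
    rw [heq x fun y hy => ?_, h1 x (by linarith)]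
    have := hdd x y
    rw [Metric.mem_ball, dist_comm] at hy
    rw [h1 x (by linarith), h1 y (by linarith)]
  have hKU : {x | δ ≤ d x} ⊆ U := by
    intro x hx
    by_contra hxU
    have h2 : d x = 0 := Metric.infDist_zero_of_mem hxU
    have h3 : δ ≤ d x := hx
    linarith
  refine ⟨η, IsTest.of_support_subset hη (K := {x | δ ≤ d x})
    (Metric.isCompact_of_isClosed_isBounded (isClosed_le continuous_const hdc) (hUb.subset hKU))
    hKU fun x hx => hη0 x (not_le.1 hx), fun x => ?_, hη1, hgrad, fun x hx => ?_, fun x hx => ?_⟩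
  · have h2 := hdist x
    rw [Real.dist_eq, abs_le] at h2
    rw [abs_le]
    constructor <;> linarith [hg01 x]
  · have h2 : ∀ᶠ y in 𝓝 x, η y = 0 :=
      (hdc.continuousAt.eventually (gt_mem_nhds hx)).mono hη0
    rw [EventuallyEq.gradient_eq (f := fun _ => (0 : ℝ)) h2]
    simp
  · have h2 : ∀ᶠ y in 𝓝 x, η y = 1 :=
      (hdc.continuousAt.eventually (lt_mem_nhds hx)).mono fun y hy => hη1 y (le_of_lt hy)
    rw [EventuallyEq.gradient_eq (f := fun _ => (1 : ℝ)) h2]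
    simp

lemma infDist_compl_pos {U : Set Plane} (hU : IsOpen U) (hne : Uᶜ.Nonempty) {x : Plane}
    (hx : x ∈ U) : 0 < Metric.infDist x Uᶜ :=
  (hU.isClosed_compl.notMem_iff_infDist_pos hne).1 (by simpa using hx)

/-- Absolute continuity of the integral: the collars in `U` decrease to the empty set. The width
`16δ` is what the averaged Hardy inequality at scale `4δ` requires. -/
lemma exists_eLpNorm_collar_lt {U : Set Plane} (hU : IsOpen U) (hUb : Bornology.IsBounded U)
    (hne : Uᶜ.Nonempty) {W : Plane → Plane} (hW : MemLp W 2 (volume.restrict U)) {τ : ℝ≥0∞}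
    (hτ : τ ≠ 0) {δ₀ : ℝ} (hδ₀ : 0 < δ₀) :
    ∃ δ, 0 < δ ∧ δ < δ₀ ∧
      eLpNorm W 2 (volume.restrict ({x | Metric.infDist x Uᶜ < 16 * δ} ∩ U)) < τ := by
  have hdc : Continuous fun x => Metric.infDist x Uᶜ := Metric.continuous_infDist_pt _
  set δ : ℕ → ℝ := fun n => δ₀ / 2 * (1 / (n + 1 : ℝ)) with hδ
  have hδpos : ∀ n, 0 < δ n := fun n => by positivity
  have hδlt : ∀ n, δ n < δ₀ := by
    intro n
    have : 1 / (n + 1 : ℝ) ≤ 1 := by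
      rw [div_le_one (by positivity)]; linarith [Nat.cast_nonneg (α := ℝ) n]
    simp only [hδ]
    nlinarith
  have hδ0 : Tendsto δ atTop (𝓝 0) := by
    have := tendsto_one_div_add_atTop_nhds_zero_nat.const_mul (δ₀ / 2)
    rwa [mul_zero] at this
  set S : ℕ → Set Plane := fun n => {x | Metric.infDist x Uᶜ < 16 * δ n} with hS
  have hSm : ∀ n, MeasurableSet (S n) := fun n => (isOpen_lt hdc continuous_const).measurableSet
  have hanti : Antitone S := by
    intro m n hmn x hx
    have h1 : Metric.infDist x Uᶜ < 16 * δ n := hx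
    have h2 : δ n ≤ δ m := by
      simp only [hδ]
      gcongr
    show Metric.infDist x Uᶜ < 16 * δ m
    linarith
  have hlim : Tendsto ((volume.restrict U) ∘ S) atTop (𝓝 0) := by
    have h1 := tendsto_measure_iInter_atTop (μ := volume.restrict U)
      (fun n => (hSm n).nullMeasurableSet) hanti ⟨0, by
        rw [Measure.restrict_apply (hSm 0)]
        exact ((measure_mono Set.inter_subset_right).trans_lt hUb.measure_lt_top).ne⟩
    have h2 : (volume.restrict U) (⋂ n, S n) = 0 := by
      rw [Measure.restrict_apply (MeasurableSet.iInter hSm)]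
      convert measure_empty (μ := (volume : Measure Plane))
      refine Set.eq_empty_of_forall_notMem fun x hx => ?_
      have h3 := infDist_compl_pos hU hne hx.2
      have h4 : Tendsto (fun n => 16 * δ n) atTop (𝓝 0) := by simpa using hδ0.const_mul 16
      obtain ⟨n, hn⟩ := (h4.eventually (gt_mem_nhds h3)).exists
      have h5 : Metric.infDist x Uᶜ < 16 * δ n := Set.mem_iInter.1 hx.1 n
      linarith
    rwa [h2] at h1
  have hfin : ∫⁻ x in U, ‖W x‖ₑ ^ 2 ≠ ⊤ := by
    rw [← eLpNorm_two_sq]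
    exact ENNReal.pow_ne_top hW.2.ne
  have h1 := tendsto_setLIntegral_zero hfin hlim
  obtain ⟨n, hn⟩ := (h1.eventually (gt_mem_nhds (pos_iff_ne_zero.2 (pow_ne_zero 2 hτ)))).exists
  refine ⟨δ n, hδpos n, hδlt n, ?_⟩
  rw [Measure.restrict_restrict (hSm n), ← eLpNorm_two_sq] at hn
  exact (ENNReal.pow_lt_pow_left_iff two_ne_zero).1 hn

/-- Test functions are dense in the functions of `H^1_0` with finite weighted energy. -/
lemma IsIslandLake.exists_isTest_approx {Ωt I : Set Plane} {b : Plane → ℝ}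
    (h : IsIslandLake Ωt I b) {Φ : Plane → ℝ} {G : Plane → Plane} (hΦ : IsH10 (Ωt \ I) Φ G)
    (hW : MemLp (wgt b G) 2 (volume.restrict (Ωt \ I))) {τ : ℝ≥0∞} (hτ : τ ≠ 0) :
    ∃ η, IsTest (Ωt \ I) η ∧
      eLpNorm (wgt b G - wgt b (gradient η)) 2 (volume.restrict (Ωt \ I)) < τ := by
  set U := Ωt \ I with hUdef
  have hb : IsDepth U b := h.isDepth
  have hU : IsOpen U := hb.isOpen
  have hUm := hU.measurableSet
  have hUb : Bornology.IsBounded U := h.isBounded.subset Set.sdiff_subset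
  have hne : Uᶜ.Nonempty := by
    obtain ⟨p, hp⟩ := h.island_nontrivial.nonempty
    exact ⟨p, fun hpU => hpU.2 hp⟩
  set d : Plane → ℝ := fun x => Metric.infDist x Uᶜ with hd
  have hdc : Continuous d := Metric.continuous_infDist_pt _
  obtain ⟨δ₀, C, hδ₀, hC, H⟩ := h.exists_local_hardy hΦ
  -- The cut-off error has two terms: `(1 - η) b^{-1/2} G`, costing 2, and `b^{-1/2} Φ ∇η`, costing
  -- `(2/δ) · 24Cδ = 48C` by Hardy.
  set c : ℝ≥0∞ := ENNReal.ofReal 2 + ENNReal.ofReal (48 * C) with hc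
  have hc0 : c ≠ 0 := by simp [hc]
  have hct : c ≠ ⊤ := by finiteness
  obtain ⟨δ, hδ, hδδ₀, he⟩ := exists_eLpNorm_collar_lt hU hUb hne hW
    (τ := τ / 2 / c) (by simp [hτ, hct, ENNReal.div_eq_zero_iff]) (δ₀ := δ₀ / 4) (by positivity)
  set e := eLpNorm (wgt b G) 2 (volume.restrict ({x | Metric.infDist x Uᶜ < 16 * δ} ∩ U)) with he'
  obtain ⟨η, hη, hη2, hη1, hηg, hη0, hη0'⟩ := exists_distance_cutoff hUb hδ
  -- `F` is the gradient of `η Φ`. This product lives on a compact subset of `U`, where the weight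
  -- is bounded, so unweighted `H^1_0` approximation suffices for it.
  set F : Plane → Plane := fun x => η x • G x + Φ x • gradient η x with hF
  have hbm : AEMeasurable b (volume.restrict U) := hb.meas.aemeasurable
  have hΦm := hΦ.1.1.aemeasurable
  -- the Hardy inequality in the collar
  set A : Set Plane := {x | δ ≤ d x ∧ d x ≤ 2 * δ} ∩ U with hA
  have hAm : MeasurableSet A :=
    ((isClosed_le continuous_const hdc).inter (isClosed_le hdc continuous_const)).measurableSet.inter
      hUm
  have hhardy : eLpNorm (fun x => (Real.sqrt (b x))⁻¹ * Φ x) 2 (volume.restrict A) ≤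
      ENNReal.ofReal (24 * C * δ) * e := by
    refine eLpNorm_two_le_of_lintegral_le ?_
    -- At scale `R = 4δ` the collar `δ ≤ d ≤ 2δ` is `R/4 ≤ d ≤ R/2`, as both the local inequality
    -- and the averaging demand. Finally `C · 4δ · √36 = 24Cδ`.
    have h1 := lintegral_le_of_local (d := d)
      (p := A.indicator fun x => ‖(Real.sqrt (b x))⁻¹ * Φ x‖ₑ ^ 2)
      (q := U.indicator fun x => ‖wgt b G x‖ₑ ^ 2)
      (fun x y => Metric.infDist_le_infDist_add_dist) hdc.measurable
      ((aemeasurable_indicator_iff hAm).2 ?_) ((aemeasurable_indicator_iff hUm).2 ?_)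
      (R := 4 * δ) (by positivity) (K := ENNReal.ofReal (C * (4 * δ)) ^ 2) (by finiteness) ?_ ?_
    · have h36 : (36 : ℝ≥0∞) = ENNReal.ofReal 6 ^ 2 := by
        rw [← ENNReal.ofReal_pow (by norm_num)]; norm_num
      rw [lintegral_indicator hAm, setLIntegral_indicator hUm, h36, ← mul_pow,
        ← ENNReal.ofReal_mul (by positivity), show C * (4 * δ) * 6 = 24 * C * δ by ring,
        show 4 * (4 * δ) = 16 * δ by ring, Set.inter_comm U] at h1
      exact h1
    · exact (((hbm.mono_measure (Measure.restrict_mono Set.inter_subset_right le_rfl)).sqrt.inv.mul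
        hΦm.restrict).enorm).pow_const 2
    · exact hW.1.enorm.pow_const 2
    · intro y hy
      refine Set.indicator_of_notMem (fun hyA => ?_) _
      linarith [hyA.1.2]
    · intro x hx
      rw [setLIntegral_indicator hAm, setLIntegral_indicator hUm]
      refine (lintegral_mono_set ?_).trans ((H (4 * δ) (by positivity) (by linarith) x hx).trans
        (le_of_eq ?_))
      · rintro y ⟨hyA, hyx⟩
        refine ⟨hyx, hyA.2, ?_⟩
        have := hyA.1.1
        show 4 * δ / 4 ≤ d y
        linarith
      · rw [Set.inter_comm]
  have hSm : MeasurableSet {x | d x < 16 * δ} := (isOpen_lt hdc continuous_const).measurableSet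
  -- the error made by cutting off
  have hcut : eLpNorm (wgt b G - wgt b F) 2 (volume.restrict U) < τ / 2 := by
    have h1 : eLpNorm (fun x => (1 - η x) • wgt b G x) 2 (volume.restrict U) ≤
        ENNReal.ofReal 2 * e := by
      rw [he', ← Measure.restrict_restrict hSm, ← eLpNorm_indicator_eq_eLpNorm_restrict hSm]
      refine eLpNorm_le_mul_eLpNorm_of_ae_le_mul (ae_of_all _ fun x => ?_) 2
      by_cases hx : d x < 16 * δ
      · rw [Set.indicator_of_mem (by exact hx), norm_smul, Real.norm_eq_abs]
        gcongr
        exact hη2 x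
      · have h3 : η x = 1 := hη1 x (by show 2 * δ ≤ d x; linarith)
        simp [h3]
    have h2 : eLpNorm (fun x => ((Real.sqrt (b x))⁻¹ * Φ x) • gradient η x) 2
        (volume.restrict U) ≤ ENNReal.ofReal (48 * C) * e := by
      have hA' : MeasurableSet {x | δ ≤ d x ∧ d x ≤ 2 * δ} :=
        ((isClosed_le continuous_const hdc).inter (isClosed_le hdc continuous_const)).measurableSet
      have h3 : eLpNorm (fun x => ((Real.sqrt (b x))⁻¹ * Φ x) • gradient η x) 2
          (volume.restrict U) ≤ ENNReal.ofReal (2 / δ) *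
            eLpNorm (fun x => (Real.sqrt (b x))⁻¹ * Φ x) 2 (volume.restrict A) := by
        rw [hA, ← Measure.restrict_restrict hA', ← eLpNorm_indicator_eq_eLpNorm_restrict hA']
        refine eLpNorm_le_mul_eLpNorm_of_ae_le_mul (ae_of_all _ fun x => ?_) 2
        by_cases hx : δ ≤ d x ∧ d x ≤ 2 * δ
        · rw [Set.indicator_of_mem (by exact hx), norm_smul, mul_comm]
          gcongr
          exact hηg x
        · have h4 : gradient η x = 0 := by
            by_cases h5 : d x < δ
            · exact hη0 x h5
            · exact hη0' x (not_le.1 fun h6 => hx ⟨not_lt.1 h5, h6⟩)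
          rw [h4, smul_zero, norm_zero]
          positivity
      refine h3.trans ((mul_le_mul_right hhardy _).trans (le_of_eq ?_))
      rw [← mul_assoc, ← ENNReal.ofReal_mul (by positivity)]
      congr 2
      field_simp
      ring
    have h3 : wgt b G - wgt b F = (fun x => (1 - η x) • wgt b G x) -
        fun x => ((Real.sqrt (b x))⁻¹ * Φ x) • gradient η x := by
      ext1 x
      simp only [Pi.sub_apply, wgt, hF]
      module
    rw [h3]
    refine (eLpNorm_sub_le ?_ ?_ one_le_two).trans_lt ?_
    · exact (continuous_const.sub hη.smooth.continuous).aestronglyMeasurable.smul hW.1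
    · exact ((hbm.sqrt.inv.mul hΦm.restrict).aestronglyMeasurable).smul
        hη.continuous_gradient.aestronglyMeasurable
    · refine (add_le_add h1 h2).trans_lt ?_
      rw [← add_mul, mul_comm]
      exact (ENNReal.lt_div_iff_mul_lt (Or.inl hc0) (Or.inl hct)).1 he
  -- approximation of the cut-off function
  obtain ⟨hΦL, hGL, φ, hφ, hφ0, hφ1⟩ := hΦ
  obtain ⟨c', hc', hw⟩ := hb.eLpNorm_wgt_le hη.compactSupp.isCompact hη.supp_subset
  have hη3 : ∀ x, ‖η x‖ ≤ 3 := by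
    intro x
    have := abs_le.1 (hη2 x)
    rw [Real.norm_eq_abs, abs_le]
    constructor <;> linarith
  have htest : ∀ n, IsTest U fun x => η x * φ n x := fun n =>
    IsTest.of_support_subset (hη.smooth.mul (hφ n).smooth) hη.compactSupp.isCompact hη.supp_subset
      fun x hx => by simp [image_eq_zero_of_notMem_tsupport hx]
  have hgr : ∀ n x, F x - gradient (fun x => η x * φ n x) x =
      (Φ x - φ n x) • gradient η x - η x • (gradient (φ n) x - G x) := by
    intro n x
    rw [gradient_fun_mul (hη.differentiable x) ((hφ n).differentiable x)]
    simp only [hF]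
    module
  have hle : ∀ n, eLpNorm (wgt b F - wgt b (gradient fun x => η x * φ n x)) 2
      (volume.restrict U) ≤ ENNReal.ofReal c' *
        (ENNReal.ofReal (2 / δ) * eLpNorm (fun x => φ n x - Φ x) 2 volume +
          ENNReal.ofReal 3 * eLpNorm (fun x => gradient (φ n) x - G x) 2 volume) := by
    intro n
    have h1 : wgt b F - wgt b (gradient fun x => η x * φ n x) =
        wgt b (fun x => F x - gradient (fun x => η x * φ n x) x) := by
      ext1 x
      simp only [Pi.sub_apply, wgt, smul_sub]
    rw [h1]
    refine (hw _ fun x hx => ?_).trans ?_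
    · rw [hgr, image_eq_zero_of_notMem_tsupport hx,
        image_eq_zero_of_notMem_tsupport fun h => hx (tsupport_gradient_subset η h)]
      simp
    · gcongr
      simp_rw [hgr]
      refine (eLpNorm_sub_le (f := fun x => (Φ x - φ n x) • gradient η x)
        (g := fun x => η x • (gradient (φ n) x - G x)) ?_ ?_ one_le_two).trans
        (add_le_add ?_ ?_)
      · exact (hΦL.1.sub (hφ n).memLp.1).smul hη.continuous_gradient.aestronglyMeasurable
      · exact hη.smooth.continuous.aestronglyMeasurable.smul ((hφ n).memLp_gradient.1.sub hGL.1)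
      · refine eLpNorm_le_mul_eLpNorm_of_ae_le_mul (ae_of_all _ fun x => ?_) 2
        rw [norm_smul, mul_comm, norm_sub_rev]
        gcongr
        exact hηg x
      · refine eLpNorm_le_mul_eLpNorm_of_ae_le_mul (ae_of_all _ fun x => ?_) 2
        rw [norm_smul]
        gcongr
        exact hη3 x
  have hlim : Tendsto (fun n => ENNReal.ofReal c' *
        (ENNReal.ofReal (2 / δ) * eLpNorm (fun x => φ n x - Φ x) 2 volume +
          ENNReal.ofReal 3 * eLpNorm (fun x => gradient (φ n) x - G x) 2 volume)) atTop (𝓝 0) := by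
    have h1 := ENNReal.Tendsto.const_mul (a := ENNReal.ofReal (2 / δ)) hφ0 (Or.inr (by finiteness))
    have h2 := ENNReal.Tendsto.const_mul (a := ENNReal.ofReal 3) hφ1 (Or.inr (by finiteness))
    have h3 := ENNReal.Tendsto.const_mul (a := ENNReal.ofReal c') (h1.add h2)
      (Or.inr (by finiteness))
    simpa using h3
  obtain ⟨n, hn⟩ := (hlim.eventually (gt_mem_nhds
    (ENNReal.div_pos_iff.2 ⟨hτ, ENNReal.ofNat_ne_top⟩ : 0 < τ / 2))).exists
  refine ⟨_, htest n, ?_⟩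
  have hFm : AEStronglyMeasurable F (volume.restrict U) :=
    ((hη.smooth.continuous.aestronglyMeasurable.smul hGL.1).add
      (hΦL.1.smul hη.continuous_gradient.aestronglyMeasurable)).restrict
  have hFm' := hb.aestronglyMeasurable_wgt hFm
  have hTm := ((htest n).isGradTest.memLp hb).1
  calc _ = eLpNorm ((wgt b G - wgt b F) + (wgt b F - wgt b (gradient fun x => η x * φ n x))) 2
        (volume.restrict U) := by simp
    _ ≤ _ := eLpNorm_add_le (hW.1.sub hFm') (hFm'.sub hTm) one_le_two
    _ < τ / 2 + τ / 2 := ENNReal.add_lt_add hcut ((hle n).trans_lt hn)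
    _ = τ := ENNReal.add_halves τ

/-! ### The `b`-harmonic functions of a lake with one island -/

lemma inner_wgt {b : Plane → ℝ} {x : Plane} (hx : 0 ≤ b x) (G F : Plane → Plane) :
    inner ℝ (wgt b G x) (wgt b F x) = (b x)⁻¹ * inner ℝ (G x) (F x) := by
  rw [wgt, wgt, real_inner_smul_left, real_inner_smul_right, ← mul_assoc, ← mul_inv,
    Real.mul_self_sqrt hx]

lemma inner_rot_smul_rot (c : ℝ) (F G : Plane) :
    inner ℝ (rot F) (c • rot G) = c * inner ℝ G F := by
  rw [real_inner_smul_right, inner_rot, real_inner_comm]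

section general

variable {Ωt I : Set Plane} {b : Plane → ℝ} {Φ Φ' : Plane → ℝ} {G G' : Plane → Plane}

lemma IsDepth.inner_toLp_wgradLp {U : Set Plane} (hb : IsDepth U b)
    (hw : MemLp (wgt b G) 2 (volume.restrict U)) {f : Plane → ℝ} (hf : IsGradTest U f) :
    inner ℝ (hw.toLp _) (wgradLp U b f) = ∫ x in U, (b x)⁻¹ * inner ℝ (G x) (gradient f x) := by
  rw [inner_wgradLp hb hf]
  refine integral_congr_ae ?_
  filter_upwards [hw.coeFn_toLp, hb.ae_pos] with x hx hpos
  rw [hx, inner_wgt hpos.le]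

lemma IsDepth.integrable_inner {U : Set Plane} (hb : IsDepth U b)
    (hw : MemLp (wgt b G) 2 (volume.restrict U)) {f : Plane → ℝ} (hf : IsGradTest U f) :
    IntegrableOn (fun x => (b x)⁻¹ * inner ℝ (G x) (gradient f x)) U := by
  refine (MemLp.integrable_mul hw.norm (hf.memLp hb).norm).mono' ?_ ?_
  · have := hb.aestronglyMeasurable_wgt hf.isTest.continuous_gradient.aestronglyMeasurable
    refine AEStronglyMeasurable.congr (hw.1.inner this) ?_
    filter_upwards [hb.ae_pos] with x hx
    exact inner_wgt hx.le _ _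
  · filter_upwards [hb.ae_pos] with x hx
    rw [← inner_wgt hx.le]
    exact norm_inner_le_norm _ _

lemma HasIslandTrace.sub {c c' : ℝ} (h : HasIslandTrace Ωt I Φ G c)
    (h' : HasIslandTrace Ωt I Φ' G' c') :
    HasIslandTrace Ωt I (fun x => Φ x - Φ' x) (fun x => G x - G' x) (c - c') := by
  intro χ hχ
  convert (h χ hχ).sub (h' χ hχ) using 2 with x x
  · ring
  · module

lemma HasIslandTrace.const_mul {c : ℝ} (h : HasIslandTrace Ωt I Φ G c) (a : ℝ) :
    HasIslandTrace Ωt I (fun x => a * Φ x) (fun x => a • G x) (a * c) := by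
  intro χ hχ
  convert (h χ hχ).const_mul a using 2 with x x
  · ring
  · module

lemma wgt_sub (b : Plane → ℝ) (G G' : Plane → Plane) :
    wgt b (fun x => G x - G' x) = wgt b G - wgt b G' := by
  ext1 x; simp [wgt, smul_sub]

lemma wgt_const_smul (b : Plane → ℝ) (a : ℝ) (G : Plane → Plane) :
    wgt b (fun x => a • G x) = a • wgt b G := by
  ext1 x
  exact smul_comm _ _ _

lemma IsBHarmonic.sub (hb : IsDepth (Ωt \ I) b) (h : IsBHarmonic Ωt I b Φ G)
    (h' : IsBHarmonic Ωt I b Φ' G') :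
    IsBHarmonic Ωt I b (fun x => Φ x - Φ' x) (fun x => G x - G' x) where
  h10 := h.h10.sub h'.h10
  weighted := by
    have := MemLp.sub (f := wgt b G) (g := wgt b G') h.weighted h'.weighted
    rwa [← wgt_sub] at this
  equation η hη := by
    have h1 := integral_sub (hb.integrable_inner h.weighted hη.isGradTest)
      (hb.integrable_inner h'.weighted hη.isGradTest)
    rw [h.equation η hη, h'.equation η hη, sub_zero] at h1
    rw [← h1]
    congr 1 with x
    rw [inner_sub_left, mul_sub]
  trace := by
    obtain ⟨c, hc⟩ := h.trace
    obtain ⟨c', hc'⟩ := h'.trace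
    exact ⟨_, hc.sub hc'⟩

lemma IsBHarmonic.const_mul (h : IsBHarmonic Ωt I b Φ G) (a : ℝ) :
    IsBHarmonic Ωt I b (fun x => a * Φ x) (fun x => a • G x) where
  h10 := h.h10.const_mul a
  weighted := by
    have := MemLp.const_smul (f := wgt b G) h.weighted a
    rwa [← wgt_const_smul] at this
  equation η hη := by
    have h1 := h.equation η hη
    calc _ = ∫ x in Ωt \ I, a * ((b x)⁻¹ * inner ℝ (G x) (gradient η x)) := by
          congr 1 with x
          rw [real_inner_smul_left]; ring
      _ = 0 := by rw [integral_const_mul, h1, mul_zero]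
  trace := by
    obtain ⟨c, hc⟩ := h.trace
    exact ⟨_, hc.const_mul a⟩

lemma IsDepth.ae_eq_sqrt_smul {U : Set Plane} (hb : IsDepth U b) (G : Plane → Plane) :
    G =ᵐ[volume.restrict U] fun x => Real.sqrt (b x) • wgt b G x := by
  filter_upwards [hb.ae_pos] with x hx
  rw [wgt, smul_inv_smul₀ (Real.sqrt_pos.2 hx).ne']

end general

namespace IsIslandLake

variable {Ωt I : Set Plane} {b : Plane → ℝ} {Φ Φ' : Plane → ℝ} {G G' : Plane → Plane}
  {k : Lp Plane 2 (volume.restrict (Ωt \ I))}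

lemma exists_cutoff (h : IsIslandLake Ωt I b) : ∃ χ, IsCutoff Ωt I χ :=
  exists_isCutoff h.isOpen h.island_compact h.island_subset

/-- By density the weighted gradient is a limit of test gradients; the equation makes it orthogonal
to these, hence to itself. The Poincaré inequality then kills the function. -/
lemma ae_eq_zero_of_trace_zero (h : IsIslandLake Ωt I b) (hΦ : IsBHarmonic Ωt I b Φ G)
    (htr : HasIslandTrace Ωt I Φ G 0) : Φ =ᵐ[volume] 0 ∧ G =ᵐ[volume] 0 := by
  have hb := h.isDepth
  obtain ⟨χ, hχ⟩ := h.exists_cutoff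
  have h10 : IsH10 (Ωt \ I) Φ G := by simpa using htr χ hχ
  have hw : MemLp (wgt b G) 2 (volume.restrict (Ωt \ I)) := hΦ.weighted
  have hcl : hw.toLp _ ∈ closure (testGradients hb : Set (Lp Plane 2 _)) := by
    rw [EMetric.mem_closure_iff]
    intro τ hτ
    obtain ⟨η, hη, hlt⟩ := h.exists_isTest_approx h10 hw hτ.ne'
    refine ⟨_, ⟨η, hη, rfl⟩, ?_⟩
    rwa [wgradLp_eq hb hη.isGradTest, Lp.edist_toLp_toLp]
  have h0 : Set.EqOn (fun g => inner ℝ (hw.toLp _) g) (fun _ => (0 : ℝ))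
      (testGradients hb : Set (Lp Plane 2 _)) := by
    rintro _ ⟨η, hη, rfl⟩
    exact (hb.inner_toLp_wgradLp hw hη.isGradTest).trans (hΦ.equation η hη)
  have h1 := h0.closure (by fun_prop) (by fun_prop) hcl
  have h2 : hw.toLp _ = 0 := inner_self_eq_zero.1 h1
  have h3 : wgt b G =ᵐ[volume.restrict (Ωt \ I)] 0 := by
    have := hw.coeFn_toLp
    rw [h2] at this
    exact this.symm.trans (Lp.coeFn_zero _ _ _)
  have h4 : G =ᵐ[volume.restrict (Ωt \ I)] 0 := by
    filter_upwards [hb.ae_eq_sqrt_smul G, h3] with x hx hx0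
    rw [hx, hx0]; simp
  have h5 : G =ᵐ[volume] 0 :=
    ae_of_ae_restrict_of_ae_restrict_compl _ h4 (h10.gradient_ae_zero hb.isOpen.measurableSet)
  exact ⟨h10.ae_zero (h.isBounded.subset Set.sdiff_subset) h5, h5⟩

/-- The equation is the orthogonality; density, applied to the difference of `φ¹` and one cut-off,
gives approximation by cut-offs in the weighted norm. -/
lemma isPotential_of_isPhiOne (h : IsIslandLake Ωt I b) (hΦ : IsPhiOne Ωt I b Φ G)
    (hw : MemLp (wgt b G) 2 (volume.restrict (Ωt \ I))) : IsPotential Ωt I b (hw.toLp _) := by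
  have hb := h.isDepth
  refine ⟨?_, fun η hη => (hb.inner_toLp_wgradLp hw hη.isGradTest).trans (hΦ.1.equation η hη)⟩
  obtain ⟨χ, hχ⟩ := h.exists_cutoff
  have h10 : IsH10 (Ωt \ I) (fun x => Φ x - χ x) (fun x => G x - gradient χ x) := by
    simpa using hΦ.2 χ hχ
  rw [EMetric.mem_closure_iff]
  intro τ hτ
  have hw' : MemLp (wgt b fun x => G x - gradient χ x) 2 (volume.restrict (Ωt \ I)) := by
    rw [wgt_sub]
    exact hw.sub (hχ.isGradTest.memLp hb)
  obtain ⟨η, hη, hlt⟩ := h.exists_isTest_approx h10 hw' hτ.ne'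
  have hη' := hη.const_mul (-1)
  refine ⟨_, ⟨_, hχ.sub_isTest hη', rfl⟩, ?_⟩
  rw [wgradLp_eq hb (hχ.sub_isTest hη').isGradTest, Lp.edist_toLp_toLp]
  convert hlt using 2
  rw [hχ.1.gradient_sub hη', wgt_sub, wgt_sub, hη.gradient_const_mul]
  ext1 x
  simp [wgt]
  abel

lemma wgt_ae_eq (h : IsIslandLake Ωt I b) (hk : IsPotential Ωt I b k)
    (hΦ : IsPhiOne Ωt I b Φ G) : wgt b G =ᵐ[volume.restrict (Ωt \ I)] k := by
  have hw : MemLp (wgt b G) 2 (volume.restrict (Ωt \ I)) := hΦ.1.weighted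
  rw [hk.unique (h.isPotential_of_isPhiOne hΦ hw) h.isDepth]
  exact hw.coeFn_toLp.symm

lemma integral_inner_cutoff (h : IsIslandLake Ωt I b) (hk : IsPotential Ωt I b k)
    (hΦ : IsPhiOne Ωt I b Φ G) {χ : Plane → ℝ} (hχ : IsCutoff Ωt I χ) :
    ∫ x in Ωt \ I, (b x)⁻¹ * inner ℝ (G x) (gradient χ x) = ‖k‖ ^ 2 := by
  have hw : MemLp (wgt b G) 2 (volume.restrict (Ωt \ I)) := hΦ.1.weighted
  have hp := h.isPotential_of_isPhiOne hΦ hw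
  rw [← h.isDepth.inner_toLp_wgradLp hw hχ.isGradTest, hp.inner_cutoff h.isDepth hχ,
    hk.unique hp h.isDepth]

/-- The circulation of the velocity field of a multiple of `φ¹`. -/
lemma hasCirculation_iff (h : IsIslandLake Ωt I b) (hk : IsPotential Ωt I b k)
    (hΦ : IsPhiOne Ωt I b Φ G) (hG' : G' =ᵐ[volume] fun x => (a : ℝ) • G x) {κ : ℝ} :
    HasCirculation Ωt I (fun x => (b x)⁻¹ • rot (G' x)) κ ↔ κ = -(a * ‖k‖ ^ 2) := by
  have hint : ∀ f : Plane → ℝ, ∫ x in Ωt \ I, inner ℝ (rot (gradient f x)) ((b x)⁻¹ • rot (G' x)) =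
      a * ∫ x in Ωt \ I, (b x)⁻¹ * inner ℝ (G x) (gradient f x) := by
    intro f
    rw [← integral_const_mul]
    refine integral_congr_ae ?_
    filter_upwards [ae_restrict_of_ae hG'] with x hx
    rw [inner_rot_smul_rot, hx, real_inner_smul_left]
    ring
  have hU := h.isDepth.isOpen
  obtain ⟨χ, hχ⟩ := h.exists_cutoff
  constructor
  · rintro ⟨w, hw, hcurl, hcirc⟩
    -- The curl of `b⁻¹∇^⊥Φ` is weakly `div (b⁻¹∇Φ) = 0`. Any admissible `w` therefore vanishes
    -- almost everywhere, and the circulation is the gradient term alone.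
    have hw0 : ∀ᵐ x, x ∈ Ωt \ I → w x = 0 := by
      refine hU.ae_eq_zero_of_integral_contDiff_smul_eq_zero
        (hw.locallyIntegrableOn) fun η hη1 hη2 hη3 => ?_
      have hη : IsTest (Ωt \ I) η := ⟨hη1, hη2, hη3⟩
      have h1 := hcurl η hη
      rw [hint, hΦ.1.equation η hη, mul_zero, neg_zero] at h1
      rw [← h1, ← setIntegral_eq_integral_of_forall_compl_eq_zero (s := Ωt \ I)]
      · congr 1 with x
        simp [mul_comm]
      · intro x hx
        simp [hη.eq_zero hx]
    have h1 := hcirc χ hχ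
    rw [hint, h.integral_inner_cutoff hk hΦ hχ, integral_eq_zero_of_ae, neg_zero, zero_sub] at h1
    · exact h1
    · filter_upwards [(ae_restrict_iff' hU.measurableSet).2 hw0] with x hx
      simp [hx]
  · rintro rfl
    refine ⟨0, integrableOn_zero, fun η hη => ?_, fun χ hχ => ?_⟩
    · rw [hint, hΦ.1.equation η hη]; simp
    · rw [hint, h.integral_inner_cutoff hk hΦ hχ]; simp

/-- Take cut-offs whose weighted gradients tend to the potential `k`. Since the depth is bounded,
their plain gradients tend to `√b k`, extended by zero; by Poincaré the cut-offs themselves are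
Cauchy in `L²`, and their limit is `φ¹`. -/
lemma exists_isPhiOne (h : IsIslandLake Ωt I b) : ∃ φ G, IsPhiOne Ωt I b φ G := by
  have hb := h.isDepth
  have hUm := hb.isOpen.measurableSet
  obtain ⟨k, hk⟩ := exists_isPotential h.isOpen h.island_compact h.island_subset hb
  obtain ⟨D, hD, hΩD⟩ := h.isBounded.subset_ball_lt 0 0
  obtain ⟨M, hM, hbM⟩ := hb.bound
  have happ : ∀ n : ℕ, ∃ χ, IsCutoff Ωt I χ ∧ ‖wgradLp (Ωt \ I) b χ - k‖ < 1 / (n + 1 : ℝ) :=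
    fun n => hk.exists_cutoff (by positivity)
  choose χ hχ hχk using happ
  set G : Plane → Plane := (Ωt \ I).indicator fun x => Real.sqrt (b x) • k x with hG
  have hGU : G =ᵐ[volume.restrict (Ωt \ I)] fun x => Real.sqrt (b x) • k x :=
    indicator_ae_eq_restrict hUm
  have hwG : wgt b G =ᵐ[volume.restrict (Ωt \ I)] k := by
    filter_upwards [hGU, hb.ae_pos] with x hx hpos
    rw [wgt, hx, inv_smul_smul₀ (Real.sqrt_pos.2 hpos).ne']
  have hw : MemLp (wgt b G) 2 (volume.restrict (Ωt \ I)) := (Lp.memLp k).ae_eq hwG.symm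
  have hsq : ∀ F : Plane → Plane, ∀ᵐ x ∂(volume.restrict (Ωt \ I)),
      ‖F x‖ ≤ Real.sqrt M * ‖wgt b F x‖ := by
    intro F
    filter_upwards [hb.ae_eq_sqrt_smul F, hbM] with x hx hxM
    conv_lhs => rw [hx]
    rw [norm_smul, Real.norm_of_nonneg (Real.sqrt_nonneg _)]
    gcongr
  have hGm : MemLp G 2 volume := by
    rw [hG, memLp_indicator_iff_restrict hUm]
    refine MemLp.of_le ((Lp.memLp k).const_smul (Real.sqrt M))
      (hb.meas.aemeasurable.sqrt.aestronglyMeasurable.smul (Lp.memLp k).1) ?_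
    filter_upwards [hbM] with x hx
    rw [Pi.smul_apply, norm_smul, norm_smul, Real.norm_of_nonneg (Real.sqrt_nonneg _),
      Real.norm_of_nonneg (Real.sqrt_nonneg _)]
    gcongr
  have hconv : ∀ n, eLpNorm (fun x => gradient (χ n) x - G x) 2 volume ≤
      ENNReal.ofReal (Real.sqrt M) * ENNReal.ofReal (1 / (n + 1 : ℝ)) := by
    intro n
    have h1 : eLpNorm (fun x => gradient (χ n) x - G x) 2 volume =
        eLpNorm (fun x => gradient (χ n) x - G x) 2 (volume.restrict (Ωt \ I)) := by
      rw [← eLpNorm_indicator_eq_eLpNorm_restrict hUm]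
      congr 1
      ext1 x
      by_cases hx : x ∈ Ωt \ I
      · rw [Set.indicator_of_mem hx]
      · rw [Set.indicator_of_notMem hx, (hχ n).gradient_eq_zero hx, hG,
          Set.indicator_of_notMem hx, sub_zero]
    rw [h1]
    refine (eLpNorm_le_mul_eLpNorm_of_ae_le_mul (hsq _) 2).trans ?_
    gcongr
    have h2 : eLpNorm (wgt b fun x => gradient (χ n) x - G x) 2 (volume.restrict (Ωt \ I)) =
        ‖wgradLp (Ωt \ I) b (χ n) - k‖ₑ := by
      rw [Lp.enorm_def]
      refine eLpNorm_congr_ae ?_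
      filter_upwards [Lp.coeFn_sub (wgradLp (Ωt \ I) b (χ n)) k,
        coeFn_wgradLp hb (hχ n).isGradTest, hwG] with x h1 h2 h3
      rw [h1, Pi.sub_apply, h2, ← h3, wgt_sub, Pi.sub_apply]
    rw [h2, ← ofReal_norm]
    exact ENNReal.ofReal_le_ofReal (hχk n).le
  have hlim : Tendsto (fun n : ℕ => ENNReal.ofReal (Real.sqrt M) *
      ENNReal.ofReal (1 / (n + 1 : ℝ))) atTop (𝓝 0) := by
    have h1 := ENNReal.tendsto_ofReal (tendsto_one_div_add_atTop_nhds_zero_nat (𝕜 := ℝ))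
    have h2 := ENNReal.Tendsto.const_mul (a := ENNReal.ofReal (Real.sqrt M)) h1
      (Or.inr (by finiteness))
    simpa using h2
  set e : ℕ → ℝ≥0∞ := fun n => ENNReal.ofReal (Real.sqrt M) * ENNReal.ofReal (1 / (n + 1 : ℝ))
    with he
  have heanti : ∀ N n, N ≤ n → e n ≤ e N := by
    intro N n hNn
    simp only [he]
    gcongr
  set P : ℝ≥0∞ := ENNReal.ofReal (2 * Real.pi * (3 * D)) with hP
  have hcau : CauchySeq fun n => (hχ n).1.memLp.toLp (χ n) := by
    rw [EMetric.cauchySeq_iff_le_tendsto_0]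
    refine ⟨fun N => P * (2 * e N), fun n m N hn hm => ?_, ?_⟩
    · rw [Lp.edist_toLp_toLp]
      refine (((hχ n).1.sub (hχ m).1).eLpNorm_le hD hΩD).trans ?_
      rw [(hχ n).1.gradient_sub (hχ m).1, hP.symm]
      beta_reduce
      rw [two_mul (e N)]
      gcongr
      calc _ = eLpNorm ((fun x => gradient (χ n) x - G x) - fun x => gradient (χ m) x - G x) 2
            volume := by congr 1; ext1 x; simp
        _ ≤ _ := eLpNorm_sub_le ((hχ n).1.memLp_gradient.1.sub hGm.1)
            ((hχ m).1.memLp_gradient.1.sub hGm.1) one_le_two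
        _ ≤ e N + e N := add_le_add ((hconv n).trans (heanti N n hn))
            ((hconv m).trans (heanti N m hm))
    · have h1 := ENNReal.Tendsto.const_mul (a := (2 : ℝ≥0∞)) hlim (Or.inr (by finiteness))
      have h2 := ENNReal.Tendsto.const_mul (a := P) h1 (Or.inr (by finiteness))
      simpa using h2
  obtain ⟨Φ, hΦ⟩ := cauchySeq_tendsto_of_complete hcau
  have hΦ' : Tendsto (fun n => eLpNorm (fun x => χ n x - Φ x) 2 volume) atTop (𝓝 0) := by
    rw [Lp.tendsto_Lp_iff_tendsto_eLpNorm'] at hΦ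
    refine hΦ.congr fun n => eLpNorm_congr_ae ?_
    filter_upwards [(hχ n).1.memLp.coeFn_toLp] with x hx
    simp [hx]
  have hG0 : Tendsto (fun n => eLpNorm (fun x => gradient (χ n) x - G x) 2 volume) atTop (𝓝 0) :=
    tendsto_of_tendsto_of_tendsto_of_le_of_le tendsto_const_nhds hlim (fun _ => zero_le) hconv
  have htr : HasIslandTrace Ωt I Φ G 1 := by
    intro ξ hξ
    refine ⟨(Lp.memLp Φ).sub (hξ.1.memLp.const_mul 1),
      hGm.sub (hξ.1.memLp_gradient.const_smul (1 : ℝ)), fun n x => χ n x - ξ x,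
      fun n => (hχ n).isTest_sub hξ, ?_, ?_⟩
    · convert hΦ' using 3 with n
      ext x; ring
    · convert hG0 using 3 with n
      ext1 x
      rw [(hχ n).1.gradient_sub hξ.1]
      module
  refine ⟨Φ, G, ⟨⟨Lp.memLp Φ, hGm, χ, fun n => (hχ n).1, hΦ', hG0⟩, hw, fun η hη => ?_,
    ⟨1, htr⟩⟩, htr⟩
  rw [← hb.inner_toLp_wgradLp hw hη.isGradTest]
  have hkw : hw.toLp _ = k := by
    refine Lp.ext ?_
    exact hw.coeFn_toLp.trans hwG
  rw [hkw]
  exact hk.orth η hη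

/-- The island has positive capacity. -/
lemma norm_pos (h : IsIslandLake Ωt I b) (hk : IsPotential Ωt I b k) : 0 < ‖k‖ := by
  by_contra hk0
  have hk0' : k = 0 := norm_eq_zero.1 (le_antisymm (not_lt.1 hk0) (norm_nonneg k))
  subst hk0'
  have hb := h.isDepth
  obtain ⟨Φ, G, hΦ⟩ := h.exists_isPhiOne
  obtain ⟨χ, hχ⟩ := h.exists_cutoff
  have h10 : IsH10 (Ωt \ I) (fun x => Φ x - χ x) (fun x => G x - gradient χ x) := by
    simpa using hΦ.2 χ hχ
  have hGU : G =ᵐ[volume.restrict (Ωt \ I)] 0 := by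
    filter_upwards [hb.ae_eq_sqrt_smul G, h.wgt_ae_eq hk hΦ,
      Lp.coeFn_zero Plane 2 (volume.restrict (Ωt \ I))] with x h1 h2 h3
    rw [h1, h2, h3]; simp
  have hGC : G =ᵐ[volume.restrict (Ωt \ I)ᶜ] 0 := by
    filter_upwards [h10.gradient_ae_zero hb.isOpen.measurableSet,
      ae_restrict_mem hb.isOpen.measurableSet.compl] with x h1 h2
    simpa [hχ.gradient_eq_zero h2] using h1
  have hG : G =ᵐ[volume] 0 := ae_of_ae_restrict_of_ae_restrict_compl _ hGU hGC
  have hΦ0 := hΦ.1.h10.ae_zero h.isBounded hG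
  -- Zero capacity has made `Φ` and `G` vanish. Around an island point `z` the function `Φ - χ` then
  -- has zero gradient, and circles about `z` meet the island, so the disc Poincaré inequality
  -- forces `Φ - χ = 0` there; but `Φ - χ = -1`.
  obtain ⟨z, hz⟩ := h.island_nontrivial.nonempty
  obtain ⟨ρ, hρ, hIρ⟩ := exists_dist_le_of_nontrivial h.island_nontrivial
  obtain ⟨w, hw, hwz⟩ := hIρ z
  have hχ1 : ∀ᶠ y in 𝓝 z, χ y = 1 := hχ.2.filter_mono (nhds_le_nhdsSet hz)
  obtain ⟨r, hr, hball⟩ := Metric.eventually_nhds_iff_ball.1 hχ1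
  have hgrad : ∀ y ∈ Metric.ball z r, gradient χ y = 0 := by
    intro y hy
    have h1 : ∀ᶠ y' in 𝓝 y, χ y' = 1 := by
      filter_upwards [Metric.isOpen_ball.mem_nhds hy] with y' hy' using hball y' hy'
    rw [EventuallyEq.gradient_eq (f := fun _ => (1 : ℝ)) h1]
    simp
  set R := min r ρ with hR
  have hR0 : 0 < R := lt_min hr hρ
  have h1 := h10.eLpNorm_ball_le (z := z) (R := R) fun s hs hsR => by
    obtain ⟨y, hy, hyI⟩ := exists_mem_sphere_of_isPreconnected
      h.island_simplyConnected.isPathConnected.isConnected.isPreconnected hz hw hs.le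
      ((hsR.le.trans (min_le_right _ _)).trans hwz)
    exact ⟨y, hy, fun hyU => hyU.2 hyI⟩
  have h2 : eLpNorm (fun x => G x - gradient χ x) 2 (volume.restrict (Metric.ball z R)) = 0 := by
    rw [eLpNorm_eq_zero_iff (h10.2.1.restrict _).1 two_ne_zero]
    filter_upwards [ae_restrict_of_ae hG, ae_restrict_mem Metric.isOpen_ball.measurableSet]
      with x hx hxR
    simp [hx, hgrad x (Metric.ball_subset_ball (min_le_left _ _) hxR)]
  rw [h2, mul_zero, nonpos_iff_eq_zero, eLpNorm_eq_zero_iff (h10.1.restrict _).1 two_ne_zero] at h1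
  have h3 : ∀ᵐ x ∂(volume.restrict (Metric.ball z R)), False := by
    filter_upwards [h1, ae_restrict_of_ae hΦ0, ae_restrict_mem Metric.isOpen_ball.measurableSet]
      with x hx hx0 hxR
    simp [hx0, hball x (Metric.ball_subset_ball (min_le_left _ _) hxR)] at hx
  rw [Filter.eventually_false_iff_eq_bot, ae_eq_bot, Measure.restrict_eq_zero] at h3
  exact (Metric.measure_ball_pos volume z hR0).ne' h3

lemma existsUniqueAE_isPhiOne (h : IsIslandLake Ωt I b) : ExistsUniqueAE (IsPhiOne Ωt I b) := by
  refine ⟨h.exists_isPhiOne, fun Φ G Φ' G' hΦ hΦ' => ?_⟩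
  have htr := hΦ.2.sub hΦ'.2
  rw [sub_self] at htr
  obtain ⟨h1, h2⟩ := h.ae_eq_zero_of_trace_zero (hΦ.1.sub h.isDepth hΦ'.1) htr
  constructor
  · filter_upwards [h1] with x hx using sub_eq_zero.1 hx
  · filter_upwards [h2] with x hx using sub_eq_zero.1 hx

/-- By uniqueness `ψ¹` is `c φ¹`, where `c` is its island value; its circulation is `-c‖k‖²`, which
determines `c`. -/
lemma isPsiOne_ae_eq (h : IsIslandLake Ωt I b) (hk : IsPotential Ωt I b k)
    (hΦ : IsPhiOne Ωt I b Φ G) (hΨ : IsPsiOne Ωt I b Φ' G') :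
    (Φ' =ᵐ[volume] fun x => -(‖k‖ ^ 2)⁻¹ * Φ x) ∧
      G' =ᵐ[volume] fun x => (-(‖k‖ ^ 2)⁻¹) • G x := by
  obtain ⟨c, hc⟩ := hΨ.1.trace
  have htr := hc.sub (hΦ.2.const_mul c)
  rw [mul_one, sub_self] at htr
  obtain ⟨h1, h2⟩ := h.ae_eq_zero_of_trace_zero (hΨ.1.sub h.isDepth (hΦ.1.const_mul c)) htr
  have hG' : G' =ᵐ[volume] fun x => c • G x := by
    filter_upwards [h2] with x hx using sub_eq_zero.1 hx
  have h3 := (h.hasCirculation_iff hk hΦ hG').1 hΨ.2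
  have hk0 := h.norm_pos hk
  have h4 : c = -(‖k‖ ^ 2)⁻¹ := by
    field_simp
    linarith
  subst h4
  refine ⟨?_, hG'⟩
  filter_upwards [h1] with x hx using sub_eq_zero.1 hx

lemma existsUniqueAE_isPsiOne (h : IsIslandLake Ωt I b) : ExistsUniqueAE (IsPsiOne Ωt I b) := by
  obtain ⟨k, hk⟩ := exists_isPotential h.isOpen h.island_compact h.island_subset h.isDepth
  obtain ⟨Φ, G, hΦ⟩ := h.exists_isPhiOne
  refine ⟨⟨_, _, hΦ.1.const_mul (-(‖k‖ ^ 2)⁻¹), ?_⟩, fun Φ₁ G₁ Φ₂ G₂ h₁ h₂ => ?_⟩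
  · rw [h.hasCirculation_iff hk hΦ (G' := fun x => (-(‖k‖ ^ 2)⁻¹) • G x) EventuallyEq.rfl]
    have := h.norm_pos hk
    field_simp
  · obtain ⟨ha, hb⟩ := h.isPsiOne_ae_eq hk hΦ h₁
    obtain ⟨hc, hd⟩ := h.isPsiOne_ae_eq hk hΦ h₂
    exact ⟨ha.trans hc.symm, hb.trans hd.symm⟩

lemma weightedNorm_isPhiOne (h : IsIslandLake Ωt I b) (hk : IsPotential Ωt I b k)
    (hΦ : IsPhiOne Ωt I b Φ G) : weightedNorm (Ωt \ I) b G = ENNReal.ofReal ‖k‖ := by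
  rw [weightedNorm_eq, eLpNorm_congr_ae (h.wgt_ae_eq hk hΦ), ← Lp.enorm_def, ofReal_norm]

lemma enorm_neg_inv_sq (h : IsIslandLake Ωt I b) (hk : IsPotential Ωt I b k) :
    ‖-(‖k‖ ^ 2)⁻¹‖ₑ = ENNReal.ofReal ((‖k‖ ^ 2)⁻¹) := by
  have := h.norm_pos hk
  rw [enorm_neg, Real.enorm_eq_ofReal (by positivity)]

/-- The factor `‖k‖⁻²` meets the norm `‖k‖` of `φ¹`: bounding `ψ¹` amounts to bounding the capacity
from below. -/
lemma weightedNorm_isPsiOne (h : IsIslandLake Ωt I b) (hk : IsPotential Ωt I b k)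
    (hΨ : IsPsiOne Ωt I b Φ' G') : weightedNorm (Ωt \ I) b G' = ENNReal.ofReal (‖k‖⁻¹) := by
  obtain ⟨Φ, G, hΦ⟩ := h.exists_isPhiOne
  have hk0 := h.norm_pos hk
  have h1 : wgt b G' =ᵐ[volume.restrict (Ωt \ I)] (-(‖k‖ ^ 2)⁻¹) • wgt b G := by
    filter_upwards [ae_restrict_of_ae (h.isPsiOne_ae_eq hk hΦ hΨ).2] with x hx
    rw [← wgt_const_smul, wgt, hx, wgt]
  rw [weightedNorm_eq, eLpNorm_congr_ae h1, eLpNorm_const_smul, ← weightedNorm_eq,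
    h.weightedNorm_isPhiOne hk hΦ, h.enorm_neg_inv_sq hk, ← ENNReal.ofReal_mul (by positivity)]
  congr 1
  field_simp

end IsIslandLake

/-! ### Evanescent islands: geometry -/

section geometry

variable {Ω : Set Plane} {b : Plane → ℝ} {Ωt I : ℝ → Set Plane} {bε : ℝ → Plane → ℝ}

/-- A compact set keeps a positive distance from the complement of `Ω \ {0}`, so complements close
to it in Hausdorff distance cannot reach `K`. -/
lemma IsEvanescent.eventually_subset (h : IsEvanescent Ω b Ωt I bε) (hΩ : IsOpen Ω)
    {K : Set Plane} (hK : IsCompact K) (hKΩ : K ⊆ Ω \ {0}) :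
    ∀ᶠ ε in 𝓝[>] (0 : ℝ), K ⊆ Ωt ε \ I ε := by
  obtain ⟨δ, hδ, hδK⟩ := hK.exists_thickening_subset_open (hΩ.sdiff isClosed_singleton) hKΩ
  filter_upwards [h.hausdorff.eventually (gt_mem_nhds (ENNReal.ofReal_pos.2 hδ))] with ε hε x hx
  by_contra hxU
  obtain ⟨y, hy, hxy⟩ := Metric.exists_edist_lt_of_hausdorffEDist_lt
    (show x ∈ (Ωt ε \ I ε)ᶜ from hxU) hε
  refine hy (hδK (Metric.mem_thickening_iff.2 ⟨x, hx, ?_⟩))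
  rw [edist_lt_ofReal] at hxy
  rwa [dist_comm]

lemma infDist_union_zero_le (S : Set Plane) (x : Plane) : Metric.infDist x (S ∪ {0}) ≤ ‖x‖ :=
  (Metric.infDist_le_dist_of_mem (Set.mem_union_right _ (Set.mem_singleton 0))).trans_eq
    (dist_zero_right x)

/-- At an interior point of a lake the depth is locally bounded below, whereas `b' ≤ C b ≤ C |M|
‖x‖^a` tends to zero at the origin because `a > 0`. -/
lemma IsPuncturedLake.zero_notMem (hΩ : IsPuncturedLake Ω b) {U : Set Plane} {b' : Plane → ℝ}
    (hU : IsDepth U b') (hUΩ : U ⊆ Ω) {C : ℝ} (hC : 0 < C)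
    (hle : ∀ᵐ x ∂(volume.restrict Ω), U.indicator b' x ≤ C * b x) : (0 : Plane) ∉ U := by
  intro h0
  obtain ⟨a, ha, -, O, hO, h0O, c, θ, M, hθ, hc⟩ := hΩ.origin_shore
  have h0O' : (0 : Plane) ∈ O := h0O rfl
  obtain ⟨s, hs, hsU⟩ := Metric.isOpen_iff.1 (hO.inter hU.isOpen) 0 ⟨h0O', h0⟩
  have hsub : Metric.closedBall (0 : Plane) (s / 2) ⊆ O ∩ U :=
    (Metric.closedBall_subset_ball (by linarith)).trans hsU
  obtain ⟨θ', hθ', hlow⟩ := hU.lower _ (isCompact_closedBall 0 (s / 2))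
    (hsub.trans Set.inter_subset_right)
  have hlim : Tendsto (fun t : ℝ => C * (|M| * t ^ a)) (𝓝 0) (𝓝 0) := by
    have h1 : Tendsto (fun t : ℝ => t ^ a) (𝓝 0) (𝓝 (0 ^ a)) :=
      (Real.continuousAt_rpow_const 0 a (Or.inr ha.le)).tendsto
    rw [Real.zero_rpow ha.ne'] at h1
    simpa using (h1.const_mul |M|).const_mul C
  obtain ⟨r, hr, hball⟩ := Metric.eventually_nhds_iff_ball.1 (hlim.eventually (gt_mem_nhds hθ'))
  set R := min r (s / 2) with hR
  have hR0 : 0 < R := by positivity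
  have hRs : Metric.ball (0 : Plane) R ⊆ Metric.closedBall 0 (s / 2) :=
    (Metric.ball_subset_ball (min_le_right _ _)).trans Metric.ball_subset_closedBall
  have h3 : ∀ᵐ x ∂(volume.restrict (Metric.ball (0 : Plane) R)), False := by
    rw [ae_restrict_iff' (hO.inter hΩ.isOpen).measurableSet] at hc
    rw [ae_restrict_iff' hΩ.isOpen.measurableSet] at hle
    filter_upwards [ae_restrict_of_ae hc, ae_restrict_of_ae hle,
      ae_restrict_of_ae ((ae_restrict_iff' measurableSet_closedBall).1 hlow),
      ae_restrict_mem Metric.isOpen_ball.measurableSet] with x h1 h2 h3 hx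
    have hxU := hsub (hRs hx)
    obtain ⟨-, hcM, hbx⟩ := h1 ⟨hxU.1, hUΩ hxU.2⟩
    have h4 := h2 (hUΩ hxU.2)
    rw [Set.indicator_of_mem hxU.2, hbx] at h4
    have h5 : Metric.infDist x (frontier Ω ∪ {0}) ≤ ‖x‖ :=
      infDist_union_zero_le _ x
    have h6 : C * (|M| * ‖x‖ ^ a) < θ' := by
      refine hball ‖x‖ ?_
      rw [mem_ball_zero_iff] at hx ⊢
      rw [norm_norm]
      exact hx.trans_le (min_le_left _ _)
    have h7 : c x * Metric.infDist x (frontier Ω ∪ {0}) ^ a ≤ |M| * ‖x‖ ^ a := by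
      have := Metric.infDist_nonneg (x := x) (s := frontier Ω ∪ {0})
      have := hcM.trans (le_abs_self M)
      gcongr
    have h8 := h3 (hRs hx)
    have h9 := mul_le_mul_of_nonneg_left h7 hC.le
    linarith
  rw [Filter.eventually_false_iff_eq_bot, ae_eq_bot, Measure.restrict_eq_zero] at h3
  exact (Metric.measure_ball_pos volume (0 : Plane) hR0).ne' h3

lemma isCompact_annulus (r R : ℝ) : IsCompact {x : Plane | r ≤ ‖x‖ ∧ ‖x‖ ≤ R} := by
  refine (isCompact_closedBall (0 : Plane) R).of_isClosed_subset ?_ fun x hx => by simpa using hx.2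
  exact (isClosed_le continuous_const continuous_norm).inter
    (isClosed_le continuous_norm continuous_const)

/-- The island contains the origin, is small, and small discs around it lie in the outer domain. -/
lemma IsEvanescent.eventually_island (hΩ : IsPuncturedLake Ω b) (h : IsEvanescent Ω b Ωt I bε)
    {ρ : ℝ} (hρ : 0 < ρ) : ∃ r, 0 < r ∧ r ≤ ρ ∧ ∀ᶠ ε in 𝓝[>] (0 : ℝ), (0 : Plane) ∈ I ε ∧
      I ε ⊆ Metric.ball 0 r ∧ Metric.ball 0 r ⊆ Ωt ε ∧ Ωt ε ⊆ Ω := by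
  obtain ⟨R, hR, hRΩ⟩ := Metric.isOpen_iff.1 hΩ.isOpen 0 hΩ.zero_mem
  -- This leaves room in `Ω` for the closed annulus between radii `r` and `4r`, which eventually
  -- lies in the lakes.
  set r := min ρ (R / 5) with hr
  have hr0 : 0 < r := by positivity
  have hrR : 5 * r ≤ R := by linarith [min_le_right ρ (R / 5)]
  have hKΩ : {x : Plane | r ≤ ‖x‖ ∧ ‖x‖ ≤ 4 * r} ⊆ Ω \ {0} := by
    rintro x ⟨h1, h2⟩
    refine ⟨hRΩ ?_, fun h3 => ?_⟩
    · rw [mem_ball_zero_iff]; linarith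
    · rw [Set.mem_singleton_iff] at h3
      rw [h3, norm_zero] at h1
      linarith
  obtain ⟨C, hC, hle⟩ := h.depth_le
  refine ⟨r, hr0, min_le_left _ _, ?_⟩
  filter_upwards [h.lake, h.subset, hle, h.eventually_subset hΩ.isOpen (isCompact_annulus r (4 * r))
    hKΩ] with ε hl hsub hle hK
  -- If `p` were missing, the circle of radius `3r` about it would meet the complement of the outer
  -- domain; but `‖p‖ < r` places that circle inside the annulus.
  have hin : ∀ p ∈ Metric.ball (0 : Plane) r, p ∈ Ωt ε := by
    intro p hp
    by_contra hpΩ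
    obtain ⟨y, hy, hyΩ⟩ := exists_mem_sphere_notMem hl.simplyConnected hl.isOpen hpΩ
      (show 0 < 3 * r by positivity)
    refine hyΩ (hK ?_).1
    rw [mem_ball_zero_iff] at hp
    rw [mem_sphere_iff_norm] at hy
    have h1 := norm_sub_norm_le y p
    have h2 := norm_le_norm_sub_add y p
    have h3 := norm_sub_norm_le p (p - y)
    rw [sub_sub_cancel, norm_sub_rev p y] at h3
    have h4 := norm_sub_norm_le (y - p) (-p)
    rw [norm_neg, sub_neg_eq_add, sub_add_cancel] at h4
    constructor <;> linarith
  have h0 : (0 : Plane) ∈ I ε := by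
    by_contra h0I
    exact hΩ.zero_notMem hl.isDepth hsub hC hle ⟨hin 0 (by simpa using hr0), h0I⟩
  have hI : I ε ⊆ Metric.ball 0 r := by
    intro w hw
    by_contra hwr
    rw [Metric.mem_ball, not_lt] at hwr
    obtain ⟨y, hy, hyI⟩ := exists_mem_sphere_of_isPreconnected
      hl.island_simplyConnected.isPathConnected.isConnected.isPreconnected h0 hw hr0.le hwr
    rw [mem_sphere_zero_iff_norm] at hy
    exact (hK (show r ≤ ‖y‖ ∧ ‖y‖ ≤ 4 * r by constructor <;> linarith)).2 hyI
  refine ⟨h0, hI, hin, fun x hx => ?_⟩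
  by_cases hxI : x ∈ I ε
  · exact hRΩ (Metric.ball_subset_ball (by linarith) (hI hxI))
  · exact hsub ⟨hx, hxI⟩

/-- Near the origin `f = 1` on a disc containing the island; the rest of the support is a compact
subset of `Ω \ {0}`. Thus one fixed function serves as cut-off for all late lakes. -/
lemma IsEvanescent.eventually_isCutoff (hΩ : IsPuncturedLake Ω b) (h : IsEvanescent Ω b Ωt I bε)
    {f : Plane → ℝ} (hf : IsCutoff Ω {0} f) :
    ∀ᶠ ε in 𝓝[>] (0 : ℝ), IsCutoff (Ωt ε) (I ε) f := by
  have h1 : ∀ᶠ x in 𝓝 (0 : Plane), f x = 1 := hf.2.filter_mono (nhds_le_nhdsSet (Set.mem_singleton (0 : Plane)))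
  obtain ⟨ρ, hρ, hball⟩ := Metric.eventually_nhds_iff_ball.1 h1
  obtain ⟨r, hr, hrρ, hev⟩ := h.eventually_island hΩ hρ
  have hK : IsCompact (tsupport f \ Metric.ball 0 r) :=
    hf.1.compactSupp.isCompact.diff Metric.isOpen_ball
  have hKΩ : tsupport f \ Metric.ball 0 r ⊆ Ω \ {0} := by
    rintro x ⟨hx1, hx2⟩
    refine ⟨hf.1.supp_subset hx1, fun hx0 => hx2 ?_⟩
    rw [Set.mem_singleton_iff] at hx0
    simpa [hx0] using hr
  filter_upwards [hev, h.eventually_subset hΩ.isOpen hK hKΩ] with ε ⟨h0, hI, hin, hout⟩ hKε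
  refine ⟨⟨hf.1.smooth, hf.1.compactSupp, fun x hx => ?_⟩, ?_⟩
  · by_cases hxr : x ∈ Metric.ball (0 : Plane) r
    · exact hin hxr
    · exact (hKε ⟨hx, hxr⟩).1
  · filter_upwards [(Metric.isOpen_ball.mem_nhdsSet.2 hI)] with x hx
    exact hball x (Metric.ball_subset_ball hrρ hx)

lemma IsCutoff.of_lake {Ω Ωt I : Set Plane} {χ : Plane → ℝ} (hχ : IsCutoff Ωt I χ)
    (hΩ : Ωt ⊆ Ω) (h0 : (0 : Plane) ∈ I) : IsCutoff Ω {0} χ :=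
  ⟨hχ.1.mono hΩ, hχ.2.filter_mono (nhdsSet_mono (by simpa using h0))⟩

end geometry

/-! ### Positivity of the capacity of the puncture -/

/-- In polar coordinates the integral is `2π ∫ r^(a-1) dr`. Its convergence for `a > 0` is what
separates part (i) from the flat case. -/
lemma lintegral_ball_norm_rpow_lt_top {a : ℝ} (ha : 0 < a) (ρ : ℝ) :
    ∫⁻ x in Metric.ball (0 : Plane) ρ, ENNReal.ofReal (‖x‖ ^ a) * (‖x‖ₑ⁻¹) ^ 2 < ⊤ := by
  rw [lintegral_ball_eq_polar (by fun_prop)]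
  have h1 : ∀ r ∈ Set.Ioo 0 ρ, ∫⁻ θ in Set.Ioo (-Real.pi) Real.pi, ENNReal.ofReal r *
      (ENNReal.ofReal (‖(0 : Plane) + r • dir θ‖ ^ a) * (‖(0 : Plane) + r • dir θ‖ₑ⁻¹) ^ 2) =
      ENNReal.ofReal (r ^ (a - 1)) * ENNReal.ofReal (2 * Real.pi) := by
    intro r hr
    have h2 : ∀ θ, ‖(0 : Plane) + r • dir θ‖ = r := fun θ => by
      rw [zero_add, norm_smul, norm_dir, mul_one, Real.norm_of_nonneg hr.1.le]
    have h3 : ∀ θ, ‖(0 : Plane) + r • dir θ‖ₑ = ENNReal.ofReal r := fun θ => by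
      rw [← ofReal_norm, h2]
    simp_rw [h2, h3]
    rw [lintegral_const, Measure.restrict_apply_univ, Real.volume_Ioo, sub_neg_eq_add, ← two_mul]
    congr 1
    rw [← ENNReal.ofReal_inv_of_pos hr.1, ← ENNReal.ofReal_pow (by have := hr.1; positivity),
      ← ENNReal.ofReal_mul (by have := hr.1; positivity), ← ENNReal.ofReal_mul hr.1.le,
      Real.rpow_sub_one hr.1.ne']
    congr 1
    have := hr.1.ne'
    field_simp
  rw [setLIntegral_congr_fun measurableSet_Ioo h1, lintegral_mul_const _ (by fun_prop)]
  refine ENNReal.mul_lt_top ?_ (by finiteness)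
  by_cases hρ : 0 < ρ
  · have h2 : IntegrableOn (fun r : ℝ => r ^ (a - 1)) (Set.Ioo 0 ρ) :=
      (intervalIntegral.integrableOn_Ioo_rpow_iff hρ).2 (by linarith)
    exact h2.lintegral_lt_top
  · simp [Set.Ioo_eq_empty hρ]

lemma IsPuncturedLake.lintegral_lt_top {Ω : Set Plane} {b : Plane → ℝ}
    (hΩ : IsPuncturedLake Ω b) :
    ∫⁻ x in Ω \ {0}, ENNReal.ofReal (b x) * (‖x‖ₑ⁻¹) ^ 2 < ⊤ := by
  obtain ⟨a, ha, -, O, hO, h0O, c, θ, M, hθ, hc⟩ := hΩ.origin_shore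
  obtain ⟨ρ, hρ, hρO⟩ := Metric.isOpen_iff.1 hO 0 (h0O rfl)
  obtain ⟨N, hN, hbN⟩ := hΩ.isDepth.bound
  have hUm := hΩ.isDepth.isOpen.measurableSet
  have hB : MeasurableSet (Metric.ball (0 : Plane) ρ) := Metric.isOpen_ball.measurableSet
  rw [← lintegral_inter_add_sdiff _ _ hB, ENNReal.add_lt_top]
  constructor
  · have h1 : ∫⁻ x in (Ω \ {0}) ∩ Metric.ball 0 ρ, ENNReal.ofReal (b x) * (‖x‖ₑ⁻¹) ^ 2 ≤
        ∫⁻ x in (Ω \ {0}) ∩ Metric.ball 0 ρ, ENNReal.ofReal |M| *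
          (ENNReal.ofReal (‖x‖ ^ a) * (‖x‖ₑ⁻¹) ^ 2) := by
      refine setLIntegral_mono_ae' (hUm.inter hB) ?_
      filter_upwards [(ae_restrict_iff' (hO.inter hΩ.isOpen).measurableSet).1 hc] with x hx hxU
      obtain ⟨-, hcM, hbx⟩ := hx ⟨hρO hxU.2, hxU.1.1⟩
      rw [← mul_assoc, ← ENNReal.ofReal_mul (abs_nonneg M), hbx]
      have h5 : Metric.infDist x (frontier Ω ∪ {0}) ≤ ‖x‖ :=
        infDist_union_zero_le _ x
      have := Metric.infDist_nonneg (x := x) (s := frontier Ω ∪ {0})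
      have := hcM.trans (le_abs_self M)
      gcongr
    refine h1.trans_lt ?_
    rw [lintegral_const_mul' _ _ (by finiteness)]
    exact ENNReal.mul_lt_top (by finiteness) ((lintegral_mono_set Set.inter_subset_right).trans_lt
      (lintegral_ball_norm_rpow_lt_top ha ρ))
  · have h1 : ∫⁻ x in (Ω \ {0}) \ Metric.ball 0 ρ, ENNReal.ofReal (b x) * (‖x‖ₑ⁻¹) ^ 2 ≤
        ∫⁻ x in (Ω \ {0}) \ Metric.ball 0 ρ, ENNReal.ofReal N * ((ENNReal.ofReal ρ)⁻¹) ^ 2 := by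
      refine setLIntegral_mono_ae' (hUm.diff hB) ?_
      filter_upwards [(ae_restrict_iff' hUm).1 hbN] with x hx hxU
      have h2 := hx hxU.1
      have h3 : ENNReal.ofReal ρ ≤ ‖x‖ₑ := by
        rw [← ofReal_norm]
        refine ENNReal.ofReal_le_ofReal ?_
        simpa using hxU.2
      gcongr
    refine h1.trans_lt ?_
    rw [setLIntegral_const]
    refine ENNReal.mul_lt_top ?_ ?_
    · refine ENNReal.mul_lt_top (by finiteness) (ENNReal.pow_lt_top ?_)
      simpa using hρ
    · exact (hΩ.isBounded.subset (Set.sdiff_subset.trans Set.sdiff_subset)).measure_lt_top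

/-- For every cut-off, `2π = 2π χ(0)` is bounded by `∫ |∇χ|/|x|`, and Cauchy–Schwarz with the weight
`b` bounds this by the energy norm times `J^{1/2}`. The energies of cut-offs therefore stay away
from zero. -/
lemma IsPuncturedLake.norm_pos {Ω : Set Plane} {b : Plane → ℝ} (hΩ : IsPuncturedLake Ω b)
    {k : Lp Plane 2 (volume.restrict (Ω \ {0}))} (hk : IsPotential Ω {0} b k) : 0 < ‖k‖ := by
  by_contra hk0
  have hk0' : k = 0 := norm_eq_zero.1 (le_antisymm (not_lt.1 hk0) (norm_nonneg k))
  subst hk0'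
  have hb := hΩ.isDepth
  have hUm := hb.isOpen.measurableSet
  set J := ∫⁻ x in Ω \ {0}, ENNReal.ofReal (b x) * (‖x‖ₑ⁻¹) ^ 2 with hJ
  have hJt : J < ⊤ := hΩ.lintegral_lt_top
  have key : ∀ χ, IsCutoff Ω {0} χ →
      ENNReal.ofReal (2 * Real.pi) ^ 2 ≤ ‖wgradLp (Ω \ {0}) b χ‖ₑ ^ 2 * J := by
    intro χ hχ
    have h1 := enorm_zero_le_lintegral hχ.1.contDiff_one hχ.1.compactSupp
    have h2 : χ 0 = 1 := hχ.2.self_of_nhdsSet 0 rfl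
    rw [h2, enorm_one, mul_one] at h1
    have h3 : ∫⁻ x, ‖gradient χ x‖ₑ * ‖x‖ₑ⁻¹ = ∫⁻ x in Ω \ {0}, ‖wgt b (gradient χ) x‖ₑ *
        (ENNReal.ofReal (Real.sqrt (b x)) * ‖x‖ₑ⁻¹) := by
      rw [← setLIntegral_eq_of_support_subset (s := Ω \ {0})]
      · refine lintegral_congr_ae ?_
        filter_upwards [hb.ae_pos] with x hx
        have hx' := Real.sqrt_pos.2 hx
        have h4 : ENNReal.ofReal (Real.sqrt (b x))⁻¹ * ENNReal.ofReal (Real.sqrt (b x)) = 1 := by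
          rw [← ENNReal.ofReal_mul (by positivity), inv_mul_cancel₀ hx'.ne', ENNReal.ofReal_one]
        rw [wgt, enorm_smul, Real.enorm_eq_ofReal (by positivity), mul_mul_mul_comm, h4, one_mul]
      · intro x hx
        by_contra hxU
        exact hx (by simp [hχ.gradient_eq_zero hxU])
    have h4 := lintegral_mul_sq_le (volume.restrict (Ω \ {0}))
      (f := fun x => ‖wgt b (gradient χ) x‖ₑ)
      (g := fun x => ENNReal.ofReal (Real.sqrt (b x)) * ‖x‖ₑ⁻¹)
      (hχ.isGradTest.memLp hb).1.enorm
      ((hb.meas.aemeasurable.sqrt.ennreal_ofReal).mul (by fun_prop))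
    rw [← h3, ← eLpNorm_two_sq, ← enorm_wgradLp hb hχ.isGradTest] at h4
    refine (pow_le_pow_left₀ zero_le h1 2).trans (h4.trans (le_of_eq ?_))
    congr 1
    refine lintegral_congr_ae ?_
    filter_upwards [hb.ae_pos] with x hx
    rw [mul_pow, ← ENNReal.ofReal_pow (Real.sqrt_nonneg _), Real.sq_sqrt hx.le]
  set j := J.toReal with hj
  have hJj : J = ENNReal.ofReal j := (ENNReal.ofReal_toReal hJt.ne).symm
  have hj0 : 0 ≤ j := ENNReal.toReal_nonneg
  -- A cut-off of norm below `1/(j + 1)` would make energy times `j` at most 1, less than `4π²`.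
  obtain ⟨χ, hχ, hlt⟩ := hk.exists_cutoff (τ := 1 / (j + 1)) (by positivity)
  rw [sub_zero] at hlt
  have h1 := key χ hχ
  rw [hJj, ← ofReal_norm, ← ENNReal.ofReal_pow (by positivity), ← ENNReal.ofReal_pow (by positivity),
    ← ENNReal.ofReal_mul (by positivity), ENNReal.ofReal_le_ofReal_iff (by positivity)] at h1
  have h2 : ‖wgradLp (Ω \ {0}) b χ‖ ^ 2 * j ≤ (1 / (j + 1)) ^ 2 * j := by gcongr
  have h3 : (1 / (j + 1)) ^ 2 * j ≤ 1 := by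
    rw [div_pow, one_pow, one_div_mul_eq_div, div_le_one (by positivity)]
    nlinarith
  nlinarith [Real.pi_gt_three]

/-! ### Comparison of potentials for different depths -/

/-- The rescaled field `(b' / b)^{1/2} F`. -/
def reweight (b b' : Plane → ℝ) (F : Plane → Plane) : Plane → Plane :=
  fun x => (Real.sqrt (b' x) * (Real.sqrt (b x))⁻¹) • F x

section comparison

variable {U U' : Set Plane} {b b' : Plane → ℝ}

lemma IsDepth.aestronglyMeasurable_reweight (hb : IsDepth U b) (hb' : IsDepth U' b')
    (hU : U' ⊆ U) {F : Plane → Plane} (hF : AEStronglyMeasurable F (volume.restrict U')) :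
    AEStronglyMeasurable (reweight b b' F) (volume.restrict U') :=
  ((hb'.meas.aemeasurable.sqrt.mul
    (hb.meas.mono_measure (Measure.restrict_mono hU le_rfl)).aemeasurable.sqrt.inv)
    |>.aestronglyMeasurable).smul hF

/-- Write `b^{-1/2}∇χ = (b'/b)^{1/2} b'^{-1/2}∇χ`, move the ratio onto `k`, and apply Cauchy–Schwarz
on the smaller set, where `∇χ` is supported. -/
lemma enorm_inner_wgradLp_le (hb : IsDepth U b) (hb' : IsDepth U' b') (hU : U' ⊆ U)
    (k : Lp Plane 2 (volume.restrict U)) {χ : Plane → ℝ} (hχ : IsGradTest U' χ) :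
    ‖inner ℝ k (wgradLp U b χ)‖ₑ ≤
      eLpNorm (reweight b b' k) 2 (volume.restrict U') * ‖wgradLp U' b' χ‖ₑ := by
  have hχU : IsGradTest U χ := ⟨hχ.isTest, hχ.supp.trans hU⟩
  have hm : Measure.restrict volume U' ≤ volume.restrict U := Measure.restrict_mono hU le_rfl
  have h1 : ‖inner ℝ k (wgradLp U b χ)‖ₑ ≤ ∫⁻ x in U', ‖k x‖ₑ * ‖wgt b (gradient χ) x‖ₑ := by
    rw [inner_wgradLp hb hχU]
    refine (enorm_integral_le_lintegral_enorm _).trans ?_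
    have h2 : ∫⁻ x in U', ‖k x‖ₑ * ‖wgt b (gradient χ) x‖ₑ =
        ∫⁻ x in U, ‖k x‖ₑ * ‖wgt b (gradient χ) x‖ₑ := by
      rw [← lintegral_indicator hb'.isOpen.measurableSet,
        ← lintegral_indicator hb.isOpen.measurableSet]
      congr 1 with x
      by_cases hx : x ∈ U'
      · rw [Set.indicator_of_mem hx, Set.indicator_of_mem (hU hx)]
      · rw [Set.indicator_of_notMem hx]
        by_cases hxU : x ∈ U
        · simp [Set.indicator_of_mem hxU, wgt, hχ.gradient_eq_zero hx]
        · rw [Set.indicator_of_notMem hxU]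
    rw [h2]
    exact lintegral_mono fun x => by
      simpa [enorm_eq_nnnorm, ← ENNReal.coe_mul] using nnnorm_inner_le_nnnorm (𝕜 := ℝ) (k x) (wgt b (gradient χ) x)
  have h3 : ∫⁻ x in U', ‖k x‖ₑ * ‖wgt b (gradient χ) x‖ₑ =
      ∫⁻ x in U', ‖reweight b b' k x‖ₑ * ‖wgt b' (gradient χ) x‖ₑ := by
    refine lintegral_congr_ae ?_
    filter_upwards [hb'.ae_pos] with x hx
    have hx' := (Real.sqrt_pos.2 hx).ne'
    have h4 : ‖Real.sqrt (b' x)‖ₑ * ‖(Real.sqrt (b' x))⁻¹‖ₑ = 1 := by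
      rw [← enorm_mul, mul_inv_cancel₀ hx', enorm_one]
    rw [reweight, wgt, wgt, enorm_smul, enorm_smul, enorm_smul, enorm_mul]
    calc _ = (‖Real.sqrt (b' x)‖ₑ * ‖(Real.sqrt (b' x))⁻¹‖ₑ) *
          (‖k x‖ₑ * (‖(Real.sqrt (b x))⁻¹‖ₑ * ‖gradient χ x‖ₑ)) := by rw [h4, one_mul]
      _ = _ := by ring
  have h4 := lintegral_mul_sq_le (volume.restrict U') (f := fun x => ‖reweight b b' k x‖ₑ)
    (g := fun x => ‖wgt b' (gradient χ) x‖ₑ)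
    (hb.aestronglyMeasurable_reweight hb' hU ((Lp.memLp k).1.mono_measure hm)).enorm
    (hχ.memLp hb').1.enorm
  rw [← eLpNorm_two_sq, ← eLpNorm_two_sq, ← mul_pow, ENNReal.pow_le_pow_left_iff two_ne_zero,
    ← enorm_wgradLp hb' hχ] at h4
  exact (h1.trans_eq h3).trans h4

/-- Enlarging the lake by filling the island decreases the capacity, up to the change of depth. -/
lemma IsPotential.norm_sq_le {Ω Ωt I : Set Plane}
    {k : Lp Plane 2 (volume.restrict (Ω \ {0}))} {k' : Lp Plane 2 (volume.restrict (Ωt \ I))}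
    (hk : IsPotential Ω {0} b k) (hk' : IsPotential Ωt I b' k') (hb : IsDepth (Ω \ {0}) b)
    (hb' : IsDepth (Ωt \ I) b') (hΩ : Ωt ⊆ Ω) (h0 : (0 : Plane) ∈ I) {η : ℝ} (hη : 0 ≤ η)
    (h : eLpNorm (reweight b b' k) 2 (volume.restrict (Ωt \ I)) ≤ ENNReal.ofReal η) :
    ‖k‖ ^ 2 ≤ η * ‖k'‖ := by
  have hU : Ωt \ I ⊆ Ω \ {0} :=
    Set.sdiff_subset_sdiff hΩ (Set.singleton_subset_iff.2 h0)
  have hcl : IsClosed {g : Lp Plane 2 (volume.restrict (Ωt \ I)) | ‖k‖ ^ 2 ≤ η * ‖g‖} :=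
    isClosed_le continuous_const (by fun_prop)
  refine closure_minimal ?_ hcl hk'.mem_closure
  rintro _ ⟨χ, hχ, rfl⟩
  -- A cut-off of the lake is also one of the puncture, so its inner product with `k` is `‖k‖²`.
  have h1 := (enorm_inner_wgradLp_le hb hb' hU k hχ.isGradTest).trans (mul_le_mul_left h _)
  rwa [hk.inner_cutoff hb (hχ.of_lake hΩ h0), Real.enorm_eq_ofReal (by positivity), ← ofReal_norm,
    ← ENNReal.ofReal_mul hη, ENNReal.ofReal_le_ofReal_iff (by positivity)] at h1

/-- The ratio bound `C` multiplies only the small remainder of `k` after subtracting a fixed smooth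
field. The reweighted energy of that field is treated separately, by convergence of the depths. -/
lemma eLpNorm_reweight_le (hb : IsDepth U b) (hb' : IsDepth U' b') (hU : U' ⊆ U) {C : ℝ}
    (hC : 0 < C) (hle : ∀ᵐ x ∂(volume.restrict U'), b' x ≤ C * b x)
    (k : Lp Plane 2 (volume.restrict U)) {f : Plane → ℝ} (hf : IsGradTest U f) :
    eLpNorm (reweight b b' k) 2 (volume.restrict U') ≤
      ENNReal.ofReal (Real.sqrt C) * ‖wgradLp U b f - k‖ₑ +
        eLpNorm (reweight b b' (wgt b (gradient f))) 2 (volume.restrict U') := by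
  have hm : Measure.restrict volume U' ≤ volume.restrict U := Measure.restrict_mono hU le_rfl
  have hkm := (Lp.memLp k).1.mono_measure hm
  have hfm := (hf.memLp hb).1.mono_measure hm
  have h1 : reweight b b' k = reweight b b' (fun x => k x - wgt b (gradient f) x) +
      reweight b b' (wgt b (gradient f)) := by
    ext1 x
    simp only [reweight, Pi.add_apply]
    module
  rw [h1]
  refine (eLpNorm_add_le (hb.aestronglyMeasurable_reweight hb' hU (hkm.sub hfm))
    (hb.aestronglyMeasurable_reweight hb' hU hfm) (by norm_num)).trans ?_
  gcongr
  have h2 : ∀ᵐ x ∂(volume.restrict U'), ‖reweight b b' (fun x => k x - wgt b (gradient f) x) x‖ ≤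
      Real.sqrt C * ‖(wgradLp U b f - k) x‖ := by
    filter_upwards [hle, ae_mono hm hb.ae_pos, ae_mono hm (Lp.coeFn_sub (wgradLp U b f) k),
      ae_mono hm (coeFn_wgradLp hb hf)] with x hx hpos h3 h4
    rw [h3, Pi.sub_apply, h4, reweight, norm_smul, norm_sub_rev, Real.norm_of_nonneg (by positivity)]
    gcongr
    rw [← div_eq_mul_inv, div_le_iff₀ (Real.sqrt_pos.2 hpos), ← Real.sqrt_mul hC.le]
    exact Real.sqrt_le_sqrt hx
  refine (eLpNorm_le_mul_eLpNorm_of_ae_le_mul h2 2).trans ?_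
  gcongr
  rw [Lp.enorm_def]
  exact eLpNorm_mono_measure _ hm

end comparison

lemma enorm_sq_eq_ofReal {E : Type*} [NormedAddCommGroup E] (v : E) :
    ‖v‖ₑ ^ 2 = ENNReal.ofReal (‖v‖ ^ 2) := by
  rw [← ofReal_norm, ENNReal.ofReal_pow (norm_nonneg v)]

lemma lintegral_enorm_sq_le {K : Set Plane} {F F₀ : Plane → Plane} {d : Plane → ℝ} {c : ℝ}
    (hc : 0 ≤ c) (hF₀ : AEStronglyMeasurable F₀ (volume.restrict K))
    (h : ∀ᵐ x ∂(volume.restrict K), ‖F x‖ ^ 2 ≤ ‖F₀ x‖ ^ 2 + c * |d x|) :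
    ∫⁻ x in K, ‖F x‖ₑ ^ 2 ≤ (∫⁻ x in K, ‖F₀ x‖ₑ ^ 2) +
      ENNReal.ofReal c * eLpNorm d 1 (volume.restrict K) := by
  rw [eLpNorm_one_eq_lintegral_enorm, ← lintegral_const_mul' _ _ (by finiteness),
    ← lintegral_add_left' (hF₀.enorm.pow_const 2)]
  refine lintegral_mono_ae ?_
  filter_upwards [h] with x hx
  rw [enorm_sq_eq_ofReal, enorm_sq_eq_ofReal, Real.enorm_eq_ofReal_abs, ← ENNReal.ofReal_mul hc,
    ← ENNReal.ofReal_add (by positivity) (by positivity)]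
  exact ENNReal.ofReal_le_ofReal hx

/-- Both differences are explicit: `g²/β - g²/b = g²(b - β)/(βb)` and `βg²/b² - g²/b = g²(β -
b)/b²`. They are linear in `|β - b|`, so `L¹` convergence of the depths is enough. -/
lemma sq_weight_le {β b θ L g : ℝ} (hθ : 0 < θ) (hβ : θ ≤ β) (hb : θ ≤ b) (hg : 0 ≤ g)
    (hgL : g ≤ L) : ((Real.sqrt β)⁻¹ * g) ^ 2 ≤ ((Real.sqrt b)⁻¹ * g) ^ 2 +
      (L / θ) ^ 2 * |β - b| ∧
    (Real.sqrt β * (Real.sqrt b)⁻¹ * ((Real.sqrt b)⁻¹ * g)) ^ 2 ≤ ((Real.sqrt b)⁻¹ * g) ^ 2 +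
      (L / θ) ^ 2 * |β - b| := by
  have hβ0 : 0 < β := hθ.trans_le hβ
  have hb0 : 0 < b := hθ.trans_le hb
  simp only [mul_pow, inv_pow, Real.sq_sqrt hβ0.le, Real.sq_sqrt hb0.le]
  constructor
  · have h1 : β⁻¹ * g ^ 2 = b⁻¹ * g ^ 2 + g ^ 2 / (β * b) * (b - β) := by field_simp; ring
    have h2 : g ^ 2 / (β * b) * (b - β) ≤ L ^ 2 / (θ * θ) * |β - b| := by
      refine (mul_le_mul_of_nonneg_left ((le_abs_self _).trans_eq (abs_sub_comm b β))
        (by positivity)).trans ?_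
      gcongr
    rw [h1, div_pow, sq θ]
    linarith
  · have h1 : β * b⁻¹ * (b⁻¹ * g ^ 2) = b⁻¹ * g ^ 2 + g ^ 2 / (b * b) * (β - b) := by
      field_simp; ring
    have h2 : g ^ 2 / (b * b) * (β - b) ≤ L ^ 2 / (θ * θ) * |β - b| := by
      refine (mul_le_mul_of_nonneg_left (le_abs_self _) (by positivity)).trans ?_
      gcongr
    rw [h1, div_pow, sq θ]
    linarith

/-- The energies of a fixed cut-off function converge. -/
lemma IsEvanescent.eventually_energy_lt {Ω : Set Plane} {b : Plane → ℝ} {Ωt I : ℝ → Set Plane}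
    {bε : ℝ → Plane → ℝ} (hΩ : IsPuncturedLake Ω b) (h : IsEvanescent Ω b Ωt I bε) {f : Plane → ℝ}
    (hf : IsCutoff Ω {0} f) {N : ℝ} (hN : 0 < N) (hfN : ‖wgradLp (Ω \ {0}) b f‖ < N) :
    ∀ᶠ ε in 𝓝[>] (0 : ℝ),
      eLpNorm (wgt (bε ε) (gradient f)) 2 (volume.restrict (Ωt ε \ I ε)) < ENNReal.ofReal N ∧
      eLpNorm (reweight b (bε ε) (wgt b (gradient f))) 2 (volume.restrict (Ωt ε \ I ε)) <
        ENNReal.ofReal N := by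
  have hb := hΩ.isDepth
  set K := tsupport (gradient f) with hK
  have hKc : IsCompact K := hf.1.hasCompactSupport_gradient
  have hKΩ : K ⊆ Ω \ {0} := hf.tsupport_gradient
  have hf0 : ∀ x ∉ K, gradient f x = 0 := fun x hx => image_eq_zero_of_notMem_tsupport hx
  obtain ⟨L, hL⟩ := hf.1.continuous_gradient.bounded_above_of_compact_support
    hf.1.hasCompactSupport_gradient
  obtain ⟨θ₁, hθ₁, hlow₁⟩ := hb.lower K hKc hKΩ
  obtain ⟨θ₂, hθ₂, hlow₂⟩ := h.depth_lower K hKc hKΩ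
  set θ := min θ₁ θ₂ with hθ
  have hθ0 : 0 < θ := lt_min hθ₁ hθ₂
  set E := ∫⁻ x in K, ‖wgt b (gradient f) x‖ₑ ^ 2 with hE
  have hred : ∀ {V : Set Plane} (F : Plane → Plane), (∀ x ∉ K, F x = 0) → K ⊆ V →
      eLpNorm F 2 (volume.restrict V) ^ 2 = ∫⁻ x in K, ‖F x‖ₑ ^ 2 := by
    intro V F hF hKV
    have h1 : Function.support (fun x => ‖F x‖ₑ ^ 2) ⊆ K := fun x hx => by
      by_contra hxK
      exact hx (by simp [hF x hxK])
    rw [eLpNorm_two_sq, setLIntegral_eq_of_support_subset (h1.trans hKV),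
      setLIntegral_eq_of_support_subset h1]
  have hEN : E < ENNReal.ofReal N ^ 2 := by
    rw [hE, ← hred (V := Ω \ {0}) _ (fun x hx => by simp [wgt, hf0 x hx]) hKΩ,
      ← enorm_wgradLp hb hf.isGradTest, ← ofReal_norm]
    gcongr
    exact (ENNReal.ofReal_lt_ofReal_iff hN).2 hfN
  -- The energies exceed `E` by at most `(L/θ)²` times the `L¹` distance of the depths on the
  -- support of `∇f`.
  have hlim : Tendsto (fun ε => E + ENNReal.ofReal ((L / θ) ^ 2) *
      eLpNorm (fun x => (Ωt ε \ I ε).indicator (bε ε) x - b x) 1 (volume.restrict K))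
      (𝓝[>] (0 : ℝ)) (𝓝 E) := by
    have := (ENNReal.Tendsto.const_mul (h.depth_tendsto K hKc hKΩ)
      (Or.inr (ENNReal.ofReal_ne_top (r := (L / θ) ^ 2)))).const_add E
    simpa using this
  have hwm : AEStronglyMeasurable (wgt b (gradient f)) (volume.restrict K) :=
    (hf.isGradTest.memLp hb).1.mono_measure (Measure.restrict_mono hKΩ le_rfl)
  filter_upwards [hlow₂, hlim.eventually (gt_mem_nhds hEN), h.eventually_subset hΩ.isOpen hKc hKΩ]
    with ε hlow hε hKε
  have hpt : ∀ᵐ x ∂(volume.restrict K), ‖wgt (bε ε) (gradient f) x‖ ^ 2 ≤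
      ‖wgt b (gradient f) x‖ ^ 2 +
        (L / θ) ^ 2 * |(Ωt ε \ I ε).indicator (bε ε) x - b x| ∧
      ‖reweight b (bε ε) (wgt b (gradient f)) x‖ ^ 2 ≤ ‖wgt b (gradient f) x‖ ^ 2 +
        (L / θ) ^ 2 * |(Ωt ε \ I ε).indicator (bε ε) x - b x| := by
    filter_upwards [hlow, hlow₁, ae_restrict_mem hKc.measurableSet] with x h1 h2 hxK
    rw [Set.indicator_of_mem (hKε hxK)] at h1 ⊢
    have := sq_weight_le hθ0 ((min_le_right _ _).trans h1) ((min_le_left _ _).trans h2)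
      (norm_nonneg _) (hL x)
    simp only [wgt, reweight, norm_smul, norm_mul, norm_inv,
      Real.norm_of_nonneg (Real.sqrt_nonneg _)]
    exact this
  have hfin : ∀ F : Plane → Plane, (∀ x ∉ K, F x = 0) → (∀ᵐ x ∂(volume.restrict K), ‖F x‖ ^ 2 ≤
      ‖wgt b (gradient f) x‖ ^ 2 + (L / θ) ^ 2 * |(Ωt ε \ I ε).indicator (bε ε) x - b x|) →
      eLpNorm F 2 (volume.restrict (Ωt ε \ I ε)) < ENNReal.ofReal N := by
    intro F hF hle
    refine lt_of_pow_lt_pow_left' 2 ?_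
    rw [hred F hF hKε]
    exact (lintegral_enorm_sq_le (by positivity) hwm hle).trans_lt hε
  exact ⟨hfin _ (fun x hx => by simp [wgt, hf0 x hx]) (hpt.mono fun _ hx => hx.1),
    hfin _ (fun x hx => by simp [reweight, wgt, hf0 x hx]) (hpt.mono fun _ hx => hx.2)⟩

/-! ### Uniform bounds -/

lemma h1Norm_le (U : Set Plane) (Φ : Plane → ℝ) (G : Plane → Plane) :
    h1Norm U Φ G ≤ eLpNorm Φ 2 volume + eLpNorm G 2 volume := by
  refine le_trans ?_ (add_le_add (eLpNorm_restrict_le Φ 2 volume U)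
    (eLpNorm_restrict_le G 2 volume U))
  have h1 : ∀ a c : ℝ≥0∞, a ^ 2 + c ^ 2 ≤ (a + c) ^ 2 := fun a c => by
    rw [add_sq]
    gcongr
    exact le_self_add
  refine (ENNReal.rpow_le_rpow (h1 _ _) (by norm_num)).trans ?_
  rw [← ENNReal.rpow_natCast, ← ENNReal.rpow_mul]
  norm_num

lemma IsPhiOne.gradient_ae_zero {Ωt I : Set Plane} {b Φ : Plane → ℝ} {G : Plane → Plane}
    (h : IsIslandLake Ωt I b) (hΦ : IsPhiOne Ωt I b Φ G) :
    G =ᵐ[volume.restrict (Ωt \ I)ᶜ] 0 := by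
  obtain ⟨χ, hχ⟩ := h.exists_cutoff
  have hm := h.isDepth.isOpen.measurableSet
  filter_upwards [(hΦ.2 χ hχ).gradient_ae_zero hm, ae_restrict_mem hm.compl] with x h1 h2
  simpa [hχ.gradient_eq_zero h2] using h1

lemma eLpNorm_eq_of_ae_zero {U : Set Plane} (hU : MeasurableSet U) {G : Plane → Plane}
    (hG : G =ᵐ[volume.restrict Uᶜ] 0) : eLpNorm G 2 volume = eLpNorm G 2 (volume.restrict U) := by
  rw [← eLpNorm_indicator_eq_eLpNorm_restrict hU]
  refine eLpNorm_congr_ae ?_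
  filter_upwards [(ae_restrict_iff' hU.compl).1 hG] with x hx
  by_cases hxU : x ∈ U
  · rw [Set.indicator_of_mem hxU]
  · rw [Set.indicator_of_notMem hxU, hx hxU]; rfl

lemma IsDepth.eLpNorm_le_wgt {U : Set Plane} {b : Plane → ℝ} (hb : IsDepth U b) {M : ℝ}
    (hM : ∀ᵐ x ∂(volume.restrict U), b x ≤ M) (G : Plane → Plane) :
    eLpNorm G 2 (volume.restrict U) ≤
      ENNReal.ofReal (Real.sqrt M) * eLpNorm (wgt b G) 2 (volume.restrict U) := by
  refine eLpNorm_le_mul_eLpNorm_of_ae_le_mul ?_ 2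
  filter_upwards [hb.ae_eq_sqrt_smul G, hM] with x hx hxM
  conv_lhs => rw [hx]
  rw [norm_smul, Real.norm_of_nonneg (Real.sqrt_nonneg _)]
  gcongr

/-- The gradient of the potential is close to the gradient of a cut-off function if the energies
are close. -/
lemma IsPhiOne.eLpNorm_gradient_le {Ωt I : Set Plane} {b Φ : Plane → ℝ} {G : Plane → Plane}
    (h : IsIslandLake Ωt I b) {k : Lp Plane 2 (volume.restrict (Ωt \ I))}
    (hk : IsPotential Ωt I b k) (hΦ : IsPhiOne Ωt I b Φ G) {M : ℝ}
    (hM : ∀ᵐ x ∂(volume.restrict (Ωt \ I)), b x ≤ M) {f : Plane → ℝ} (hf : IsCutoff Ωt I f) :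
    eLpNorm G 2 volume ≤ ENNReal.ofReal (Real.sqrt M * ‖wgradLp (Ωt \ I) b f - k‖) +
      eLpNorm (gradient f) 2 volume := by
  have hb := h.isDepth
  have hfG := hf.isGradTest
  rw [eLpNorm_eq_of_ae_zero hb.isOpen.measurableSet (hΦ.gradient_ae_zero h)]
  have h1 : G = (fun x => G x - gradient f x) + gradient f := by ext1 x; simp
  have hGm := hΦ.1.h10.2.1.restrict (Ωt \ I)
  have hfm := hf.1.memLp_gradient.restrict (Ωt \ I)
  conv_lhs => rw [h1]
  refine (eLpNorm_add_le (hGm.1.sub hfm.1) hfm.1 (by norm_num)).trans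
    (add_le_add ?_ (eLpNorm_restrict_le _ _ _ _))
  refine (hb.eLpNorm_le_wgt hM fun x => G x - gradient f x).trans_eq ?_
  rw [ENNReal.ofReal_mul (Real.sqrt_nonneg _), ofReal_norm, Lp.enorm_def, wgt_sub,
    ← eLpNorm_neg]
  congr 1
  refine eLpNorm_congr_ae ?_
  filter_upwards [h.wgt_ae_eq hk hΦ, Lp.coeFn_sub (wgradLp (Ωt \ I) b f) k, coeFn_wgradLp hb hfG]
    with x h2 h3 h4
  rw [h3, Pi.neg_apply, Pi.sub_apply, Pi.sub_apply, h4, h2, neg_sub]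

/-- The energies of the potentials are bounded below, and a fixed function approximates them. -/
lemma IsEvanescent.eventually_potential {Ω : Set Plane} {b : Plane → ℝ} {Ωt I : ℝ → Set Plane}
    {bε : ℝ → Plane → ℝ} (hΩ : IsPuncturedLake Ω b) (h : IsEvanescent Ω b Ωt I bε)
    {k : Lp Plane 2 (volume.restrict (Ω \ {0}))} (hk : IsPotential Ω {0} b k) {M : ℝ} (hM : 0 < M)
    (hbM : ∀ᵐ x ∂(volume.restrict (Ω \ {0})), b x ≤ M) :
    ∃ f M', IsCutoff Ω {0} f ∧ ‖wgradLp (Ω \ {0}) b f‖ ≤ ‖k‖ + 1 ∧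
      ∀ᶠ ε in 𝓝[>] (0 : ℝ), IsIslandLake (Ωt ε) (I ε) (bε ε) ∧ Ωt ε ⊆ Ω ∧
        IsCutoff (Ωt ε) (I ε) f ∧ (∀ᵐ x ∂(volume.restrict (Ωt ε \ I ε)), bε ε x ≤ M') ∧
        ∀ kε, IsPotential (Ωt ε) (I ε) (bε ε) kε → ‖k‖ / 2 ≤ ‖kε‖ ∧ ‖kε‖ ≤ ‖k‖ + 1 ∧
          Real.sqrt M' * ‖wgradLp (Ωt ε \ I ε) (bε ε) f - kε‖ ≤ 1 := by
  have hs := hΩ.norm_pos hk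
  set s := ‖k‖ with hs'
  obtain ⟨C, hC, hle⟩ := h.depth_le
  have hb := hΩ.isDepth
  -- `t ≤ s` gives the lower bound `s/2`; `t ≤ 1` gives the upper bound `s + 1`; the last entry
  -- makes the unweighted error at most 1 in spite of the family constant `C`. Below, `τ` is chosen
  -- so that `τ + √C τ = t`.
  set t := min (min 1 s) (1 / (2 * (2 * s + 1) * (C * M))) with ht
  have ht0 : 0 < t := by positivity
  have ht1 : t ≤ 1 := (min_le_left _ _).trans (min_le_left _ _)
  have hts : t ≤ s := (min_le_left _ _).trans (min_le_right _ _)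
  have htM : 2 * t * (2 * s + 1) * (C * M) ≤ 1 := by
    have : t ≤ 1 / (2 * (2 * s + 1) * (C * M)) := min_le_right _ _
    rw [le_div_iff₀ (by positivity)] at this
    linarith
  set τ := t / (1 + Real.sqrt C) with hτ
  have hτ0 : 0 < τ := by positivity
  have hτt : τ + Real.sqrt C * τ = t := by rw [hτ]; field_simp
  have hCτ : 0 ≤ Real.sqrt C * τ := by positivity
  obtain ⟨f, hf, hfk⟩ := hk.exists_cutoff hτ0
  have hfN : ‖wgradLp (Ω \ {0}) b f‖ < s + τ := by
    have := norm_le_norm_add_norm_sub' (wgradLp (Ω \ {0}) b f) k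
    linarith
  refine ⟨f, C * M, hf, by linarith, ?_⟩
  obtain ⟨r, -, -, hisl⟩ := h.eventually_island hΩ one_pos
  filter_upwards [h.lake, hisl, hle, h.eventually_isCutoff hΩ hf,
    h.eventually_energy_lt hΩ hf (by positivity) hfN]
    with ε hl ⟨h0, _, _, hsub⟩ hle hfε ⟨hE₁, hE₂⟩
  have hU : Ωt ε \ I ε ⊆ Ω \ {0} :=
    Set.sdiff_subset_sdiff hsub (Set.singleton_subset_iff.2 h0)
  have hbε := hl.isDepth
  have hle' : ∀ᵐ x ∂(volume.restrict (Ωt ε \ I ε)), bε ε x ≤ C * b x := by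
    filter_upwards [ae_restrict_of_ae_restrict_of_subset (Set.sdiff_subset.trans hsub) hle,
      ae_restrict_mem hbε.isOpen.measurableSet] with x hx hxU
    rwa [Set.indicator_of_mem hxU] at hx
  refine ⟨hl, hsub, hfε, ?_, fun kε hkε => ?_⟩
  · filter_upwards [hle', ae_restrict_of_ae_restrict_of_subset hU hbM] with x hx hxM
    exact hx.trans (mul_le_mul_of_nonneg_left hxM hC.le)
  have hN : ‖wgradLp (Ωt ε \ I ε) (bε ε) f‖ < s + τ := by
    rw [← enorm_wgradLp hbε hfε.isGradTest, ← ofReal_norm,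
      ENNReal.ofReal_lt_ofReal_iff (by positivity)] at hE₁
    exact hE₁
  have hup := (hkε.norm_le hbε hfε).trans hN.le
  have hH : eLpNorm (reweight b (bε ε) k) 2 (volume.restrict (Ωt ε \ I ε)) ≤
      ENNReal.ofReal (s + t) := by
    refine (eLpNorm_reweight_le hb hbε hU hC hle' k hf.isGradTest).trans ?_
    rw [show s + t = Real.sqrt C * τ + (s + τ) by linarith,
      ENNReal.ofReal_add hCτ (by positivity), ENNReal.ofReal_mul (Real.sqrt_nonneg _)]
    refine add_le_add (mul_le_mul_right ?_ _) hE₂.le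
    rw [← ofReal_norm]
    exact ENNReal.ofReal_le_ofReal hfk.le
  have hlow := hk.norm_sq_le hkε hb hbε hsub h0 (by positivity) hH
  rw [← hs'] at hlow
  refine ⟨?_, by linarith, ?_⟩
  -- `s² ≤ (s + t)‖kε‖ ≤ 2s‖kε‖`.
  · nlinarith [norm_nonneg kε]
  have hξ := hkε.norm_cutoff_sub_sq hbε hfε
  set ξ := ‖wgradLp (Ωt ε \ I ε) (bε ε) f - kε‖ with hξ'
  -- With `X = (s + t)²` and `Y = s²`, Pythagoras and the capacity bound give `ξ² ≤ X - Y²/X ≤ 2(X -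
  -- Y) = 2t(2s + t)`.
  have h1 : ξ ^ 2 ≤ 2 * t * (2 * s + 1) := by
    have h2 : (s ^ 2) ^ 2 ≤ (s + t) ^ 2 * ‖kε‖ ^ 2 := by
      rw [← mul_pow]
      gcongr
    have h3 : ‖wgradLp (Ωt ε \ I ε) (bε ε) f‖ ^ 2 ≤ (s + t) ^ 2 := by
      gcongr
      linarith
    have h4 : (s + t) ^ 2 - ‖kε‖ ^ 2 ≤ 2 * ((s + t) ^ 2 - s ^ 2) := by
      have h5 : (0 : ℝ) < (s + t) ^ 2 := by positivity
      have h6 : s ^ 2 ≤ (s + t) ^ 2 := by gcongr; linarith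
      refine le_of_mul_le_mul_left ?_ h5
      nlinarith
    nlinarith
  have h2 : (Real.sqrt (C * M) * ξ) ^ 2 ≤ 1 := by
    rw [mul_pow, Real.sq_sqrt (by positivity)]
    calc C * M * ξ ^ 2 ≤ C * M * (2 * t * (2 * s + 1)) := by gcongr
      _ ≤ 1 := by linarith
  nlinarith [sq_nonneg (Real.sqrt (C * M) * ξ - 1)]

/-- The uniform bounds for lakes with an evanescent island. -/
theorem IsPuncturedLake.uniform_bound {Ω : Set Plane} {b : Plane → ℝ}
    (hΩ : IsPuncturedLake Ω b) : ∃ C : ℝ, 0 < C ∧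
      ∀ (Ωt I : ℝ → Set Plane) (bε : ℝ → Plane → ℝ), IsEvanescent Ω b Ωt I bε →
        ∀ᶠ ε in 𝓝[>] (0 : ℝ),
          (ExistsUniqueAE (IsPhiOne (Ωt ε) (I ε) (bε ε)) ∧
            ∀ φ G, IsPhiOne (Ωt ε) (I ε) (bε ε) φ G →
              h1Norm (Ωt ε \ I ε) φ G + weightedNorm (Ωt ε \ I ε) (bε ε) G ≤ ENNReal.ofReal C) ∧
          (ExistsUniqueAE (IsPsiOne (Ωt ε) (I ε) (bε ε)) ∧
            ∀ ψ G, IsPsiOne (Ωt ε) (I ε) (bε ε) ψ G →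
              h1Norm (Ωt ε \ I ε) ψ G + weightedNorm (Ωt ε \ I ε) (bε ε) G ≤ ENNReal.ofReal C) := by
  have hb := hΩ.isDepth
  obtain ⟨k, hk⟩ := exists_isPotential hΩ.isOpen isCompact_singleton
    (Set.singleton_subset_iff.2 hΩ.zero_mem) hb
  have hs := hΩ.norm_pos hk
  set s := ‖k‖ with hs'
  obtain ⟨M, hM, hbM⟩ := hb.bound
  obtain ⟨D, hD, hΩD⟩ := hΩ.isBounded.subset_ball_lt 0 0
  set P := 2 * Real.pi * (3 * D) with hP
  have hP0 : 0 < P := by have := Real.pi_pos; positivity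
  set A := 1 + Real.sqrt M * (s + 1) with hA
  have hA0 : 0 < A := by positivity
  set B := P * A + A with hB
  have hB0 : 0 < B := by positivity
  have hc0 : 0 ≤ ((s / 2) ^ 2)⁻¹ := by positivity
  -- The constant involves only `s`, `M` and the size `D` of `Ω`: `A` bounds the gradient of `φ¹`,
  -- `B` adds the Poincaré bound on `φ¹`, and the factor for `ψ¹` comes from the lower bound `s/2`.
  refine ⟨(B + (s + 1)) + (((s / 2) ^ 2)⁻¹ * B + (s / 2)⁻¹), by positivity, fun Ωt I bε h => ?_⟩
  obtain ⟨f, M', hf, hfs, hev⟩ := h.eventually_potential hΩ hk hM hbM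
  filter_upwards [hev] with ε ⟨hl, hsub, hfε, hM', hpot⟩
  have hbε := hl.isDepth
  obtain ⟨kε, hkε⟩ := exists_isPotential hl.isOpen hl.island_compact hl.island_subset hbε
  obtain ⟨hlow, hup, hξ⟩ := hpot kε hkε
  have hkε0 := hl.norm_pos hkε
  have hbound : ∀ φ G, IsPhiOne (Ωt ε) (I ε) (bε ε) φ G →
      eLpNorm φ 2 volume + eLpNorm G 2 volume ≤ ENNReal.ofReal B := by
    intro φ G hφ
    have h1 : eLpNorm G 2 volume ≤ ENNReal.ofReal A := by
      refine (hφ.eLpNorm_gradient_le hl hkε hM' hfε).trans ?_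
      rw [hA, ENNReal.ofReal_add one_pos.le (by positivity)]
      refine add_le_add (ENNReal.ofReal_le_ofReal hξ) ?_
      rw [eLpNorm_eq_of_ae_zero hb.isOpen.measurableSet (G := gradient f)]
      · refine (hb.eLpNorm_le_wgt hbM _).trans ?_
        rw [← enorm_wgradLp hb hf.isGradTest, ENNReal.ofReal_mul (Real.sqrt_nonneg _), ← ofReal_norm]
        gcongr
      · filter_upwards [ae_restrict_mem hb.isOpen.measurableSet.compl] with x hx
        exact hf.gradient_eq_zero hx
    have h2 := hφ.1.h10.eLpNorm_le hD (hsub.trans hΩD)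
    rw [hB, ENNReal.ofReal_add (by positivity) hA0.le, ENNReal.ofReal_mul hP0.le]
    exact add_le_add (h2.trans (mul_le_mul_right h1 _)) h1
  refine ⟨⟨hl.existsUniqueAE_isPhiOne, fun φ G hφ => ?_⟩,
    hl.existsUniqueAE_isPsiOne, fun ψ G hψ => ?_⟩
  · rw [ENNReal.ofReal_add (by positivity) (by positivity)]
    refine le_add_right ?_
    rw [ENNReal.ofReal_add hB0.le (by positivity), hl.weightedNorm_isPhiOne hkε hφ]
    exact add_le_add ((h1Norm_le _ _ _).trans (hbound φ G hφ)) (ENNReal.ofReal_le_ofReal hup)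
  · rw [ENNReal.ofReal_add (by positivity) (by positivity)]
    refine le_add_left ?_
    rw [ENNReal.ofReal_add (by positivity) (by positivity), hl.weightedNorm_isPsiOne hkε hψ]
    refine add_le_add ((h1Norm_le _ _ _).trans ?_) (ENNReal.ofReal_le_ofReal (by gcongr))
    obtain ⟨Φ, G', hΦ⟩ := hl.exists_isPhiOne
    obtain ⟨h1, h2⟩ := hl.isPsiOne_ae_eq hkε hΦ hψ
    have h3 : (fun x => -(‖kε‖ ^ 2)⁻¹ * Φ x) = (-(‖kε‖ ^ 2)⁻¹) • Φ := rfl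
    have h4 : (fun x => (-(‖kε‖ ^ 2)⁻¹) • G' x) = (-(‖kε‖ ^ 2)⁻¹) • G' := rfl
    rw [eLpNorm_congr_ae h1, eLpNorm_congr_ae h2, h3, h4, eLpNorm_const_smul, eLpNorm_const_smul,
      hl.enorm_neg_inv_sq hkε, ← mul_add, ENNReal.ofReal_mul hc0]
    refine mul_le_mul' (ENNReal.ofReal_le_ofReal (by gcongr)) (hbound Φ G' hΦ)

/-! ### Shrinking discs over a flat bottom -/

lemma isSimplyConnected_of_convex {S : Set Plane} (hS : Convex ℝ S) (hne : S.Nonempty) :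
    IsSimplyConnected S := by
  have := hS.contractibleSpace hne
  exact SimplyConnectedSpace.ofContractible S

lemma isIslandLake_disc {r β : ℝ} (hr : 0 < r) (hr1 : r < 1) (hβ : 0 < β) :
    IsIslandLake (Metric.ball 0 1) (Metric.closedBall 0 r) (fun _ => β) := by
  have hshore : ∀ Ω Γ S : Set Plane, HasShore Ω Γ S (fun _ => β) 0 := fun Ω Γ S =>
    ⟨Set.univ, isOpen_univ, Set.subset_univ _, fun _ => β, β, β, hβ, ae_of_all _ fun x => by simp⟩
  exact
    { isOpen := Metric.isOpen_ball
      isBounded := Metric.isBounded_ball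
      simplyConnected := isSimplyConnected_of_convex (convex_ball 0 1) ⟨0, by simp⟩
      island_compact := isCompact_closedBall 0 r
      island_simplyConnected := isSimplyConnected_of_convex (convex_closedBall 0 r)
        ⟨0, by simpa using hr.le⟩
      island_subset := Metric.closedBall_subset_ball hr1
      island_nontrivial := by
        refine ⟨0, by simpa using hr.le, EuclideanSpace.single 0 r, by simp [abs_of_pos hr], ?_⟩
        intro h0
        have h1 := congrArg (fun x : Plane => x 0) h0
        simp at h1
        exact hr.ne h1
      depth_memLp := memLp_top_const β
      depth_nonneg := ae_of_all _ fun _ => hβ.le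
      depth_lower := fun _ _ _ => ⟨β, hβ, ae_of_all _ fun _ => le_rfl⟩
      outer_shore := ⟨0, le_rfl, hshore _ _ _, fun h => (lt_irrefl _ h).elim⟩
      island_shore := ⟨0, le_rfl, hshore _ _ _, fun h => (lt_irrefl _ h).elim⟩ }

lemma gradient_comp_smul (f : Plane → ℝ) (c : ℝ) (x : Plane) :
    gradient (fun y => f (c • y)) x = c • gradient f (c • x) := by
  simp [gradient, fderiv_comp_smul]

lemma IsCutoff.comp_smul {R ρ : ℝ} {χ : Plane → ℝ}
    (hχ : IsCutoff (Metric.ball 0 R) (Metric.closedBall 0 ρ) χ) {c : ℝ} (hc : 0 < c) :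
    IsCutoff (Metric.ball 0 (R / c)) (Metric.closedBall 0 (ρ / c)) fun x => χ (c • x) := by
  have hcont : Continuous fun x : Plane => c • x := by fun_prop
  refine ⟨⟨hχ.1.smooth.comp (by fun_prop), hχ.1.compactSupp.comp_smul hc.ne', fun x hx => ?_⟩, ?_⟩
  · have h1 := hχ.1.supp_subset (tsupport_comp_subset_preimage χ hcont hx)
    rw [mem_ball_zero_iff, norm_smul, Real.norm_of_nonneg hc.le] at h1
    rw [mem_ball_zero_iff, lt_div_iff₀ hc]
    linarith
  · refine (hcont.tendsto_nhdsSet fun x hx => ?_).eventually hχ.2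
    rw [mem_closedBall_zero_iff, le_div_iff₀ hc] at hx
    rw [mem_closedBall_zero_iff, norm_smul, Real.norm_of_nonneg hc.le]
    linarith

lemma IsCutoff.mono {Ωt Ωt' I I' : Set Plane} {χ : Plane → ℝ} (hχ : IsCutoff Ωt I χ)
    (hΩ : Ωt ⊆ Ωt') (hI : I' ⊆ I) : IsCutoff Ωt' I' χ :=
  ⟨hχ.1.mono hΩ, hχ.2.filter_mono (nhdsSet_mono hI)⟩

lemma norm_sum_sq_le_of_orthogonal {E : Type*} [NormedAddCommGroup E] [InnerProductSpace ℝ E]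
    (w : ℕ → E) {V : ℝ} {N : ℕ} (horth : ∀ i < N, ∀ j < N, i < j → inner ℝ (w i) (w j) = 0)
    (hV : ∀ i < N, ‖w i‖ ^ 2 ≤ V) : ‖∑ i ∈ Finset.range N, w i‖ ^ 2 ≤ N * V := by
  induction N with
  | zero => simp
  | succ N ih =>
    have h1 : inner ℝ (∑ i ∈ Finset.range N, w i) (w N) = 0 := by
      rw [sum_inner]
      refine Finset.sum_eq_zero fun i hi => ?_
      rw [Finset.mem_range] at hi
      exact horth i (by omega) N (by omega) hi
    rw [Finset.sum_range_succ, norm_add_sq_real, h1]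
    have h2 := ih (fun i hi j hj => horth i (by omega) j (by omega)) fun i hi => hV i (by omega)
    have h3 := hV N (by omega)
    push_cast
    linarith

/-- A family of dyadically rescaled cut-off functions shows that the logarithmic capacity of small
discs tends to zero. -/
lemma exists_capacity_disc_le : ∃ W : ℝ, 0 < W ∧ ∀ (N : ℕ) (r β : ℝ), 0 < r → r ≤ (1 / 2) ^ N →
    0 < N → 0 < β → ∀ k, IsPotential (Metric.ball 0 1) (Metric.closedBall 0 r) (fun _ => β) k →
      N * β * ‖k‖ ^ 2 ≤ W := by
  obtain ⟨χ, hχ⟩ := exists_isCutoff (Metric.isOpen_ball (x := (0 : Plane)) (ε := 1))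
    (isCompact_closedBall (0 : Plane) (1 / 2)) (Metric.closedBall_subset_ball (by norm_num))
  obtain ⟨L, hL⟩ := hχ.1.continuous_gradient.bounded_above_of_compact_support
    hχ.1.hasCompactSupport_gradient
  set v := (volume (Metric.ball (0 : Plane) 1)).toReal with hv
  have hvv : volume (Metric.ball (0 : Plane) 1) = ENNReal.ofReal v :=
    (ENNReal.ofReal_toReal measure_ball_lt_top.ne).symm
  have hv0 : 0 ≤ v := ENNReal.toReal_nonneg
  refine ⟨L ^ 2 * v + 1, by positivity, fun N r β hr hrN hN hβ => ?_⟩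
  have hr1 : r < 1 := hrN.trans_lt (pow_lt_one₀ (by norm_num) (by norm_num) hN.ne')
  have hb := (isIslandLake_disc hr hr1 hβ).isDepth
  set U : Set Plane := Metric.ball 0 1 \ Metric.closedBall 0 r with hU
  intro k hk
  set f : ℕ → Plane → ℝ := fun j x => χ ((2 : ℝ) ^ j • x) with hf
  have hfc : ∀ j, IsCutoff (Metric.ball 0 (1 / 2 ^ j)) (Metric.closedBall 0 (1 / 2 / 2 ^ j)) (f j) :=
    fun j => hχ.comp_smul (by positivity)
  have hball : ∀ j : ℕ, (1 : ℝ) / 2 ^ j ≤ 1 := fun j => by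
    rw [div_le_one (by positivity)]
    exact one_le_pow₀ (by norm_num)
  -- `r ≤ 2^(-N) ≤ 2^(-(j+1))`, so the rescaled function still equals 1 near the disc.
  have hfU : ∀ j < N, IsCutoff (Metric.ball 0 1) (Metric.closedBall 0 r) (f j) := by
    intro j hj
    refine (hfc j).mono (Metric.ball_subset_ball (hball j)) (Metric.closedBall_subset_closedBall ?_)
    refine hrN.trans ((pow_le_pow_of_le_one (by norm_num) (by norm_num) hj).trans_eq ?_)
    rw [pow_succ, one_div_pow]
    ring
  -- For `i < j`, the support of `∇f_j` lies where `f_i` is already constant.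
  have horth : ∀ i < N, ∀ j < N, i < j →
      inner ℝ (wgradLp U (fun _ => β) (f i)) (wgradLp U (fun _ => β) (f j)) = 0 := by
    intro i hi j hj hij
    rw [inner_wgradLp hb (hfU j hj).isGradTest]
    refine integral_eq_zero_of_ae ?_
    filter_upwards [coeFn_wgradLp hb (hfU i hi).isGradTest] with x hx
    rw [hx, wgt, wgt, real_inner_smul_left, real_inner_smul_right]
    by_cases hxj : x ∈ Metric.ball (0 : Plane) (1 / 2 ^ j)
    · rw [(hfc i).gradient_eq_zero (x := x)]
      · simp
      · refine fun h => h.2 (Metric.ball_subset_closedBall (Metric.ball_subset_ball ?_ hxj))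
        rw [div_div, ← pow_succ']
        exact one_div_le_one_div_of_le (by positivity) (pow_le_pow_right₀ (by norm_num) hij)
    · rw [(hfc j).gradient_eq_zero (x := x) fun h => hxj h.1]
      simp
  -- The squared gradient grows like `4^j` and the area shrinks like `4^(-j)`, so the bound is
  -- independent of `j`.
  have hnorm : ∀ j < N, ‖wgradLp U (fun _ => β) (f j)‖ ^ 2 ≤ β⁻¹ * (L ^ 2 * v) := by
    intro j hj
    have h1 : ‖wgradLp U (fun _ => β) (f j)‖ₑ ^ 2 ≤ ENNReal.ofReal (β⁻¹ * (L ^ 2 * v)) := by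
      rw [enorm_wgradLp hb (hfU j hj).isGradTest, eLpNorm_two_sq]
      calc _ ≤ ∫⁻ x, ‖wgt (fun _ => β) (gradient (f j)) x‖ₑ ^ 2 := setLIntegral_le_lintegral _ _
        _ ≤ ∫⁻ x, (Metric.ball (0 : Plane) (1 / 2 ^ j)).indicator
              (fun _ => ENNReal.ofReal (β⁻¹ * (2 ^ j * L) ^ 2)) x := by
            refine lintegral_mono fun x => ?_
            by_cases hx : x ∈ Metric.ball (0 : Plane) (1 / 2 ^ j)
            · rw [Set.indicator_of_mem hx, enorm_sq_eq_ofReal]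
              refine ENNReal.ofReal_le_ofReal ?_
              rw [wgt, norm_smul, norm_inv, Real.norm_of_nonneg (Real.sqrt_nonneg _), mul_pow,
                inv_pow, Real.sq_sqrt hβ.le, hf, gradient_comp_smul, norm_smul,
                Real.norm_of_nonneg (by positivity)]
              gcongr
              exact hL _
            · rw [Set.indicator_of_notMem hx, wgt,
                (hfc j).gradient_eq_zero (x := x) fun h => hx h.1]
              simp
        _ = _ := by
            rw [lintegral_indicator_const Metric.isOpen_ball.measurableSet,
              Measure.addHaar_ball_of_pos _ _ (by positivity), hvv,
              ← ENNReal.ofReal_mul (by positivity), ← ENNReal.ofReal_mul (by positivity)]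
            congr 1
            rw [finrank_euclideanSpace, Fintype.card_fin]
            field_simp
    rwa [enorm_sq_eq_ofReal, ENNReal.ofReal_le_ofReal_iff (by positivity)] at h1
  have h1 := norm_sum_sq_le_of_orthogonal (fun j => wgradLp U (fun _ => β) (f j)) horth hnorm
  -- Each of the `N` cut-offs has inner product `‖k‖²` with `k`, whereas the norm of the sum grows
  -- only like `√N`; dividing by `‖k‖ > 0` gives `‖k‖² = O(1/N)`.
  have h2 : inner ℝ k (∑ j ∈ Finset.range N, wgradLp U (fun _ => β) (f j)) = N * ‖k‖ ^ 2 := by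
    rw [inner_sum, Finset.sum_congr rfl fun j hj =>
      hk.inner_cutoff hb (hfU j (Finset.mem_range.1 hj))]
    simp
  have h3 := real_inner_le_norm k (∑ j ∈ Finset.range N, wgradLp U (fun _ => β) (f j))
  rw [h2] at h3
  set S := ‖∑ j ∈ Finset.range N, wgradLp U (fun _ => β) (f j)‖ with hS
  have hN' : (0 : ℝ) < N := by exact_mod_cast hN
  have hk0 := (isIslandLake_disc hr hr1 hβ).norm_pos hk
  have h4 : N * ‖k‖ ≤ S := by
    refine le_of_mul_le_mul_left ?_ hk0
    calc ‖k‖ * (N * ‖k‖) = N * ‖k‖ ^ 2 := by ring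
      _ ≤ _ := h3
  have h5 : (N * ‖k‖) ^ 2 ≤ N * (β⁻¹ * (L ^ 2 * v)) := (by gcongr : _ ≤ S ^ 2).trans h1
  have h6 : N * (N * β * ‖k‖ ^ 2) ≤ N * (L ^ 2 * v) := by
    calc N * (N * β * ‖k‖ ^ 2) = β * (N * ‖k‖) ^ 2 := by ring
      _ ≤ β * (N * (β⁻¹ * (L ^ 2 * v))) := by gcongr
      _ = _ := by field_simp
  linarith [le_of_mul_le_mul_left h6 hN']

lemma le_inv_of_sq_mul_le {M x : ℝ} (hx : 0 < x) (h : M ^ 2 * x ^ 2 ≤ 1) : M ≤ x⁻¹ := by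
  rw [← one_div, le_div_iff₀ hx]
  nlinarith [sq_nonneg (M * x - 1)]

/-- The weighted norm of `∇ψ¹` is `1/‖k‖`, and the capacity `‖k‖²` of the disc tends to zero. For
constant depth the plain norm differs only by the factor `√β`, which stays away from zero. -/
theorem flat_bottom_blowup (r β : ℝ → ℝ) (β₀ : ℝ) (hr : ∀ᶠ ε in 𝓝[>] (0 : ℝ), 0 < r ε)
    (hr0 : Tendsto r (𝓝[>] (0 : ℝ)) (𝓝 0)) (hβ₀ : 0 < β₀)
    (hβ : Tendsto β (𝓝[>] (0 : ℝ)) (𝓝 β₀)) :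
    (∀ᶠ ε in 𝓝[>] (0 : ℝ),
      IsIslandLake (Metric.ball 0 1) (Metric.closedBall 0 (r ε)) (fun _ => β ε) ∧
      ExistsUniqueAE
        (IsPsiOne (Metric.ball 0 1) (Metric.closedBall 0 (r ε)) (fun _ => β ε))) ∧
    ∀ M : ℝ, ∀ᶠ ε in 𝓝[>] (0 : ℝ), ∀ ψ G,
      IsPsiOne (Metric.ball 0 1) (Metric.closedBall 0 (r ε)) (fun _ => β ε) ψ G →
        ENNReal.ofReal M ≤
          eLpNorm G 2 (volume.restrict (Metric.ball 0 1 \ Metric.closedBall 0 (r ε))) ∧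
        ENNReal.ofReal M ≤
          weightedNorm (Metric.ball 0 1 \ Metric.closedBall 0 (r ε)) (fun _ => β ε) G := by
  have hlake : ∀ᶠ ε in 𝓝[>] (0 : ℝ),
      IsIslandLake (Metric.ball 0 1) (Metric.closedBall 0 (r ε)) (fun _ => β ε) := by
    filter_upwards [hr, hr0.eventually (gt_mem_nhds one_pos), hβ.eventually (lt_mem_nhds hβ₀)]
      with ε h1 h2 h3 using isIslandLake_disc h1 h2 h3
  refine ⟨hlake.mono fun ε h => ⟨h, h.existsUniqueAE_isPsiOne⟩, fun M => ?_⟩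
  obtain ⟨W, hW, hcap⟩ := exists_capacity_disc_le
  -- `m` is eventually below both `β` and `β²`: the weighted bound needs `M² W ≤ N β`, the plain one
  -- `M² W ≤ N β²`.
  set m := min (β₀ / 2) ((β₀ / 2) ^ 2) with hm
  have hm0 : 0 < m := by positivity
  obtain ⟨N, hN⟩ := exists_nat_gt (M ^ 2 * W / m)
  have hN0 : (0 : ℝ) < N := lt_of_le_of_lt (by positivity) hN
  rw [div_lt_iff₀ hm0] at hN
  filter_upwards [hlake, hr, hr0.eventually (gt_mem_nhds (show (0 : ℝ) < (1 / 2) ^ N by positivity)),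
    hβ.eventually (lt_mem_nhds (half_lt_self hβ₀))] with ε hl hr1 hr2 hβ1 ψ G hψ
  have hβ2 : 0 < β ε := (half_pos hβ₀).trans hβ1
  obtain ⟨k, hk⟩ := exists_isPotential hl.isOpen hl.island_compact hl.island_subset hl.isDepth
  have hk0 := hl.norm_pos hk
  have h1 := hcap N (r ε) (β ε) hr1 hr2.le (by exact_mod_cast hN0) hβ2 k hk
  have h2 : N * m ≤ N * β ε := by
    gcongr
    exact (min_le_left _ _).trans hβ1.le
  have h3 : N * m ≤ N * β ε ^ 2 := by
    gcongr
    exact (min_le_right _ _).trans (by gcongr)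
  have h4 : M ^ 2 * (N * β ε * ‖k‖ ^ 2) ≤ M ^ 2 * W := by gcongr
  have hw := hl.weightedNorm_isPsiOne hk hψ
  constructor
  · have h5 : weightedNorm (Metric.ball 0 1 \ Metric.closedBall 0 (r ε)) (fun _ => β ε) G =
        ENNReal.ofReal (Real.sqrt (β ε))⁻¹ *
          eLpNorm G 2 (volume.restrict (Metric.ball 0 1 \ Metric.closedBall 0 (r ε))) := by
      rw [weightedNorm, ← Real.enorm_eq_ofReal (by positivity), ← eLpNorm_const_smul]
      rfl
    have h6 : M ≤ Real.sqrt (β ε) * ‖k‖⁻¹ := by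
      have h7 : M * (Real.sqrt (β ε))⁻¹ ≤ ‖k‖⁻¹ := by
        refine le_inv_of_sq_mul_le hk0 ?_
        rw [mul_pow, inv_pow, Real.sq_sqrt hβ2.le]
        refine le_of_mul_le_mul_left ?_ (show 0 < N * β ε ^ 2 by positivity)
        calc N * β ε ^ 2 * (M ^ 2 * (β ε)⁻¹ * ‖k‖ ^ 2) = M ^ 2 * (N * β ε * ‖k‖ ^ 2) := by
              field_simp
          _ ≤ N * β ε ^ 2 * 1 := by linarith
      have h8 := Real.sqrt_pos.2 hβ2
      calc M = Real.sqrt (β ε) * (M * (Real.sqrt (β ε))⁻¹) := by field_simp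
        _ ≤ _ := by gcongr
    refine (ENNReal.ofReal_le_ofReal h6).trans_eq ?_
    rw [ENNReal.ofReal_mul (Real.sqrt_nonneg _), ← hw, h5, ← mul_assoc,
      ← ENNReal.ofReal_mul (Real.sqrt_nonneg _), mul_inv_cancel₀ (Real.sqrt_pos.2 hβ2).ne',
      ENNReal.ofReal_one, one_mul]
  · rw [hw]
    refine ENNReal.ofReal_le_ofReal (le_inv_of_sq_mul_le hk0 ?_)
    refine le_of_mul_le_mul_left ?_ (show 0 < N * β ε by positivity)
    linarith

end LakeEq

end

theorem mainTheorem7 :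
    -- uniform bounds on lakes with an evanescent island
    (∀ (Ω : Set LakeEq.Plane) (b : LakeEq.Plane → ℝ), LakeEq.IsPuncturedLake Ω b →
      ∃ C : ℝ, 0 < C ∧
        ∀ (Ωt I : ℝ → Set LakeEq.Plane) (bε : ℝ → LakeEq.Plane → ℝ),
          LakeEq.IsEvanescent Ω b Ωt I bε →
          ∀ᶠ ε in 𝓝[>] (0 : ℝ),
            (LakeEq.ExistsUniqueAE (LakeEq.IsPhiOne (Ωt ε) (I ε) (bε ε)) ∧
              ∀ φ G, LakeEq.IsPhiOne (Ωt ε) (I ε) (bε ε) φ G →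
                LakeEq.h1Norm (Ωt ε \ I ε) φ G + LakeEq.weightedNorm (Ωt ε \ I ε) (bε ε) G
                  ≤ ENNReal.ofReal C) ∧
            (LakeEq.ExistsUniqueAE (LakeEq.IsPsiOne (Ωt ε) (I ε) (bε ε)) ∧
              ∀ ψ G, LakeEq.IsPsiOne (Ωt ε) (I ε) (bε ε) ψ G →
                LakeEq.h1Norm (Ωt ε \ I ε) ψ G + LakeEq.weightedNorm (Ωt ε \ I ε) (bε ε) G
                  ≤ ENNReal.ofReal C)) ∧
    -- failure of the bound for flat bottoms: shrinking discs in the unit disc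
    (∀ (r β : ℝ → ℝ) (β₀ : ℝ), (∀ᶠ ε in 𝓝[>] (0 : ℝ), 0 < r ε) →
      Tendsto r (𝓝[>] (0 : ℝ)) (𝓝 0) → 0 < β₀ → Tendsto β (𝓝[>] (0 : ℝ)) (𝓝 β₀) →
      (∀ᶠ ε in 𝓝[>] (0 : ℝ),
        LakeEq.IsIslandLake (Metric.ball 0 1) (Metric.closedBall 0 (r ε)) (fun _ => β ε) ∧
        LakeEq.ExistsUniqueAE
          (LakeEq.IsPsiOne (Metric.ball 0 1) (Metric.closedBall 0 (r ε)) (fun _ => β ε))) ∧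
      ∀ M : ℝ, ∀ᶠ ε in 𝓝[>] (0 : ℝ), ∀ ψ G,
        LakeEq.IsPsiOne (Metric.ball 0 1) (Metric.closedBall 0 (r ε)) (fun _ => β ε) ψ G →
          ENNReal.ofReal M ≤
            eLpNorm G 2 (volume.restrict (Metric.ball 0 1 \ Metric.closedBall 0 (r ε))) ∧
          ENNReal.ofReal M ≤
            LakeEq.weightedNorm (Metric.ball 0 1 \ Metric.closedBall 0 (r ε)) (fun _ => β ε) G) := by
  exact ⟨fun _ _ hΩ => hΩ.uniform_bound, LakeEq.flat_bottom_blowup⟩
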